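/- **Setting.** Let $m>0$ and $R>3m$. The Schwarzschild exterior is $M=\{(t^*,r,\omega)\in\mathbb R\times[2m,\infty)\times\mathbb S^2\}$ with metric $$g=-\Omega^2(dt^*)^2+2(1-\Omega^2)\,dt^*dr+(2-\Omega^2)\,dr^2+r^2d\omega^2,\qquad \Omega^2=1-\tfrac{2m}{r},$$ time-oriented so that $dt^*>0$ on future-directed causal vectors. A tangent vector is written $p=(p^{t^*},p^r,\not p)$, where $|\not p|$ is the length of the angular part in the metric $r^2d\omega^2$; put $L=r|\not p|$ and $E=\Omega^2p^{t^*}-(1-\Omega^2)p^r$. For $r>2m$ put $t=t^*-2m\log(r-2m)$, $r^*=r+2m\log(r-2m)-3m-2m\log m$, $u=t-r^*$, $v=t+r^*$, and let $p^u,p^v$ be the corresponding components of $p$. The time function $\tau$ is $t^*$ where $r\le R$ and $u+R+4m\log(R-2m)-3m-2m\log m$ where $r\ge R$. The mass shell $\mathcal P$ is the set of $(x,p)$ with $x\in M$ and $p\neq0$ a future-directed null vector at $x$; $\mathcal P_x$ is its fibre over $x$, and $\mathcal P_0$ its part over $\{\tau=0\}$. On $\mathcal P_x$, parametrised by $(p^r,p^\theta,p^\phi)$,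 let $d\mu_x=\frac{r^2\sin\theta}{E}\,dp^r\,dp^\theta\,dp^\phi$. **Data and solution.** Let $C_r,C_p>0$ and let $f_0:\mathcal P_0\to[0,\infty)$ be bounded and measurable (for instance continuous), with $\|f_0\|_\infty=\sup_{\mathcal P_0}f_0$ and $$\operatorname{supp} f_0\subset\{\,r\le C_r,\ \ p^{t^*},\,|p^r|,\,|\not p|\le C_p\,\}.$$ Let $f$ be the solution of the massless Vlasov equation in $\{\tau>0\}$ with data $f_0$: $f$ is constant along future-directed affinely parametrised null geodesics $(\gamma,\dot\gamma)$ in $\{\tau>0\}$, and on a geodesic that issues from $\{\tau=0\}$ and enters $\{\tau>0\}$ its value is that of $f_0$ at the starting point. A weight $w:\mathcal P\to[0,\infty)$, assumed measurable, is called *bounded in $x$* if for every $K>0$ it is bounded on $\{(x,p)\in\mathcal P: p^{t^*},|p^r|,|\not p|\le K\}$; put $W=\sup_{\operatorname{supp} f}|w|$, with $\operatorname{supp} f$ taken over $\{\tau>0\}$. **Theorem.** There are constants $C,C_0,\mathfrak c>0$, depending only on the ratio $R/m$, such that for all $m,C_r,C_p,f_0,f$ as above the following holds with $\tau_\bullet=C_0\left(m+\frac{C_r^2}{m}\right)$.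 1. If $w$ is bounded in $x$, then $W<\infty$, and for all $x\in M$ with $\tau(x)\ge\tau_\bullet$ $$\int_{\mathcal P_x}wf\,d\mu_x\le C\,W\,\|f_0\|_\infty\,C_p^2C_r^2\,\frac1{r^2}\,e^{-\frac{\mathfrak c}{m}(\tau(x)-\tau_\bullet)}.$$ If moreover $0<\delta<1$ and $r\notin[(3-\delta)m,(3+\delta)m]$, then $$\int_{\mathcal P_x}wf\,d\mu_x\le C\,W\,\|f_0\|_\infty\,C_p^2C_r^2\,\frac1{r^2}\,e^{-\frac{2\mathfrak c}{m}(\tau(x)-\tau_\bullet)}.$$ 2. For $a,b>0$ let $w_{a,b}=\Big||p^r|-\sqrt{\tfrac1{27}-\tfrac{m^2}{r^2}\Omega^2}\,\tfrac Lm\Big|^a|p^r|^b$ and $\mathfrak c_{a,b}=\mathfrak c\min\{1+a,3+2b\}$. For all $x\in M$ with $\tau(x)\ge\tau_\bullet$ $$\int_{\mathcal P_x}w_{a,b}f\,d\mu_x\le C^{2+a+b}\,\|f_0\|_\infty\,\frac{C_r^{2+a}C_p^{2+a+b}}{m^a}\,\frac1{r^2}\,e^{-\frac{\mathfrak c_{a,b}}{m}(\tau(x)-\tau_\bullet)}.$$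 3. For $\kappa>0$ and all $x$ with $r=3m$ and $\tau(x)\ge\tau_\bullet$ $$\int_{\mathcal P_x}|p^r|^\kappa f\,d\mu_x\le C^{2+\kappa}\,\|f_0\|_\infty\,\frac{C_r^{2+\kappa}C_p^{2+\kappa}}{m^{2+\kappa}}\,e^{-\frac{\mathfrak c}{m}(1+\kappa)(\tau(x)-\tau_\bullet)}.$$ 4. For $a,b,d\ge0$ and all $x$ with $r\ge R$ and $\tau(x)\ge\tau_\bullet$ $$\int_{\mathcal P_x}|p^v|^a|p^u|^b|\not p|^d f\,d\mu_x\le C^{2+a+b+d}\,\|f_0\|_\infty\,C_p^{2+a+b+d}\,\frac{C_r^{2(1+b)+d}}{r^{2(1+b)+d}}\,e^{-\frac{\mathfrak c}{m}(\tau(x)-\tau_\bullet)}.$$ -/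

import Mathlib

open MeasureTheory Set

noncomputable section

namespace SchwarzschildVlasov

/-- Euclidean three-space. -/
abbrev E3 := EuclideanSpace ℝ (Fin 3)

/-- Events and tangent vectors of the exterior. The manifold `ℝ × [2m, ∞) × S²` with its coordinates
`(t*, r, ω)` is described through the global chart `(t*, r ω) ∈ ℝ × ℝ³`. A tangent vector is
`p = (p^{t*}, p^r ω + r ω')`, where `ω' ∈ T_ω S²` is the angular velocity. -/
abbrev Event := ℝ × E3

/-- Points of the tangent bundle, in the induced chart. -/
abbrev Phase := Event × Event

/-- The area radius `r`. -/
def radius (x : Event) : ℝ := ‖x.2‖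

/-- `Ω² = 1 - 2m/r`. -/
def Omega2 (m r : ℝ) : ℝ := 1 - 2 * m / r

/-- The exterior, including the horizon `r = 2m`. -/
def exterior (m : ℝ) : Set Event := {x | 2 * m ≤ radius x}

/-- The component `p^r` of a tangent vector at `x`. -/
def pr (x p : Event) : ℝ := inner ℝ x.2 p.2 / radius x

/-- The length of the angular part of `p` in the metric `r² dω²`, which is the Euclidean length of the
part of the spatial vector `p.2` that is tangent to the sphere through `x`. -/
def angNorm (x p : Event) : ℝ := ‖p.2 - (pr x p / radius x) • x.2‖

/-- The Schwarzschild metric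
`-Ω² (dt*)² + 2 (1 - Ω²) dt* dr + (2 - Ω²) dr² + r² dω²`, as a bilinear form. -/
def metric (m : ℝ) (x p q : Event) : ℝ :=
  -Omega2 m (radius x) * (p.1 * q.1)
    + (1 - Omega2 m (radius x)) * (p.1 * pr x q + pr x p * q.1)
    + (2 - Omega2 m (radius x)) * (pr x p * pr x q)
    + (inner ℝ p.2 q.2 - pr x p * pr x q)

/-- Christoffel symbols of the first kind, `Γ_ξ(a, b) = (∂_a g(b, ξ) + ∂_b g(a, ξ) - ∂_ξ g(a, b)) / 2`
for constant vector fields `a, b, ξ` of the chart. -/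
def christoffel (m : ℝ) (x a b ξ : Event) : ℝ :=
  (fderiv ℝ (fun y => metric m y b ξ) x a + fderiv ℝ (fun y => metric m y a ξ) x b
    - fderiv ℝ (fun y => metric m y a b) x ξ) / 2

/-- The mass shell: future-directed (non-zero) null vectors over the exterior. As `∇t*` is timelike on
the whole exterior, a null vector is future-directed exactly when `p^{t*} > 0`. -/
def massShell (m : ℝ) : Set Phase :=
  {z | z.1 ∈ exterior m ∧ metric m z.1 z.2 z.2 = 0 ∧ 0 < z.2.1}

/-- `γ`, with velocity `v`, is on `[0, s₁]` an affinely parametrised future-directed null geodesic in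
the exterior: `g(∇_v v, ξ) = 0` for all `ξ`. -/
def IsNullGeodesic (m s₁ : ℝ) (γ v : ℝ → Event) : Prop :=
  ∀ s ∈ Icc 0 s₁, (γ s, v s) ∈ massShell m ∧ HasDerivWithinAt γ (v s) (Icc 0 s₁) s ∧
    ∃ a : Event, HasDerivWithinAt v a (Icc 0 s₁) s ∧
      ∀ ξ : Event, metric m (γ s) a ξ + christoffel m (γ s) (v s) (v s) ξ = 0

/-- Boyer–Lindquist time `t = t* - 2m log(r - 2m)`. -/
def tBL (m : ℝ) (x : Event) : ℝ := x.1 - 2 * m * Real.log (radius x - 2 * m)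

/-- The Regge–Wheeler radius `r*`, normalised by `r* = 0` at `r = 3m`. -/
def rStar (m : ℝ) (x : Event) : ℝ :=
  radius x + 2 * m * Real.log (radius x - 2 * m) - 3 * m - 2 * m * Real.log m

/-- The double null coordinate `u = t - r*`. -/
def nullU (m : ℝ) (x : Event) : ℝ := tBL m x - rStar m x

/-- The time function: `t*` for `r ≤ R`, and `u + c(R)` for `r ≥ R`. -/
def tau (m R : ℝ) (x : Event) : ℝ :=
  if radius x ≤ R then x.1
  else nullU m x + (R + 4 * m * Real.log (R - 2 * m) - 3 * m - 2 * m * Real.log m)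

/-- The mass shell over the initial hypersurface `{τ = 0}`. -/
def massShell0 (m R : ℝ) : Set Phase := {z ∈ massShell m | tau m R z.1 = 0}

/-- The mass shell over the future `{τ > 0}` of the initial hypersurface. -/
def massShellFuture (m R : ℝ) : Set Phase := {z ∈ massShell m | 0 < tau m R z.1}

/-- The support of `f` as a function on `S`: the relative closure in `S` of `{f ≠ 0}`. -/
def suppOn (S : Set Phase) (f : Phase → ℝ) : Set Phase := closure {z ∈ S | f z ≠ 0} ∩ S

/-- `f` solves the massless Vlasov equation on `{τ > 0}` with data `f₀` on `{τ = 0}`: it is conserved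
along future-directed null geodesics, and takes the value of `f₀` on those that issue from `{τ = 0}`.
(Where `r ≥ R` the hypersurface `{τ = 0}` is null and contains its own radial generators. These never
enter `{τ > 0}`, so that the values of `f₀` on them are not constrained.) -/
structure IsVlasovSolution (m R : ℝ) (f₀ f : Phase → ℝ) : Prop where
  conserved : ∀ (s₁ : ℝ) (γ v : ℝ → Event), 0 ≤ s₁ → IsNullGeodesic m s₁ γ v →
    0 < tau m R (γ 0) → f (γ s₁, v s₁) = f (γ 0, v 0)
  initial : ∀ (s₁ : ℝ) (γ v : ℝ → Event), 0 ≤ s₁ → IsNullGeodesic m s₁ γ v →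
    tau m R (γ 0) = 0 → 0 < tau m R (γ s₁) → f (γ s₁, v s₁) = f₀ (γ 0, v 0)

/-- Non-negative bounded data on the mass shell over `{τ = 0}` whose support satisfies
`r ≤ C_r` and `p^{t*}, |p^r|, |p̸| ≤ C_p`. -/
structure IsInitialDatum (m R Cr Cp : ℝ) (f₀ : Phase → ℝ) : Prop where
  nonneg : ∀ z ∈ massShell0 m R, 0 ≤ f₀ z
  measurable : Measurable fun z : massShell0 m R => f₀ z
  bounded : BddAbove ((fun z => |f₀ z|) '' massShell0 m R)
  support : ∀ z ∈ suppOn (massShell0 m R) f₀,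
    radius z.1 ≤ Cr ∧ z.2.1 ≤ Cp ∧ |pr z.1 z.2| ≤ Cp ∧ angNorm z.1 z.2 ≤ Cp

/-- The supremum norm of the data. -/
def dataNorm (m R : ℝ) (f₀ : Phase → ℝ) : ℝ := sSup ((fun z => |f₀ z|) '' massShell0 m R)

/-- The weight `w` is bounded in `x`. -/
def BoundedInX (m : ℝ) (w : Phase → ℝ) : Prop :=
  ∀ C > 0, BddAbove ((fun z => |w z|) ''
    {z ∈ massShell m | z.2.1 ≤ C ∧ |pr z.1 z.2| ≤ C ∧ angNorm z.1 z.2 ≤ C})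

/-- The energy `E = Ω² p^{t*} - (1 - Ω²) p^r`. -/
def energy (m : ℝ) (x p : Event) : ℝ :=
  Omega2 m (radius x) * p.1 - (1 - Omega2 m (radius x)) * pr x p

/-- The total angular momentum `L = r |p̸|`. -/
def angMom (x p : Event) : ℝ := radius x * angNorm x p

/-- The null vector at `x` with spatial part `q`. Its `t*`-component is the positive root
`((2 - Ω²) (p^r)² + |p̸|²) / (√((p^r)² + Ω² |p̸|²) - (1 - Ω²) p^r)`
of the mass-shell relation; for `r > 2m` this is
`((1 - Ω²) p^r + √((p^r)² + Ω² |p̸|²)) / Ω²` with the numerator made rational, and at `r = 2m`, `p^r < 0`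
it is `|p^r| + |p̸|² / (2 |p^r|)`. See `mem_massShell_iff`. -/
def lift (m : ℝ) (x : Event) (q : E3) : Event :=
  (((2 - Omega2 m (radius x)) * pr x (0, q) ^ 2 + angNorm x (0, q) ^ 2) /
    (√(pr x (0, q) ^ 2 + Omega2 m (radius x) * angNorm x (0, q) ^ 2)
      - (1 - Omega2 m (radius x)) * pr x (0, q)), q)

/-- The measure `dμ_x` on the fibre of the mass shell, which is parametrised by the spatial part `q` of
the momentum: `dμ_x = r² sin θ dp^r dp^θ dp^φ / E = d³q / E`. -/
def fibreMeasure (m : ℝ) (x : Event) : Measure E3 :=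
  (volume.restrict {q : E3 | (x, lift m x q) ∈ massShell m}).withDensity
    fun q => ENNReal.ofReal (energy m x (lift m x q))⁻¹

/-- The moment `∫_{P_x} w f dμ_x ∈ [0, ∞]` of a non-negative `f` with non-negative weight `w`. -/
def moment (m : ℝ) (w f : Phase → ℝ) (x : Event) : ENNReal :=
  ∫⁻ q, ENNReal.ofReal (w (x, lift m x q) * f (x, lift m x q)) ∂(fibreMeasure m x)

/-- `W`, the supremum of `|w|` on the support of the solution `f`. -/
def weightSup (m R : ℝ) (w f : Phase → ℝ) : ℝ :=
  sSup ((fun z => |w z|) '' suppOn (massShellFuture m R) f)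

/-- The weight `w_{a,b} = ||p^r| - √(1/27 - m² Ω² / r²) L/m|^a |p^r|^b`. -/
def weightAB (m a b : ℝ) (z : Phase) : ℝ :=
  |(|pr z.1 z.2| - √(1 / 27 - m ^ 2 / radius z.1 ^ 2 * Omega2 m (radius z.1))
      * (angMom z.1 z.2 / m))| ^ a * |pr z.1 z.2| ^ b

/-- `p^t`, conjugate to Boyer–Lindquist `t = t* - F(r)` with `F' = (1 - Ω²)/Ω²`. -/
def pt (m : ℝ) (x p : Event) : ℝ :=
  p.1 - (1 - Omega2 m (radius x)) / Omega2 m (radius x) * pr x p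

/-- `p^{r*}`, where `dr*/dr = 1/Ω²`. -/
def prStar (m : ℝ) (x p : Event) : ℝ := pr x p / Omega2 m (radius x)

/-- `p^u = p^t - p^{r*}`. -/
def pu (m : ℝ) (x p : Event) : ℝ := pt m x p - prStar m x p

/-- `p^v = p^t + p^{r*}`. -/
def pv (m : ℝ) (x p : Event) : ℝ := pt m x p + prStar m x p

theorem angNorm_sq (x p : Event) (hx : radius x ≠ 0) :
    angNorm x p ^ 2 = ‖p.2‖ ^ 2 - pr x p ^ 2 := by
  have h1 : inner ℝ p.2 x.2 = pr x p * radius x := by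
    rw [real_inner_comm]; unfold pr; field_simp
  unfold angNorm
  rw [norm_sub_sq_real, inner_smul_right, h1, norm_smul, mul_pow, Real.norm_eq_abs, sq_abs]
  change _ - _ + _ * radius x ^ 2 = _
  field_simp
  ring

/-- Over the exterior, a vector with spatial part `q ≠ 0` lies on the mass shell exactly when it is the
lift of `q` and this lift is future-directed. -/
theorem mem_massShell_iff (m : ℝ) (hm : 0 < m) (x : Event) (hx : x ∈ exterior m) (q : E3)
    (hq : q ≠ 0) (s : ℝ) :
    (x, (s, q)) ∈ massShell m ↔ 0 < (lift m x q).1 ∧ (s, q) = lift m x q := by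
  have hx' : 2 * m ≤ radius x := hx
  have hr : 0 < radius x := by linarith
  have ha := angNorm_sq x (0, q) hr.ne'
  have hqn : 0 < ‖q‖ ^ 2 := by positivity
  have hO : 0 ≤ Omega2 m (radius x) := by
    unfold Omega2; rw [sub_nonneg, div_le_one hr]; exact hx'
  have hO1 : Omega2 m (radius x) < 1 := by
    unfold Omega2; have : 0 < 2 * m / radius x := by positivity
    linarith
  have hprs : pr x (s, q) = pr x (0, q) := rfl
  have hAn : 0 ≤ angNorm x (0, q) ^ 2 := sq_nonneg _
  have hmet : metric m x (s, q) (s, q) = -Omega2 m (radius x) * s ^ 2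
      + 2 * (1 - Omega2 m (radius x)) * s * pr x (0, q)
      + ((2 - Omega2 m (radius x)) * pr x (0, q) ^ 2 + angNorm x (0, q) ^ 2) := by
    unfold metric
    rw [hprs, ha, real_inner_self_eq_norm_sq]; ring
  have hmem : (x, (s, q)) ∈ massShell m ↔ metric m x (s, q) (s, q) = 0 ∧ 0 < s :=
    ⟨fun h => h.2, fun h => ⟨hx, h⟩⟩
  have hlift : (lift m x q).1 = ((2 - Omega2 m (radius x)) * pr x (0, q) ^ 2
      + angNorm x (0, q) ^ 2) /
    (√(pr x (0, q) ^ 2 + Omega2 m (radius x) * angNorm x (0, q) ^ 2)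
      - (1 - Omega2 m (radius x)) * pr x (0, q)) := rfl
  have heq : (s, q) = lift m x q ↔ s = (lift m x q).1 :=
    ⟨fun h => by rw [← h], fun h => by rw [h]; rfl⟩
  rw [hmem, heq, hmet, hlift]
  have hApos : 0 < (2 - Omega2 m (radius x)) * pr x (0, q) ^ 2 + angNorm x (0, q) ^ 2 := by
    have : ‖((0 : ℝ), q).2‖ = ‖q‖ := rfl
    rw [this] at ha
    nlinarith [sq_nonneg (pr x (0, q))]
  generalize Omega2 m (radius x) = O at *
  generalize pr x (0, q) = P at *
  generalize angNorm x (0, q) ^ 2 = N at *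
  have hin : 0 ≤ P ^ 2 + O * N := by positivity
  set e := √(P ^ 2 + O * N) with he
  have he2 : e ^ 2 = P ^ 2 + O * N := Real.sq_sqrt hin
  have he0 : 0 ≤ e := Real.sqrt_nonneg _
  set A := (2 - O) * P ^ 2 + N with hA
  have key : e ^ 2 = (1 - O) ^ 2 * P ^ 2 + O * A := by rw [he2, hA]; ring
  have hD0 : 0 ≤ e - (1 - O) * P := by
    have : (1 - O) * P ≤ e := abs_le_of_sq_le_sq' (by nlinarith [mul_nonneg hO hApos.le]) he0 |>.2
    linarith
  constructor
  · rintro ⟨h, hs⟩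
    have h2 : (e - (O * s - (1 - O) * P)) * (e + (O * s - (1 - O) * P)) = 0 := by
      have : O * (-O * s ^ 2 + 2 * (1 - O) * s * P + A) = 0 := by rw [h]; ring
      nlinarith
    have hE : 0 ≤ O * s - (1 - O) * P := by
      by_contra hc
      push Not at hc
      have hP : 0 < P := by
        by_contra hP; push Not at hP
        nlinarith [mul_nonneg hO hs.le]
      nlinarith [mul_pos hs hP]
    have h3 : e = O * s - (1 - O) * P := by
      rcases mul_eq_zero.1 h2 with h4 | h4
      · linarith
      · nlinarith
    have h5 : s * (e - (1 - O) * P) = A := by rw [h3]; linarith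
    have hDpos : 0 < e - (1 - O) * P := by
      rcases hD0.lt_or_eq with h6 | h6
      · exact h6
      · rw [← h6] at h5; linarith
    refine ⟨div_pos hApos hDpos, ?_⟩
    rw [eq_div_iff hDpos.ne']; exact h5
  · rintro ⟨h, hs⟩
    have hDpos : 0 < e - (1 - O) * P := by
      rcases hD0.lt_or_eq with h6 | h6
      · exact h6
      · rw [← h6, div_zero] at h; exact absurd h (lt_irrefl _)
    rw [hs]
    refine ⟨?_, h⟩
    field_simp
    nlinarith

end SchwarzschildVlasov

end

noncomputable section

namespace SchwarzschildVlasov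

/-! Along a null geodesic the radial momentum p = p^r obeys r' = p, p' = L²(r − 3m)/r⁴. The function
1/(27m²) − Ω²/r² has a double zero at r = 3m, hence a smooth signed root s (`trapSlope`), and s s' =
(r − 3m)/r⁴. Therefore p ± sL satisfy the exact scalar linear equations (p ± sL)' = ± L s'(r) (p ±
sL) (`RadialOrbit.exists_rate`). The hyperbolic structure of the photon sphere is thus explicit and
global in r: p + sL expands, p − sL contracts, and the unstable manifold is p = sL.

A geodesic makes at most one stay in r ≤ R = ρm (`RadialOrbit.exists_interior_interval`). Outside, a
virial functional bounds the increase of retarded time by a multiple of the radius at which the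
excursion begins plus a multiple of m (`RadialOrbit.retarded_le`). Hence, up to an amount of order m
+ C_r²/m, all of τ is spent inside, where |p − sL| decays exponentially in t*
(`RadialOrbit.stable_decay`). For L ≥ 2mE this combines contraction with the redshift at the
horizon; for L ≤ 2mE an orbit that stays long must have started exponentially close to the horizon,
so that E itself is exponentially small. The outcome is `RadialOrbit.late_time`: at late times the
momenta in the support fill a slab |p^r − sL| ≤ D with D exponentially small.

The fibre measure d³q/E is singular where E is small. On the support √|p^r| |p̸| is at most a
constant times (m/r) E, so 1/E is dominated by |p^r|^(-1/2) |p̸|^(-1), and the integral of this over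
the slab is at most a multiple of √D times the bound on |p̸|, uniformly in the slope of the slab
(`lintegral_fibre_le`). With the rate 1/(2ρ⁴m) for D, √D decays at the rate 2c/m, where c = 1/(8ρ⁴);
this is `moment_le`. Weights vanishing on the unstable cone add powers of D; for r ≥ R the
components p^u and p̸ add powers of C_r/r (`SupportBounds.far`).

To transport the bounds from the data, each point of the mass shell over {τ > 0} is joined to {τ =
0} by an orbit of a first order system solved backwards (`exists_orbit_backwards`), which is a
geodesic by a computation in Kerr–Schild form (`isNullGeodesic_of_orbit`). -/

/-! ### Integral curves of autonomous fields -/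

open Filter Topology in
/-- A `C¹` field on an open set coincides on a compact subset with a compactly supported `C¹` field. -/
theorem exists_contDiff_compactSupport_eqOn {F : Type*} [NormedAddCommGroup F] [NormedSpace ℝ F]
    [FiniteDimensional ℝ F] {U K : Set F} {v : F → F} (hU : IsOpen U) (hv : ContDiffOn ℝ 1 v U)
    (hK : IsCompact K) (hKU : K ⊆ U) :
    ∃ w : F → F, ContDiff ℝ 1 w ∧ HasCompactSupport w ∧ EqOn w v K := by
  obtain ⟨K', hK', hKK', hK'U⟩ := exists_compact_between hK hU hKU
  obtain ⟨χ, hχ1, hχ0, -⟩ := exists_contMDiffMap_one_nhds_of_subset_interior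
    (modelWithCornersSelf ℝ F) (n := 1) hK.isClosed hKK'
  have hχ : ContDiff ℝ 1 (χ : F → ℝ) := contMDiff_iff_contDiff.1 χ.contMDiff
  refine ⟨fun z => χ z • v z, ?_, ?_, ?_⟩
  · rw [contDiff_iff_contDiffAt]
    intro z
    by_cases hz : z ∈ U
    · exact hχ.contDiffAt.smul (hv.contDiffAt (hU.mem_nhds hz))
    · have hz' : K'ᶜ ∈ 𝓝 z := hK'.isClosed.isOpen_compl.mem_nhds fun h => hz (hK'U h)
      refine (contDiffAt_const (c := (0 : F))).congr_of_eventuallyEq ?_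
      filter_upwards [hz'] with y hy
      rw [hχ0 y hy, zero_smul]
  · refine HasCompactSupport.intro hK' fun z hz => ?_
    rw [hχ0 z hz, zero_smul]
  · intro z hz
    simp only
    rw [hχ1.self_of_nhdsSet z hz, one_smul]

/-- A compactly supported `C¹` field has integral curves on every bounded time interval. -/
theorem exists_integralCurve_of_compactSupport {F : Type*} [NormedAddCommGroup F] [NormedSpace ℝ F]
    [FiniteDimensional ℝ F] {w : F → F} (hw : ContDiff ℝ 1 w) (hc : HasCompactSupport w)
    (z₀ : F) {S : ℝ} (hS : 0 ≤ S) :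
    ∃ Z : ℝ → F, Z 0 = z₀ ∧ ∀ s ∈ Icc 0 S, HasDerivAt Z (w (Z s)) s := by
  have : CompleteSpace F := FiniteDimensional.complete ℝ F
  obtain ⟨K, hK⟩ := hw.lipschitzWith_of_hasCompactSupport hc one_ne_zero
  obtain ⟨M, hM⟩ := hc.exists_bound_of_continuous hw.continuous
  have hM0 : 0 ≤ M := (norm_nonneg _).trans (hM z₀)
  -- The time interval is enlarged beyond [0, S] so that the derivatives at 0 and S are two-sided.
  -- As the field is bounded by M everywhere, a ball of radius M(S + 1) contains the curve.
  have h0 : (0 : ℝ) ∈ Icc (-1) (S + 1) := ⟨by norm_num, by linarith⟩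
  have hPL : IsPicardLindelof (fun _ => w) (tmin := -1) (tmax := S + 1) ⟨0, h0⟩ z₀
      ⟨M * (S + 1), by positivity⟩ 0 ⟨M, hM0⟩ K := by
    refine IsPicardLindelof.of_time_independent (fun x _ => hM x) hK.lipschitzOnWith ?_
    have : max (S + 1 - 0) (0 - (-1)) = S + 1 := by
      rw [max_eq_left] <;> linarith
    change M * max (S + 1 - 0) (0 - (-1)) ≤ M * (S + 1) - 0
    rw [this, sub_zero]
  obtain ⟨Z, hZ0, hZ⟩ := hPL.exists_eq_forall_mem_Icc_hasDerivWithinAt₀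
  refine ⟨Z, hZ0, fun s hs => ?_⟩
  exact (hZ s ⟨by linarith [hs.1], by linarith [hs.2]⟩).hasDerivAt
    (Icc_mem_nhds (by linarith [hs.1]) (by linarith [hs.2]))

/-- An integral curve of a `C¹` field starting in a compact set `K` can be continued within `K` for any
prescribed time, or until it leaves the interior of `K`. -/
theorem exists_integralCurve_until_exit {F : Type*} [NormedAddCommGroup F] [NormedSpace ℝ F]
    [FiniteDimensional ℝ F] {U K : Set F} {v : F → F} (hU : IsOpen U) (hv : ContDiffOn ℝ 1 v U)
    (hK : IsCompact K) (hKU : K ⊆ U) {z₀ : F} (hz₀ : z₀ ∈ K) {S : ℝ} (hS : 0 ≤ S) :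
    ∃ (Z : ℝ → F) (s₁ : ℝ), s₁ ∈ Icc 0 S ∧ Z 0 = z₀ ∧
      (∀ s ∈ Icc 0 s₁, Z s ∈ K ∧ HasDerivAt Z (v (Z s)) s) ∧ (s₁ = S ∨ Z s₁ ∉ interior K) := by
  obtain ⟨w, hw, hwc, hwv⟩ := exists_contDiff_compactSupport_eqOn hU hv hK hKU
  obtain ⟨Z, hZ0, hZ⟩ := exists_integralCurve_of_compactSupport hw hwc z₀ hS
  have hcont : ContinuousOn Z (Icc 0 S) := fun s hs => (hZ s hs).continuousAt.continuousWithinAt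
  by_cases hex : ∀ s ∈ Icc 0 S, Z s ∈ interior K
  · refine ⟨Z, S, ⟨hS, le_rfl⟩, hZ0, fun s hs => ?_, Or.inl rfl⟩
    have h := interior_subset (hex s hs)
    exact ⟨h, hwv h ▸ hZ s hs⟩
  push Not at hex
  set A : Set ℝ := {s ∈ Icc 0 S | Z s ∉ interior K} with hA
  have hAc : IsClosed A := hcont.preimage_isClosed_of_isClosed isClosed_Icc
    isOpen_interior.isClosed_compl
  have hAne : A.Nonempty := let ⟨s, hs, h⟩ := hex; ⟨s, hs, h⟩
  have hAb : BddBelow A := ⟨0, fun s hs => hs.1.1⟩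
  have hmem := hAc.csInf_mem hAne hAb
  set e := sInf A with he
  have hbefore : ∀ s ∈ Ico 0 e, Z s ∈ K := fun s hs => by
    by_contra hc
    have : s ∈ A := ⟨⟨hs.1, hs.2.le.trans hmem.1.2⟩, fun h => hc (interior_subset h)⟩
    exact absurd (csInf_le hAb this) (not_le.2 hs.2)
  -- The first exit time from the interior is only a boundary time: membership in K comes from the
  -- left by closedness, or from the initial condition if e = 0.
  have hek : Z e ∈ K := by
    rcases hmem.1.1.eq_or_lt with h0 | h0
    · rw [← h0, hZ0]; exact hz₀
    · refine (closure_minimal (s := Z '' Ico 0 e) ?_ hK.isClosed) ?_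
      · rintro _ ⟨s, hs, rfl⟩; exact hbefore s hs
      · have : e ∈ closure (Ico 0 e) := by rw [closure_Ico h0.ne]; exact ⟨h0.le, le_rfl⟩
        exact (hZ e hmem.1).continuousAt.continuousWithinAt.mem_closure_image this
  refine ⟨Z, e, hmem.1, hZ0, fun s hs => ?_, Or.inr hmem.2⟩
  have h : Z s ∈ K := by
    rcases hs.2.eq_or_lt with h | h
    · rw [h]; exact hek
    · exact hbefore s ⟨hs.1, h⟩
  exact ⟨h, hwv h ▸ hZ s ⟨hs.1, hs.2.trans hmem.1.2⟩⟩

/-! ### Monotonicity and scalar linear equations -/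

theorem le_of_hasDerivAt_nonneg {f f' : ℝ → ℝ} {a b : ℝ} (hab : a ≤ b)
    (hf : ∀ s ∈ Icc a b, HasDerivAt f (f' s) s) (h : ∀ s ∈ Icc a b, 0 ≤ f' s) : f a ≤ f b := by
  refine (monotoneOn_of_deriv_nonneg (convex_Icc a b)
    (fun s hs => (hf s hs).continuousAt.continuousWithinAt) (fun s hs => ?_) fun s hs => ?_)
    ⟨le_rfl, hab⟩ ⟨hab, le_rfl⟩ hab
  · exact (hf s (interior_subset hs)).differentiableAt.differentiableWithinAt
  · rw [(hf s (interior_subset hs)).deriv]; exact h s (interior_subset hs)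

theorem le_of_hasDerivAt_nonpos {f f' : ℝ → ℝ} {a b : ℝ} (hab : a ≤ b)
    (hf : ∀ s ∈ Icc a b, HasDerivAt f (f' s) s) (h : ∀ s ∈ Icc a b, f' s ≤ 0) : f b ≤ f a := by
  have := le_of_hasDerivAt_nonneg hab (fun s hs => (hf s hs).neg)
    (fun s hs => neg_nonneg.2 (h s hs))
  simpa using this

/-- The coefficient is first extended by constants outside the interval, so that its primitive is
differentiable from both sides at the end points as well. -/
theorem exists_hasDerivAt_of_continuousOn {c : ℝ → ℝ} {a b : ℝ} (hab : a ≤ b)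
    (hc : ContinuousOn c (Icc a b)) : ∃ H : ℝ → ℝ, ∀ s ∈ Icc a b, HasDerivAt H (c s) s := by
  have hcont : Continuous (IccExtend hab ((Icc a b).domRestrict c)) :=
    (continuousOn_iff_continuous_domRestrict.1 hc).Icc_extend'
  refine ⟨fun s => ∫ x in a..s, IccExtend hab ((Icc a b).domRestrict c) x, fun s hs => ?_⟩
  have := intervalIntegral.integral_hasDerivAt_right (hcont.intervalIntegrable a s)
    (hcont.stronglyMeasurableAtFilter _ _) hcont.continuousAt
  rwa [IccExtend_of_mem _ _ hs] at this

/-- Solutions of a scalar linear homogeneous equation with coefficient the derivative of `H` are multiples of `exp H`. -/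
theorem eq_mul_exp_of_hasDerivAt {x H c : ℝ → ℝ} {a b : ℝ}
    (hH : ∀ s ∈ Icc a b, HasDerivAt H (c s) s)
    (hx : ∀ s ∈ Icc a b, HasDerivAt x (c s * x s) s) {s₁ s₂ : ℝ} (h₁ : s₁ ∈ Icc a b)
    (h₂ : s₂ ∈ Icc a b) (h₁₂ : s₁ ≤ s₂) : x s₂ = x s₁ * Real.exp (H s₂ - H s₁) := by
  have hsub : ∀ s ∈ Icc s₁ s₂, s ∈ Icc a b := fun s hs => ⟨h₁.1.trans hs.1, hs.2.trans h₂.2⟩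
  have hd : ∀ s ∈ Icc s₁ s₂, HasDerivAt (fun s => x s * Real.exp (-H s)) 0 s := fun s hs => by
    refine ((hx s (hsub s hs)).mul (hH s (hsub s hs)).neg.exp).congr_deriv ?_
    simp only [Pi.neg_apply]
    ring
  have h1 := le_of_hasDerivAt_nonneg h₁₂ hd fun _ _ => le_rfl
  have h2 := le_of_hasDerivAt_nonpos h₁₂ hd fun _ _ => le_rfl
  have h3 : x s₁ * Real.exp (-H s₁) = x s₂ * Real.exp (-H s₂) := le_antisymm h1 h2
  rw [sub_eq_neg_add, Real.exp_add, ← mul_assoc, h3, mul_assoc, ← Real.exp_add]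
  simp

/-! ### The slope of the stable and unstable manifolds of the photon sphere -/

/-- The factor `√((r + 6m) / (27 m² r³))`. -/
def trapFactor (m r : ℝ) : ℝ := √((r + 6 * m) / (27 * m ^ 2 * r ^ 3))

/-- The signed slope of the stable and unstable manifolds of the photon sphere: null geodesics asymptotic
to it satisfy `p^r = ∓ trapSlope L`, and `trapSlope² = 1/(27 m²) - Ω²/r²`. -/
def trapSlope (m r : ℝ) : ℝ := (r - 3 * m) * trapFactor m r

theorem trapFactor_sq {m r : ℝ} (hm : 0 < m) (hr : 0 < r) :
    trapFactor m r ^ 2 = (r + 6 * m) / (27 * m ^ 2 * r ^ 3) :=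
  Real.sq_sqrt (by positivity)

theorem trapFactor_pos {m r : ℝ} (hm : 0 < m) (hr : 0 < r) : 0 < trapFactor m r :=
  Real.sqrt_pos.2 (by positivity)

/-- This is the factorisation r³ − 27m²(r − 2m) = (r − 3m)²(r + 6m). The double root at the photon
sphere is what permits a smooth signed square root. -/
theorem trapSlope_sq {m r : ℝ} (hm : 0 < m) (hr : 0 < r) :
    trapSlope m r ^ 2 = 1 / (27 * m ^ 2) - (r - 2 * m) / r ^ 3 := by
  rw [trapSlope, mul_pow, trapFactor_sq hm hr]
  field_simp
  ring

theorem hasDerivAt_trapSlope {m r : ℝ} (hm : 0 < m) (hr : 0 < r) :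
    HasDerivAt (trapSlope m) (1 / (r ^ 4 * trapFactor m r)) r := by
  have hf := trapFactor_pos hm hr
  have hq : HasDerivAt (fun x : ℝ => (x + 6 * m) / (27 * m ^ 2 * x ^ 3))
      ((1 * (27 * m ^ 2 * r ^ 3) - (r + 6 * m) * (27 * m ^ 2 * (3 * r ^ 2)))
        / (27 * m ^ 2 * r ^ 3) ^ 2) r := by
    have h1 : HasDerivAt (fun x : ℝ => x + 6 * m) 1 r := (hasDerivAt_id r).add_const _
    have h2 : HasDerivAt (fun x : ℝ => 27 * m ^ 2 * x ^ 3) (27 * m ^ 2 * (3 * r ^ 2)) r := by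
      simpa using (hasDerivAt_pow 3 r).const_mul (27 * m ^ 2)
    exact h1.div h2 (by positivity)
  have h3 := ((hasDerivAt_id r).sub_const (3 * m)).mul (hq.sqrt (by positivity))
  refine h3.congr_deriv ?_
  change 1 * trapFactor m r + (r - 3 * m) * (_ / (2 * trapFactor m r)) = _
  have hs := trapFactor_sq hm hr
  field_simp
  rw [hs]
  field_simp
  ring

/-- Half the derivative of `trapSlope²` is the radial force per unit of L². This identity makes p ±
`trapSlope` L solve decoupled linear equations. -/
theorem trapSlope_mul_deriv {m r : ℝ} (hm : 0 < m) (hr : 0 < r) :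
    trapSlope m r * (1 / (r ^ 4 * trapFactor m r)) = (r - 3 * m) / r ^ 4 := by
  have hf := trapFactor_pos hm hr
  rw [trapSlope]
  field_simp

/-- The bound is 1/√27 < 1/5, attained in the limits r = 2m and r → ∞ where Ω²/r² vanishes. -/
theorem abs_trapSlope_mul_le {m r : ℝ} (hm : 0 < m) (hr : 2 * m ≤ r) :
    |trapSlope m r| * m ≤ 1 / 5 := by
  have hr0 : 0 < r := by linarith
  have h1 := trapSlope_sq hm hr0
  have h2 : 0 ≤ (r - 2 * m) / r ^ 3 := div_nonneg (by linarith) (by positivity)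
  have h3 : trapSlope m r ^ 2 * m ^ 2 ≤ 1 / 27 := by
    rw [h1, sub_mul]
    have : 1 / (27 * m ^ 2) * m ^ 2 = 1 / 27 := by field_simp
    nlinarith [sq_nonneg m]
  refine abs_le_of_sq_le_sq' (a := |trapSlope m r| * m) ?_ (by norm_num) |>.2
  rw [mul_pow, sq_abs]
  linarith

/-- `trapFactor` is largest at the horizon, where it equals 1/(√27 m²) < 1/(5m²). The result bounds
the contraction rate from below in r ≤ ρm. -/
theorem deriv_trapSlope_ge {m r ρ : ℝ} (hm : 0 < m) (hr : 2 * m ≤ r) (hρ : r ≤ ρ * m) :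
    5 / (ρ ^ 4 * m ^ 2) ≤ 1 / (r ^ 4 * trapFactor m r) := by
  have hr0 : 0 < r := by linarith
  have hf := trapFactor_pos hm hr0
  have hρ0 : 0 < ρ := by
    by_contra h
    push Not at h
    nlinarith
  have h1 : trapFactor m r ≤ 1 / (5 * m ^ 2) := by
    refine abs_le_of_sq_le_sq' ?_ (by positivity) |>.2
    rw [trapFactor_sq hm hr0, div_pow, div_le_div_iff₀ (by positivity) (by positivity)]
    have : (r + 6 * m) * m ^ 2 ≤ r ^ 3 := by
      nlinarith [mul_nonneg (sub_nonneg.2 hr) (sub_nonneg.2 hr),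
        mul_nonneg (mul_nonneg (sub_nonneg.2 hr) (sub_nonneg.2 hr)) (sub_nonneg.2 hr),
        mul_nonneg (mul_nonneg hm.le hm.le) (sub_nonneg.2 hr),
        mul_nonneg hm.le (mul_nonneg (sub_nonneg.2 hr) (sub_nonneg.2 hr)), pow_pos hm 3]
    nlinarith [mul_le_mul_of_nonneg_left this (sq_nonneg m), pow_pos hr0 3, pow_pos hm 2,
      mul_pos (pow_pos hr0 3) (pow_pos hm 2)]
  have h2 : r ^ 4 ≤ (ρ * m) ^ 4 := by gcongr
  calc 5 / (ρ ^ 4 * m ^ 2) = 1 / ((ρ * m) ^ 4 * (1 / (5 * m ^ 2))) := by field_simp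
    _ ≤ 1 / (r ^ 4 * trapFactor m r) := by gcongr

/-! ### Radial motion and its hyperbolic coordinates -/

/-- The radial motion of a future-directed null geodesic with energy `E` and angular momentum `L`:
`p = r'`, `k = p^{t*} + p^r`. -/
structure RadialOrbit (m E L S : ℝ) (r p t k : ℝ → ℝ) : Prop where
  m_pos : 0 < m
  E_nonneg : 0 ≤ E
  L_nonneg : 0 ≤ L
  deriv_r : ∀ s ∈ Icc 0 S, HasDerivAt r (p s) s
  deriv_p : ∀ s ∈ Icc 0 S, HasDerivAt p (L ^ 2 * (r s - 3 * m) / r s ^ 4) s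
  deriv_t : ∀ s ∈ Icc 0 S, HasDerivAt t (k s - p s) s
  deriv_k : ∀ s ∈ Icc 0 S, HasDerivAt k (L ^ 2 / r s ^ 3 - m * k s ^ 2 / r s ^ 2) s
  le_r : ∀ s ∈ Icc 0 S, 2 * m ≤ r s
  null : ∀ s ∈ Icc 0 S, k s * (E - p s) * r s ^ 2 = L ^ 2
  energy_eq : ∀ s ∈ Icc 0 S, k s * (r s - 2 * m) = r s * (E + p s)
  future : ∀ s ∈ Icc 0 S, 0 < k s - p s

namespace RadialOrbit

variable {m E L S : ℝ} {r p t k : ℝ → ℝ}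

theorem r_pos (o : RadialOrbit m E L S r p t k) {s : ℝ} (hs : s ∈ Icc 0 S) : 0 < r s := by
  linarith [o.le_r s hs, o.m_pos]

/-- Eliminating k from the two constraints leaves the effective-potential equation E² = p² +
Ω²L²/r², multiplied by r³. -/
theorem radial_eq (o : RadialOrbit m E L S r p t k) {s : ℝ} (hs : s ∈ Icc 0 S) :
    r s ^ 3 * (E ^ 2 - p s ^ 2) = (r s - 2 * m) * L ^ 2 := by
  linear_combination (-(r s ^ 2 * (E - p s))) * o.energy_eq s hs + (r s - 2 * m) * o.null s hs

theorem abs_p_le (o : RadialOrbit m E L S r p t k) {s : ℝ} (hs : s ∈ Icc 0 S) : |p s| ≤ E := by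
  have h1 := o.radial_eq hs
  have h2 : 0 ≤ (r s - 2 * m) * L ^ 2 := mul_nonneg (by linarith [o.le_r s hs]) (sq_nonneg _)
  rw [← h1] at h2
  have h3 := nonneg_of_mul_nonneg_right h2 (pow_pos (o.r_pos hs) 3)
  exact abs_le_of_sq_le_sq (by linarith) o.E_nonneg

theorem k_nonneg (o : RadialOrbit m E L S r p t k) {s : ℝ} (hs : s ∈ Icc 0 S) : 0 ≤ k s := by
  have h1 := o.null s hs
  have h2 := abs_le.1 (o.abs_p_le hs)
  have h3 := o.r_pos hs
  have h4 := o.future s hs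
  by_contra hc
  push Not at hc
  have h5 : 0 ≤ E - p s := by linarith
  have h6 : 0 < E - p s := by linarith [o.E_nonneg]
  have h7 : k s * ((E - p s) * r s ^ 2) < 0 := mul_neg_of_neg_of_pos hc (by positivity)
  nlinarith [sq_nonneg L]

/-- Zero energy forces p = 0, and then k(r − 2m) = 0, which off the horizon contradicts k − p > 0.
-/
theorem E_pos (o : RadialOrbit m E L S r p t k) {s : ℝ} (hs : s ∈ Icc 0 S) (h : 2 * m < r s) :
    0 < E := by
  rcases o.E_nonneg.lt_or_eq with h0 | h0
  · exact h0
  have hp : p s = 0 := by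
    have := o.abs_p_le hs
    rw [← h0] at this
    exact abs_eq_zero.1 (le_antisymm this (abs_nonneg _))
  have h1 := o.energy_eq s hs
  rw [hp, ← h0] at h1
  have h2 := o.future s hs
  rw [hp] at h2
  nlinarith [mul_pos (show 0 < k s by linarith) (sub_pos.2 h)]

theorem t_mono (o : RadialOrbit m E L S r p t k) {u v : ℝ} (hu : 0 ≤ u) (huv : u ≤ v) (hv : v ≤ S) :
    t u ≤ t v :=
  le_of_hasDerivAt_nonneg huv (fun s hs => o.deriv_t s ⟨hu.trans hs.1, hs.2.trans hv⟩)
    fun s hs => (o.future s ⟨hu.trans hs.1, hs.2.trans hv⟩).le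

theorem continuousOn_r (o : RadialOrbit m E L S r p t k) : ContinuousOn r (Icc 0 S) :=
  fun s hs => (o.deriv_r s hs).continuousAt.continuousWithinAt

/-- The coordinates `p ± trapSlope L` along the unstable and stable directions of the photon sphere
evolve by scalar linear equations with opposite rates. -/
theorem exists_rate (o : RadialOrbit m E L S r p t k) (hS : 0 ≤ S) :
    ∃ H : ℝ → ℝ, (∀ u v, 0 ≤ u → u ≤ v → v ≤ S → H u ≤ H v) ∧
      (∀ u v, 0 ≤ u → u ≤ v → v ≤ S → p v + trapSlope m (r v) * L
        = (p u + trapSlope m (r u) * L) * Real.exp (H v - H u)) ∧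
      ∀ u v, 0 ≤ u → u ≤ v → v ≤ S → p v - trapSlope m (r v) * L
        = (p u - trapSlope m (r u) * L) * Real.exp (-(H v - H u)) := by
  have hm := o.m_pos
  have hcont : ContinuousOn (fun s => 1 / (r s ^ 4 * trapFactor m (r s)) * L) (Icc 0 S) := by
    have hr := o.continuousOn_r
    unfold trapFactor
    refine ContinuousOn.mul (ContinuousOn.div continuousOn_const ?_ ?_) continuousOn_const
    · refine (hr.pow 4).mul (ContinuousOn.sqrt (ContinuousOn.div (hr.add continuousOn_const)
        (continuousOn_const.mul (hr.pow 3)) fun s hs => ?_))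
      have := o.r_pos hs
      positivity
    · intro s hs
      have := o.r_pos hs
      have := trapFactor_pos hm this
      unfold trapFactor at this
      positivity
  obtain ⟨H, hH⟩ := exists_hasDerivAt_of_continuousOn hS hcont
  have hslope : ∀ s ∈ Icc 0 S, HasDerivAt (fun s => trapSlope m (r s))
      (1 / (r s ^ 4 * trapFactor m (r s)) * p s) s := fun s hs =>
    (hasDerivAt_trapSlope hm (o.r_pos hs)).comp s (o.deriv_r s hs)
  refine ⟨H, fun u v hu huv hv => ?_, fun u v hu huv hv => ?_, fun u v hu huv hv => ?_⟩
  · refine le_of_hasDerivAt_nonneg huv (fun s hs => hH s ⟨hu.trans hs.1, hs.2.trans hv⟩)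
      fun s hs => ?_
    have h1 := o.r_pos ⟨hu.trans hs.1, hs.2.trans hv⟩
    have h2 := trapFactor_pos hm h1
    exact mul_nonneg (by positivity) o.L_nonneg
  · refine eq_mul_exp_of_hasDerivAt (x := fun s => p s + trapSlope m (r s) * L) hH
      (fun s hs => ?_) ⟨hu, huv.trans hv⟩ ⟨hu.trans huv, hv⟩ huv
    refine ((o.deriv_p s hs).add ((hslope s hs).mul_const L)).congr_deriv ?_
    have h := trapSlope_mul_deriv hm (o.r_pos hs)
    rw [mul_div_assoc, ← h]
    ring
  · have := eq_mul_exp_of_hasDerivAt (x := fun s => p s - trapSlope m (r s) * L)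
      (H := fun s => -H s) (fun s hs => (hH s hs).neg)
      (fun s hs => ?_) ⟨hu, huv.trans hv⟩ ⟨hu.trans huv, hv⟩ huv
    · rw [this]; ring_nf
    refine ((o.deriv_p s hs).sub ((hslope s hs).mul_const L)).congr_deriv ?_
    have h := trapSlope_mul_deriv hm (o.r_pos hs)
    rw [mul_div_assoc, ← h]
    ring

theorem abs_stable_antitone (o : RadialOrbit m E L S r p t k) {u v : ℝ} (hu : 0 ≤ u) (huv : u ≤ v)
    (hv : v ≤ S) : |p v - trapSlope m (r v) * L| ≤ |p u - trapSlope m (r u) * L| := by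
  obtain ⟨H, hH, -, hb⟩ := o.exists_rate (hu.trans (huv.trans hv))
  rw [hb u v hu huv hv, abs_mul, Real.abs_exp]
  refine mul_le_of_le_one_right (abs_nonneg _) (Real.exp_le_one_iff.2 ?_)
  linarith [hH u v hu huv hv]

theorem trapSlope_nonneg {m r : ℝ} (h : 3 * m ≤ r) : 0 ≤ trapSlope m r :=
  mul_nonneg (by linarith) (Real.sqrt_nonneg _)

/-- An orbit that moves outwards outside the photon sphere keeps moving outwards. -/
theorem p_nonneg_later (o : RadialOrbit m E L S r p t k) {u v : ℝ} (hu : 0 ≤ u) (huv : u ≤ v)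
    (hv : v ≤ S) (hr : 3 * m ≤ r u) (hp : 0 ≤ p u) : 0 ≤ p v := by
  obtain ⟨H, hH, ha, hb⟩ := o.exists_rate (hu.trans (huv.trans hv))
  have h1 := hH u v hu huv hv
  have h2 := ha u v hu huv hv
  have h3 := hb u v hu huv hv
  have h4 := mul_nonneg (trapSlope_nonneg hr) o.L_nonneg
  have h5 : 1 ≤ Real.exp (H v - H u) := Real.one_le_exp (by linarith)
  have h6 : Real.exp (-(H v - H u)) ≤ 1 := Real.exp_le_one_iff.2 (by linarith)
  have h7 := Real.exp_pos (-(H v - H u))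
  -- With h = H v − H u, adding the two linear laws gives 2 p(v) = p(u)(e^h + e^(−h)) + y(e^h −
  -- e^(−h)), a sum of non-negative terms.
  generalize trapSlope m (r u) * L = y at *
  nlinarith [mul_nonneg (add_nonneg hp h4) (sub_nonneg.2 h5), mul_nonneg hp h7.le,
    mul_nonneg h4 (sub_nonneg.2 h6)]

/-- An orbit that moves inwards outside the photon sphere has always been moving inwards. -/
theorem p_nonpos_earlier (o : RadialOrbit m E L S r p t k) {u v : ℝ} (hu : 0 ≤ u) (huv : u ≤ v)
    (hv : v ≤ S) (hr : 3 * m ≤ r v) (hp : p v ≤ 0) : p u ≤ 0 := by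
  obtain ⟨H, hH, ha, hb⟩ := o.exists_rate (hu.trans (huv.trans hv))
  have h1 := hH u v hu huv hv
  have h2 := ha u v hu huv hv
  have h3 := hb u v hu huv hv
  have h4 := mul_nonneg (trapSlope_nonneg hr) o.L_nonneg
  have h5 : 1 ≤ Real.exp (H v - H u) := Real.one_le_exp (by linarith)
  have h6 : Real.exp (-(H v - H u)) ≤ 1 := Real.exp_le_one_iff.2 (by linarith)
  have h7 := Real.exp_pos (-(H v - H u))
  have h8 : Real.exp (H v - H u) * Real.exp (-(H v - H u)) = 1 := by
    rw [← Real.exp_add]; simp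
  generalize trapSlope m (r v) * L = y at *
  generalize trapSlope m (r u) * L = z at *
  generalize Real.exp (H v - H u) = e at *
  generalize Real.exp (-(H v - H u)) = e' at *
  -- The two laws are solved backwards: 2 p(u) = p(v)(e + e') − y(e − e') with e' ≤ 1 ≤ e, and both
  -- terms are non-positive.
  have h9 : p u + z = (p v + y) * e' := by rw [h2, mul_assoc, h8, mul_one]
  have h10 : p u - z = (p v - y) * e := by rw [h3, mul_assoc, mul_comm e', h8, mul_one]
  nlinarith [mul_nonneg (neg_nonneg.2 hp) h7.le, mul_nonneg h4 (sub_nonneg.2 h6),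
    mul_nonneg (neg_nonneg.2 hp) (sub_nonneg.2 h5), mul_nonneg h4 (sub_nonneg.2 h5)]

theorem r_mono_of_outgoing (o : RadialOrbit m E L S r p t k) {u v : ℝ} (hu : 0 ≤ u) (huv : u ≤ v)
    (hv : v ≤ S) (hr : 3 * m ≤ r u) (hp : 0 ≤ p u) : r u ≤ r v :=
  le_of_hasDerivAt_nonneg huv (fun s hs => o.deriv_r s ⟨hu.trans hs.1, hs.2.trans hv⟩)
    fun _ hs => o.p_nonneg_later hu hs.1 (hs.2.trans hv) hr hp

theorem r_anti_of_ingoing (o : RadialOrbit m E L S r p t k) {u v : ℝ} (hu : 0 ≤ u) (huv : u ≤ v)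
    (hv : v ≤ S) (hr : 3 * m ≤ r v) (hp : p v ≤ 0) : r v ≤ r u :=
  le_of_hasDerivAt_nonpos huv (fun s hs => o.deriv_r s ⟨hu.trans hs.1, hs.2.trans hv⟩)
    fun _ hs => o.p_nonpos_earlier (hu.trans hs.1) hs.2 hv hr hp

end RadialOrbit

/-! ### Redshift near the horizon and flight time in the far region -/

/-- Squaring makes the positive part differentiable, so that barrier arguments for k reduce to the
monotonicity of one differentiable function. -/
theorem hasDerivAt_max_zero_sq (x : ℝ) : HasDerivAt (fun y : ℝ => max y 0 ^ 2) (2 * max x 0) x := by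
  rcases lt_trichotomy x 0 with h | h | h
  · rw [max_eq_right h.le, mul_zero]
    refine (hasDerivAt_const x (0 : ℝ)).congr_of_eventuallyEq ?_
    filter_upwards [Iio_mem_nhds h] with y hy
    rw [max_eq_right (le_of_lt hy)]; norm_num
  · subst h
    rw [max_self, mul_zero, hasDerivAt_iff_isLittleO_nhds_zero]
    simp only [zero_add, smul_zero, sub_zero, max_self, zero_pow two_ne_zero]
    have h1 : (fun h : ℝ => h ^ 2) =o[nhds 0] fun h : ℝ => h := by
      simpa using Asymptotics.isLittleO_pow_id (𝕜 := ℝ) (n := 2) (by norm_num)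
    refine Asymptotics.IsBigO.trans_isLittleO (Asymptotics.IsBigO.of_bound 1 ?_) h1
    refine Filter.Eventually.of_forall fun y => ?_
    rw [one_mul, Real.norm_eq_abs, Real.norm_eq_abs, abs_of_nonneg (by positivity),
      abs_of_nonneg (by positivity)]
    rcases le_total y 0 with h | h
    · rw [max_eq_right h]; nlinarith
    · rw [max_eq_left h]
  · rw [max_eq_left h.le]
    have h1 : HasDerivAt (fun y : ℝ => y ^ 2) (2 * x) x := by simpa using hasDerivAt_pow 2 x
    refine h1.congr_of_eventuallyEq ?_
    filter_upwards [Ioi_mem_nhds h] with y hy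
    rw [max_eq_left (le_of_lt hy)]

namespace RadialOrbit

variable {m E L S : ℝ} {r p t k : ℝ → ℝ}

/-- Redshift: `k` decreases quadratically as long as it exceeds `L / m`. -/
theorem deriv_k_le (o : RadialOrbit m E L S r p t k) {s : ℝ} (hs : s ∈ Icc 0 S) (hk : L / m ≤ k s) :
    L ^ 2 / r s ^ 3 - m * k s ^ 2 / r s ^ 2 ≤ -(m * k s ^ 2 / (2 * r s ^ 2)) := by
  have hm := o.m_pos
  have hr := o.le_r s hs
  have hr0 := o.r_pos hs
  rw [div_le_iff₀ hm] at hk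
  have h1 : L ^ 2 ≤ (k s * m) ^ 2 := pow_le_pow_left₀ o.L_nonneg hk 2
  have h2 : L ^ 2 / r s ^ 3 ≤ m * k s ^ 2 / (2 * r s ^ 2) := by
    rw [div_le_div_iff₀ (by positivity) (by positivity)]
    have h3 : L ^ 2 * 2 ≤ m * k s ^ 2 * r s := by
      nlinarith [mul_nonneg hm.le (sq_nonneg (k s)),
        mul_le_mul_of_nonneg_left hr (mul_nonneg hm.le (sq_nonneg (k s)))]
    nlinarith [mul_le_mul_of_nonneg_right h3 (sq_nonneg (r s))]
  have h3 : m * k s ^ 2 / r s ^ 2 = m * k s ^ 2 / (2 * r s ^ 2) + m * k s ^ 2 / (2 * r s ^ 2) := by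
    field_simp
    ring
  linarith

/-- Any level above L/m is a barrier: wherever k exceeds it the redshift makes k decrease, so the
squared excess cannot grow from 0. -/
theorem k_le (o : RadialOrbit m E L S r p t k) {B : ℝ} (hB : L / m ≤ B) (h0 : k 0 ≤ B) {s : ℝ}
    (hs : s ∈ Icc 0 S) : k s ≤ B := by
  have hd : ∀ σ ∈ Icc 0 s, HasDerivAt (fun σ => max (k σ - B) 0 ^ 2)
      (2 * max (k σ - B) 0 * (L ^ 2 / r σ ^ 3 - m * k σ ^ 2 / r σ ^ 2)) σ := fun σ hσ =>
    HasDerivAt.comp (h₂ := fun y => max y 0 ^ 2) σ (hasDerivAt_max_zero_sq (k σ - B))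
      ((o.deriv_k σ ⟨hσ.1, hσ.2.trans hs.2⟩).sub_const B)
  have h1 := le_of_hasDerivAt_nonpos hs.1 hd fun σ hσ => by
    have hσ' : σ ∈ Icc 0 S := ⟨hσ.1, hσ.2.trans hs.2⟩
    rcases le_total (k σ) B with h | h
    · rw [max_eq_right (by linarith)]; simp
    · refine mul_nonpos_of_nonneg_of_nonpos (by positivity) ((o.deriv_k_le hσ' (hB.trans h)).trans ?_)
      have := o.m_pos
      exact neg_nonpos.2 (by positivity)
  rw [max_eq_right (by linarith : k 0 - B ≤ 0)] at h1
  have h2 : max (k s - B) 0 = 0 := by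
    have : 0 ≤ max (k s - B) 0 := le_max_right _ _
    nlinarith
  linarith [le_max_left (k s - B) 0]

/-- Outside the photon sphere the retarded time `t* - r - 4m log(r - 2m)` increases by a bounded
amount only. -/
theorem retarded_le (o : RadialOrbit m E L S r p t k) {ρ : ℝ} (hρ : 3 < ρ) {u v : ℝ} (hu : 0 ≤ u)
    (huv : u ≤ v) (hv : v ≤ S) (hr : ∀ s ∈ Icc u v, ρ * m ≤ r s) :
    (1 - 2 / ρ) * ((t v - r v - 4 * m * Real.log (r v - 2 * m))
      - (t u - r u - 4 * m * Real.log (r u - 2 * m))) ≤ 4 * (r u + 3 / (ρ - 3) * m) := by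
  have hm := o.m_pos
  -- A is chosen so that A m (r − 3m) ≥ 3m² on r ≥ ρm; with this, (r + Am)(r − 3m) ≥ ¾ r(r − 2m)
  -- there, although r − 3m may be small compared with r.
  set A := 3 / (ρ - 3) with hA
  have hA0 : 0 < A := div_pos (by norm_num) (by linarith)
  have hA1 : A * (ρ - 3) = 3 := by rw [hA]; field_simp [show ρ - 3 ≠ 0 by linarith]
  set ω := 1 - 2 / ρ with hω
  have hω1 : ω * ρ = ρ - 2 := by rw [hω]; field_simp
  have hsub : ∀ s ∈ Icc u v, s ∈ Icc 0 S := fun s hs => ⟨hu.trans hs.1, hs.2.trans hv⟩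
  -- Virial functional: the retarded time, weighted by ωE/2, plus (r + Am)(E − p). It is
  -- non-increasing, and its second summand lies between 0 and 2E(r + Am), which bounds the gain of
  -- retarded time by the initial radius.
  have hd : ∀ s ∈ Icc u v, HasDerivAt (fun s => ω / 2 * E * (t s - r s
      - 4 * m * Real.log (r s - 2 * m)) + (r s + A * m) * (E - p s))
      (ω / 2 * E * (k s - p s - p s - 4 * m * (p s / (r s - 2 * m)))
        + (p s * (E - p s) + (r s + A * m) * -(L ^ 2 * (r s - 3 * m) / r s ^ 4))) s := by
    intro s hs
    have h2m : r s - 2 * m ≠ 0 := by nlinarith [hr s hs]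
    have h1 := (((o.deriv_t s (hsub s hs)).sub (o.deriv_r s (hsub s hs))).sub
      ((((o.deriv_r s (hsub s hs)).sub_const (2 * m)).log h2m).const_mul (4 * m))).const_mul (ω / 2 * E)
    have h2 := ((o.deriv_r s (hsub s hs)).add_const (A * m)).mul
      ((o.deriv_p s (hsub s hs)).const_sub E)
    exact h1.add h2
  have h := le_of_hasDerivAt_nonpos huv hd fun s hs => ?_
  · have hp := abs_le.1 (o.abs_p_le (hsub u ⟨le_rfl, huv⟩))
    have hpv := abs_le.1 (o.abs_p_le (hsub v ⟨huv, le_rfl⟩))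
    have hE : 0 < E := o.E_pos (hsub u ⟨le_rfl, huv⟩) (by nlinarith [hr u ⟨le_rfl, huv⟩])
    have hru := o.r_pos (hsub u ⟨le_rfl, huv⟩)
    have hrv := o.r_pos (hsub v ⟨huv, le_rfl⟩)
    have hAm : 0 < A * m := by positivity
    have h1 : 0 ≤ (r v + A * m) * (E - p v) := mul_nonneg (by linarith) (by linarith)
    have h2 : (r u + A * m) * (E - p u) ≤ (r u + A * m) * (2 * E) :=
      mul_le_mul_of_nonneg_left (by linarith) (by linarith)
    refine le_of_mul_le_mul_left ?_ (half_pos hE)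
    linarith
  · have hs' := hsub s hs
    have hrs := hr s hs
    have hr0 := o.r_pos hs'
    have hp := abs_le.1 (o.abs_p_le hs')
    have h2m : 0 < r s - 2 * m := by nlinarith
    have hk : k s = r s * (E + p s) / (r s - 2 * m) := by
      rw [eq_div_iff h2m.ne']; exact o.energy_eq s hs'
    have hL : L ^ 2 = r s ^ 3 * (E ^ 2 - p s ^ 2) / (r s - 2 * m) := by
      rw [eq_div_iff h2m.ne', o.radial_eq hs']; ring
    have heq : ω / 2 * E * (k s - p s - p s - 4 * m * (p s / (r s - 2 * m)))
        + (p s * (E - p s) + (r s + A * m) * -(L ^ 2 * (r s - 3 * m) / r s ^ 4))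
        = (E - p s) / (r s * (r s - 2 * m)) * (ω / 2 * E * r s ^ 2 + p s * (r s * (r s - 2 * m))
          - (r s + A * m) * (E + p s) * (r s - 3 * m)) := by
      rw [hk, hL]
      field_simp
      ring
    rw [heq]
    refine mul_nonpos_of_nonneg_of_nonpos (div_nonneg (by linarith) (by positivity)) ?_
    have h1 : ω * r s ≤ r s - 2 * m := by
      rw [hω, sub_mul, one_mul]
      have : 2 * m ≤ 2 / ρ * r s := by
        rw [div_mul_eq_mul_div, le_div_iff₀ (by linarith)]; linarith
      linarith
    have h2 : 3 / 4 * (r s * (r s - 2 * m)) ≤ (r s + A * m) * (r s - 3 * m) := by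
      have h3 : 0 ≤ A * m * (r s - ρ * m) := by
        apply mul_nonneg (by positivity); linarith
      have h4 : A * m * (r s - 3 * m) = A * m * (r s - ρ * m) + 3 * m ^ 2 := by
        linear_combination m ^ 2 * hA1
      nlinarith [sq_nonneg (r s - 3 * m), sq_nonneg m]
    have h5 : ω / 2 * E * r s ^ 2 ≤ E / 2 * (r s * (r s - 2 * m)) := by
      have := mul_le_mul_of_nonneg_left h1 (mul_nonneg o.E_nonneg hr0.le)
      nlinarith
    -- With X = r(r − 2m), the bracket is at most X(E/2 + p − ¾(E + p)) = −(E − p)X/4.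
    have h6 := mul_le_mul_of_nonneg_right h2 (show 0 ≤ E + p s by linarith)
    have h7 : 0 ≤ (E - p s) * (r s * (r s - 2 * m)) := mul_nonneg (by linarith) (by positivity)
    nlinarith

end RadialOrbit

/-! ### Exponential decay of the stable coordinate in a bounded region -/

namespace RadialOrbit

variable {m E L S : ℝ} {r p t k : ℝ → ℝ}

theorem abs_slope_mul_le (o : RadialOrbit m E L S r p t k) {s : ℝ} (hs : s ∈ Icc 0 S) :
    |trapSlope m (r s) * L| ≤ 1 / 5 * (L / m) := by
  have hm := o.m_pos
  have h1 := abs_trapSlope_mul_le hm (o.le_r s hs)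
  have h2 : 0 ≤ L / m := div_nonneg o.L_nonneg hm.le
  calc |trapSlope m (r s) * L| = |trapSlope m (r s)| * m * (L / m) := by
        rw [abs_mul, abs_of_nonneg o.L_nonneg]; field_simp
    _ ≤ _ := by gcongr

theorem abs_stable_le (o : RadialOrbit m E L S r p t k) {s : ℝ} (hs : s ∈ Icc 0 S) :
    |p s - trapSlope m (r s) * L| ≤ E + 1 / 5 * (L / m) :=
  (abs_sub _ _).trans (add_le_add (o.abs_p_le hs) (o.abs_slope_mul_le hs))

/-- Orbits with small impact parameter have no turning points. -/
theorem abs_p_ge (o : RadialOrbit m E L S r p t k) (hLE : L ≤ 2 * m * E) {s : ℝ} (hs : s ∈ Icc 0 S) :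
    9 / 10 * E ≤ |p s| := by
  have hm := o.m_pos
  have hr := o.le_r s hs
  have hr0 := o.r_pos hs
  have h1 := o.radial_eq hs
  have h2 : L ^ 2 ≤ (2 * m * E) ^ 2 := pow_le_pow_left₀ o.L_nonneg hLE 2
  have h3 : (r s - 2 * m) * m ^ 2 * 27 ≤ r s ^ 3 := by
    nlinarith [mul_nonneg (show 0 ≤ r s + 6 * m by linarith) (sq_nonneg (r s - 3 * m))]
  have h4 : r s ^ 3 * (E ^ 2 - p s ^ 2) ≤ r s ^ 3 * (4 / 27 * E ^ 2) := by
    rw [h1]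
    calc (r s - 2 * m) * L ^ 2 ≤ (r s - 2 * m) * (2 * m * E) ^ 2 :=
          mul_le_mul_of_nonneg_left h2 (by linarith)
      _ = 4 / 27 * ((r s - 2 * m) * m ^ 2 * 27) * E ^ 2 := by ring
      _ ≤ 4 / 27 * r s ^ 3 * E ^ 2 := by gcongr
      _ = _ := by ring
  have h5 := le_of_mul_le_mul_left h4 (pow_pos hr0 3)
  refine abs_le_of_sq_le_sq' ?_ (abs_nonneg _) |>.2
  rw [sq_abs]
  nlinarith [sq_nonneg E]

/-- Orbits with small impact parameter do not change their radial direction. -/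
theorem p_sign (o : RadialOrbit m E L S r p t k) (hLE : L ≤ 2 * m * E) (hE : 0 < E) {u v : ℝ}
    (hu : 0 ≤ u) (huv : u ≤ v) (hv : v ≤ S) :
    (9 / 10 * E ≤ p u → 9 / 10 * E ≤ p v) ∧ (p u ≤ -(9 / 10 * E) → p v ≤ -(9 / 10 * E)) := by
  have hm := o.m_pos
  obtain ⟨H, hH, ha, -⟩ := o.exists_rate (hu.trans (huv.trans hv))
  -- The unstable coordinate p + `trapSlope` L never changes sign, and |`trapSlope` L| ≤ 2E/5 is too
  -- small compared with |p| ≥ 9E/10 to alter the sign of p.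
  have h1 := ha u v hu huv hv
  have h2 := Real.exp_pos (H v - H u)
  have h3 := abs_le.1 (o.abs_slope_mul_le (s := u) ⟨hu, huv.trans hv⟩)
  have h4 := abs_le.1 (o.abs_slope_mul_le (s := v) ⟨hu.trans huv, hv⟩)
  have h5 : L / m ≤ 2 * E := by rw [div_le_iff₀ hm]; linarith
  have h6 := o.abs_p_ge hLE (s := v) ⟨hu.trans huv, hv⟩
  constructor
  · intro h
    have h7 : 0 < (p u + trapSlope m (r u) * L) * Real.exp (H v - H u) := mul_pos (by linarith) h2
    rcases le_abs.1 h6 with h8 | h8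
    · exact h8
    · linarith
  · intro h
    have h7 : (p u + trapSlope m (r u) * L) * Real.exp (H v - H u) < 0 :=
      mul_neg_of_neg_of_pos (by linarith) h2
    rcases le_abs.1 h6 with h8 | h8
    · linarith
    · linarith

/-- The contraction rate is proportional to L and useless for small L. Instead |p − `trapSlope` L| ≤
2E, and either the orbit moves outwards, in which case a long stay requires r − 2m, and with it E,
to be exponentially small at the start, or it moves inwards and the elapsed t* is at most 4ρm. -/
theorem stable_decay_of_small_impact (o : RadialOrbit m E L S r p t k) {ρ : ℝ} (hρ : 3 < ρ)
    (hLE : L ≤ 2 * m * E) {u v : ℝ} (hu : 0 ≤ u) (huv : u ≤ v) (hv : v ≤ S)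
    (hr : ∀ s ∈ Icc u v, r s ≤ ρ * m) {B : ℝ} (hkB : k u ≤ B) (hEB : E ≤ B) :
    |p v - trapSlope m (r v) * L|
      ≤ 9 * ρ * B * Real.exp (-(1 / (2 * ρ ^ 4) / m * (t v - t u))) := by
  have hm := o.m_pos
  have hρ0 : 0 < ρ := by linarith
  have hu' : u ∈ Icc 0 S := ⟨hu, huv.trans hv⟩
  have hv' : v ∈ Icc 0 S := ⟨hu.trans huv, hv⟩
  have hsub : ∀ s ∈ Icc u v, s ∈ Icc 0 S := fun s hs => ⟨hu.trans hs.1, hs.2.trans hv⟩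
  have hB0 : 0 ≤ B := o.E_nonneg.trans hEB
  have hLm : L / m ≤ 2 * E := by rw [div_le_iff₀ hm]; linarith
  have hb : |p v - trapSlope m (r v) * L| ≤ 2 * E := by linarith [o.abs_stable_le hv', o.E_nonneg]
  rcases o.E_nonneg.eq_or_lt with hE | hE
  · exact hb.trans (by rw [← hE, mul_zero]; positivity)
  have hρ3 : 1 / ρ ^ 3 ≤ 1 / 27 := by
    apply one_div_le_one_div_of_le (by norm_num)
    calc (27 : ℝ) = 3 ^ 3 := by norm_num
      _ ≤ ρ ^ 3 := by gcongr
  rcases le_abs.1 (o.abs_p_ge hLE hu') with hp | hp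
  · -- outgoing: the distance to the horizon grows exponentially
    have hd : ∀ s ∈ Icc u v, HasDerivAt
        (fun s => (r s - 2 * m) * Real.exp (-(1 / (2 * ρ ^ 4) / m * t s)))
        (p s * Real.exp (-(1 / (2 * ρ ^ 4) / m * t s)) + (r s - 2 * m) *
          (Real.exp (-(1 / (2 * ρ ^ 4) / m * t s)) * -(1 / (2 * ρ ^ 4) / m * (k s - p s)))) s :=
      fun s hs => ((o.deriv_r s (hsub s hs)).sub_const (2 * m)).mul
        (((o.deriv_t s (hsub s hs)).const_mul _).neg.exp)
    have h1 := le_of_hasDerivAt_nonneg huv hd fun s hs => by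
      have hps := (o.p_sign hLE hE hu hs.1 (hs.2.trans hv)).1 hp
      have hpE := (abs_le.1 (o.abs_p_le (hsub s hs))).2
      have hrs := o.le_r s (hsub s hs)
      -- Because (r − 2m)k = r(E + p), the t*-velocity is at most of order mE/(r − 2m) while p ≥
      -- 9E/10; hence r − 2m grows at least exponentially in t*.
      have h2 : (r s - 2 * m) * (k s - p s) ≤ 2 * ρ * m * E := by
        have h3 := o.energy_eq s (hsub s hs)
        have h4 : r s * (E + p s) ≤ ρ * m * (2 * E) :=
          mul_le_mul (hr s hs) (by linarith) (by linarith) (by positivity)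
        nlinarith [mul_nonneg (sub_nonneg.2 hrs) (show 0 ≤ p s by linarith)]
      have h5 : 1 / (2 * ρ ^ 4) / m * ((r s - 2 * m) * (k s - p s)) ≤ 1 / ρ ^ 3 * E := by
        calc 1 / (2 * ρ ^ 4) / m * ((r s - 2 * m) * (k s - p s))
            ≤ 1 / (2 * ρ ^ 4) / m * (2 * ρ * m * E) := by gcongr
          _ = _ := by field_simp
      have h6 : 1 / ρ ^ 3 * E ≤ 1 / 27 * E := by gcongr
      have h7 : 0 ≤ p s - 1 / (2 * ρ ^ 4) / m * ((r s - 2 * m) * (k s - p s)) := by linarith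
      have h8 := mul_nonneg (Real.exp_pos (-(1 / (2 * ρ ^ 4) / m * t s))).le h7
      refine h8.trans_eq ?_
      ring
    have h9 : r u - 2 * m ≤ (r v - 2 * m) * Real.exp (-(1 / (2 * ρ ^ 4) / m * (t v - t u))) := by
      have h10 : Real.exp (-(1 / (2 * ρ ^ 4) / m * (t v - t u)))
          = Real.exp (-(1 / (2 * ρ ^ 4) / m * t v)) / Real.exp (-(1 / (2 * ρ ^ 4) / m * t u)) := by
        rw [← Real.exp_sub]; ring_nf
      rw [h10, ← mul_div_assoc, le_div_iff₀ (Real.exp_pos _)]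
      exact h1
    set X := Real.exp (-(1 / (2 * ρ ^ 4) / m * (t v - t u))) with hX
    have hX0 : 0 < X := Real.exp_pos _
    have h11 : r u - 2 * m ≤ ρ * m * X := h9.trans
      (mul_le_mul_of_nonneg_right (by linarith [hr v ⟨huv, le_rfl⟩]) hX0.le)
    have h12 : r u * E ≤ B * (ρ * m * X) := by
      have h13 := o.energy_eq u hu'
      have h14 : k u * (r u - 2 * m) ≤ B * (ρ * m * X) :=
        mul_le_mul hkB h11 (by linarith [o.le_r u hu']) hB0
      have : 0 ≤ r u * p u := mul_nonneg (o.r_pos hu').le (by linarith)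
      linarith
    have h15 : 2 * m * E ≤ m * (B * ρ * X) := by
      have := mul_le_mul_of_nonneg_right (o.le_r u hu') hE.le
      linarith
    have h16 : 2 * E ≤ B * ρ * X := by
      refine le_of_mul_le_mul_left ?_ hm
      linarith
    have : 0 ≤ B * ρ * X := by positivity
    linarith
  · -- ingoing: the orbit reaches the horizon in bounded time
    have hd : ∀ s ∈ Icc u v, HasDerivAt (fun s => t s + 4 * r s) (k s - p s + 4 * p s) s :=
      fun s hs => (o.deriv_t s (hsub s hs)).add ((o.deriv_r s (hsub s hs)).const_mul 4)
    have h1 := le_of_hasDerivAt_nonpos huv hd fun s hs => by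
      have hps := (o.p_sign hLE hE hu hs.1 (hs.2.trans hv)).2 (by linarith)
      have hrs := o.le_r s (hsub s hs)
      have h2 := o.null s (hsub s hs)
      have hk := o.k_nonneg (hsub s hs)
      have h3 : L ^ 2 ≤ (2 * m * E) ^ 2 := pow_le_pow_left₀ o.L_nonneg hLE 2
      -- For inward motion E − p ≥ E and r ≥ 2m, so the null constraint with L ≤ 2mE yields k ≤ E.
      -- Then t* + 4r has derivative k + 3p ≤ E − 27E/10 < 0.
      have h4 : k s * (E * (2 * m) ^ 2) ≤ k s * ((E - p s) * r s ^ 2) := by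
        refine mul_le_mul_of_nonneg_left ?_ hk
        exact mul_le_mul (by linarith) (by gcongr) (by positivity) (by linarith)
      have h5 : (4 * m ^ 2 * E) * k s ≤ (4 * m ^ 2 * E) * E := by nlinarith
      have h6 := le_of_mul_le_mul_left h5 (by positivity)
      linarith
    have h2 : t v - t u ≤ 4 * ρ * m := by
      linarith [hr u ⟨le_rfl, huv⟩, o.r_pos hv']
    have h3 : 1 / (2 * ρ ^ 4) / m * (t v - t u) ≤ 2 * (1 / ρ ^ 3) := by
      calc 1 / (2 * ρ ^ 4) / m * (t v - t u) ≤ 1 / (2 * ρ ^ 4) / m * (4 * ρ * m) := by gcongr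
        _ = _ := by field_simp; norm_num
    have h4 := Real.add_one_le_exp (-(1 / (2 * ρ ^ 4) / m * (t v - t u)))
    have h5 : 1 / 2 ≤ Real.exp (-(1 / (2 * ρ ^ 4) / m * (t v - t u))) := by linarith
    have h6 : 9 * 3 * B * (1 / 2) ≤ 9 * ρ * B * Real.exp (-(1 / (2 * ρ ^ 4) / m * (t v - t u))) := by
      gcongr
    linarith

/-- The squared stable coordinate, together with the excess of `k` over `L / m`. -/
def trapEnergy (m L r p k : ℝ) : ℝ := (p - trapSlope m r * L) ^ 2 + max (k - L / m) 0 ^ 2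

/-- Here b is the stable coordinate, l = L/m, P the t*-velocity, G the contraction rate, D the
derivative of k and x the claimed decay rate in t*. Contraction is proportional to l while P may be
as large as k, so for k much larger than l it does not give decay in t*; the redshift of the excess
k − l takes over. For k ≤ l contraction suffices; for l ≤ k ≤ 2l contraction handles b² and redshift
the excess; for k ≥ 2l the sum b² + (k − l)² is at most k², and the redshift pays for both. -/
theorem trapEnergy_rate_nonpos {b k l G D x y P : ℝ} (hx0 : 0 < x) (hxy : x ≤ y / 9)
    (hb : b ^ 2 ≤ l ^ 2) (hl : 0 ≤ l) (hk : 0 ≤ k) (hP : P ≤ k + l / 2) (hG : 5 * x * l ≤ G)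
    (hD : l ≤ k → D ≤ -(y / 2 * k ^ 2)) :
    2 * b * (-(G * b)) + 2 * max (k - l) 0 * D + (b ^ 2 + max (k - l) 0 ^ 2) * (x * P) ≤ 0 := by
  have hpart : ∀ c, 0 ≤ c → c * (x * P) ≤ c * (x * (k + l / 2)) := fun c hc => by gcongr
  have hy0 : 0 < y := by linarith
  have hG0 := mul_le_mul_of_nonneg_left hG (sq_nonneg b)
  have hbx : 0 ≤ b ^ 2 * (x * l) := by positivity
  rcases le_total k l with h1 | h1
  · rw [max_eq_right (by linarith)]
    have h2 := hpart (b ^ 2) (sq_nonneg b)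
    have h4 : b ^ 2 * (x * (k + l / 2)) ≤ b ^ 2 * (x * (2 * l)) := by
      gcongr; linarith
    linarith
  · rw [max_eq_left (by linarith)]
    have hD' := mul_le_mul_of_nonneg_left (hD h1) (show 0 ≤ 2 * (k - l) by linarith)
    have h2 := hpart (b ^ 2 + (k - l) ^ 2) (by positivity)
    have h6 : x * (k + l / 2) ≤ y / 9 * (2 * k) :=
      mul_le_mul hxy (by linarith) (by linarith) (by linarith)
    have hxk : 0 ≤ x * (k + l / 2) := by positivity
    rcases le_total k (2 * l) with h3 | h3
    · have h4 : b ^ 2 * (x * (k + l / 2)) ≤ b ^ 2 * (x * (5 * l)) := by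
        gcongr; linarith
      have h5 : (k - l) ^ 2 * (x * (k + l / 2)) ≤ (k - l) * k * (y / 9 * (2 * k)) := by
        have : (k - l) ^ 2 ≤ (k - l) * k := by nlinarith
        exact mul_le_mul this h6 hxk (mul_nonneg (by linarith) hk)
      have h7 : 0 ≤ (k - l) * k * (y * k) :=
        mul_nonneg (mul_nonneg (by linarith) hk) (by positivity)
      linarith
    · have h4 : b ^ 2 + (k - l) ^ 2 ≤ k ^ 2 := by nlinarith
      have h5 : (b ^ 2 + (k - l) ^ 2) * (x * (k + l / 2)) ≤ k ^ 2 * (y / 9 * (2 * k)) :=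
        mul_le_mul h4 h6 hxk (by positivity)
      have h7 : k / 2 * (y * k ^ 2) ≤ (k - l) * (y * k ^ 2) := by
        gcongr; linarith
      have h8 : 0 ≤ k ^ 2 * (y * k) := by positivity
      linarith

/-- `trapEnergy` times exp(t*/(ρ⁴m)) is a Lyapunov function. Since `trapEnergy` dominates the square
of the stable coordinate, the rate is halved in the conclusion. The assumption on L gives E ≤
L/(2m), so that the stable coordinate is bounded by L/m. -/
theorem stable_decay_of_large_impact (o : RadialOrbit m E L S r p t k) {ρ : ℝ} (hρ : 3 < ρ)
    (hLE : 2 * m * E ≤ L) {u v : ℝ} (hu : 0 ≤ u) (huv : u ≤ v) (hv : v ≤ S)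
    (hr : ∀ s ∈ Icc u v, r s ≤ ρ * m) {B : ℝ} (hkB : k u ≤ B) (hLB : L / m ≤ B) :
    |p v - trapSlope m (r v) * L|
      ≤ 2 * B * Real.exp (-(1 / (2 * ρ ^ 4) / m * (t v - t u))) := by
  have hm := o.m_pos
  have hρ0 : 0 < ρ := by linarith
  have hu' : u ∈ Icc 0 S := ⟨hu, huv.trans hv⟩
  have hsub : ∀ s ∈ Icc u v, s ∈ Icc 0 S := fun s hs => ⟨hu.trans hs.1, hs.2.trans hv⟩
  have hl0 : 0 ≤ L / m := div_nonneg o.L_nonneg hm.le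
  have hB0 : 0 ≤ B := hl0.trans hLB
  have hEl : E ≤ L / m / 2 := by
    rw [div_div, le_div_iff₀ (by positivity)]; linarith
  have hd : ∀ s ∈ Icc u v, HasDerivAt
      (fun s => trapEnergy m L (r s) (p s) (k s) * Real.exp (1 / ρ ^ 4 / m * t s))
      ((2 * (p s - trapSlope m (r s) * L) * (-(1 / (r s ^ 4 * trapFactor m (r s)) * L
          * (p s - trapSlope m (r s) * L)))
        + 2 * max (k s - L / m) 0 * (L ^ 2 / r s ^ 3 - m * k s ^ 2 / r s ^ 2))
        * Real.exp (1 / ρ ^ 4 / m * t s) + trapEnergy m L (r s) (p s) (k s)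
        * (Real.exp (1 / ρ ^ 4 / m * t s) * (1 / ρ ^ 4 / m * (k s - p s)))) s := by
    intro s hs
    have hs' := hsub s hs
    have h1 : HasDerivAt (fun s => p s - trapSlope m (r s) * L)
        (-(1 / (r s ^ 4 * trapFactor m (r s)) * L * (p s - trapSlope m (r s) * L))) s := by
      refine ((o.deriv_p s hs').sub ((((hasDerivAt_trapSlope hm (o.r_pos hs')).comp s
        (o.deriv_r s hs'))).mul_const L)).congr_deriv ?_
      rw [mul_div_assoc, ← trapSlope_mul_deriv hm (o.r_pos hs')]
      ring
    have h2 : HasDerivAt (fun s => (p s - trapSlope m (r s) * L) ^ 2) (2 * (p s - trapSlope m (r s) * L)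
        * (-(1 / (r s ^ 4 * trapFactor m (r s)) * L * (p s - trapSlope m (r s) * L)))) s := by
      simpa using h1.fun_pow 2
    have h3 := HasDerivAt.comp (h₂ := fun y => max y 0 ^ 2) s (hasDerivAt_max_zero_sq (k s - L / m))
      ((o.deriv_k s hs').sub_const (L / m))
    exact (h2.add h3).mul ((o.deriv_t s hs').const_mul _).exp
  have h := le_of_hasDerivAt_nonpos huv hd fun s hs => by
    have hs' := hsub s hs
    have hk := o.k_nonneg hs'
    have hp := abs_le.1 (o.abs_p_le hs')
    have hrs := o.le_r s hs'
    have hr0 := o.r_pos hs'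
    have hp0 := o.future s hs'
    have hslope := deriv_trapSlope_ge hm hrs (hr s hs)
    have hb : |p s - trapSlope m (r s) * L| ≤ L / m := by linarith [o.abs_stable_le hs']
    have hlL : L = L / m * m := by field_simp
    have hkd := o.deriv_k_le hs'
    have hρ4 : 1 / ρ ^ 4 ≤ 1 / (9 * ρ ^ 2) := by
      apply one_div_le_one_div_of_le (by positivity)
      have : ρ ^ 4 = ρ ^ 2 * ρ ^ 2 := by ring
      rw [this]
      gcongr
      nlinarith
    have hr2 : 1 / (2 * ρ ^ 2 * m) ≤ m / (2 * r s ^ 2) := by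
      rw [div_le_div_iff₀ (by positivity) (by positivity)]
      have : r s ^ 2 ≤ (ρ * m) ^ 2 := pow_le_pow_left₀ hr0.le (hr s hs) 2
      nlinarith
    have hkd' : L / m ≤ k s → L ^ 2 / r s ^ 3 - m * k s ^ 2 / r s ^ 2
        ≤ -(1 / (2 * ρ ^ 2 * m) * k s ^ 2) := fun h => by
      refine (hkd h).trans (neg_le_neg ?_)
      calc 1 / (2 * ρ ^ 2 * m) * k s ^ 2 ≤ m / (2 * r s ^ 2) * k s ^ 2 := by gcongr
        _ = _ := by ring
    have hrate : 5 * (1 / ρ ^ 4) / m * (L / m) ≤ 1 / (r s ^ 4 * trapFactor m (r s)) * L := by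
      calc 5 * (1 / ρ ^ 4) / m * (L / m) = 5 / (ρ ^ 4 * m ^ 2) * L := by field_simp
        _ ≤ _ := mul_le_mul_of_nonneg_right hslope o.L_nonneg
    unfold trapEnergy
    set b := p s - trapSlope m (r s) * L
    set l := L / m
    set D := L ^ 2 / r s ^ 3 - m * k s ^ 2 / r s ^ 2
    set G := 1 / (r s ^ 4 * trapFactor m (r s)) * L
    set q := 1 / ρ ^ 4
    have hq0 : 0 < q := by positivity
    have hbsq : b ^ 2 ≤ l ^ 2 := by rw [← sq_abs b]; exact pow_le_pow_left₀ (abs_nonneg _) hb 2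
    have hqm : q / m ≤ 1 / (9 * ρ ^ 2 * m) := by
      calc q / m ≤ 1 / (9 * ρ ^ 2) / m := by gcongr
        _ = _ := by field_simp
    set y := 1 / (ρ ^ 2 * m) with hy
    have hy0 : 0 < y := by positivity
    have hy1 : 1 / (2 * ρ ^ 2 * m) = y / 2 := by rw [hy]; field_simp
    have hy2 : 1 / (9 * ρ ^ 2 * m) = y / 9 := by rw [hy]; field_simp
    rw [hy1] at hkd'
    rw [hy2] at hqm
    have hqm0 : 0 < q / m := by positivity
    have hrate' : 5 * (q / m) * l ≤ G := by rw [mul_div_assoc] at hrate; exact hrate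
    have hkey : 2 * b * (-(G * b)) + 2 * max (k s - l) 0 * D
        + (b ^ 2 + max (k s - l) 0 ^ 2) * (q / m * (k s - p s)) ≤ 0 :=
      trapEnergy_rate_nonpos hqm0 hqm hbsq hl0 hk (by linarith) hrate' hkd'
    have := mul_nonpos_of_nonpos_of_nonneg hkey (Real.exp_pos (q / m * t s)).le
    refine le_trans (le_of_eq ?_) this
    ring
  have h1 : trapEnergy m L (r v) (p v) (k v)
      ≤ trapEnergy m L (r u) (p u) (k u) * Real.exp (-(1 / ρ ^ 4 / m * (t v - t u))) := by
    have h10 : Real.exp (-(1 / ρ ^ 4 / m * (t v - t u)))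
        = Real.exp (1 / ρ ^ 4 / m * t u) / Real.exp (1 / ρ ^ 4 / m * t v) := by
      rw [← Real.exp_sub]; ring_nf
    rw [h10, ← mul_div_assoc, le_div_iff₀ (Real.exp_pos _)]
    exact h
  have h2 : trapEnergy m L (r u) (p u) (k u) ≤ (2 * B) ^ 2 := by
    have hb := abs_le.1 (o.abs_stable_le hu')
    have h3 : (p u - trapSlope m (r u) * L) ^ 2 ≤ B ^ 2 := by
      apply sq_le_sq' <;> linarith
    have h4 : max (k u - L / m) 0 ≤ B := max_le (by linarith) hB0
    have h5 : max (k u - L / m) 0 ^ 2 ≤ B ^ 2 := pow_le_pow_left₀ (le_max_right _ _) h4 2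
    unfold trapEnergy
    nlinarith [sq_nonneg B]
  have h3 : Real.exp (-(1 / ρ ^ 4 / m * (t v - t u)))
      = Real.exp (-(1 / (2 * ρ ^ 4) / m * (t v - t u))) ^ 2 := by
    rw [← Real.exp_nat_mul]
    congr 1
    push_cast
    field_simp
  refine abs_le_of_sq_le_sq ?_ (by positivity)
  rw [mul_pow, ← h3]
  calc (p v - trapSlope m (r v) * L) ^ 2 ≤ trapEnergy m L (r v) (p v) (k v) :=
        le_add_of_nonneg_right (sq_nonneg _)
    _ ≤ _ := h1.trans (by gcongr)

/-- While an orbit stays in `r ≤ ρ m`, its stable coordinate decays exponentially in `t*`. -/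
theorem stable_decay (o : RadialOrbit m E L S r p t k) {ρ : ℝ} (hρ : 3 < ρ) {u v : ℝ}
    (hu : 0 ≤ u) (huv : u ≤ v) (hv : v ≤ S)
    (hr : ∀ s ∈ Icc u v, r s ≤ ρ * m) {B : ℝ} (hkB : k u ≤ B) (hEB : E ≤ B) (hLB : L / m ≤ B) :
    |p v - trapSlope m (r v) * L|
      ≤ 9 * ρ * B * Real.exp (-(1 / (2 * ρ ^ 4) / m * (t v - t u))) := by
  rcases le_total L (2 * m * E) with h | h
  · exact o.stable_decay_of_small_impact hρ h hu huv hv hr hkB hEB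
  · refine (o.stable_decay_of_large_impact hρ h hu huv hv hr hkB hLB).trans ?_
    have hB0 : 0 ≤ B := o.E_nonneg.trans hEB
    gcongr
    linarith

end RadialOrbit

/-! ### Orbits at late times -/

/-- The time function in terms of `r` and `t*`. -/
def radialTau (m R r t : ℝ) : ℝ :=
  if r ≤ R then t
  else t - r - 4 * m * Real.log (r - 2 * m) + (R + 4 * m * Real.log (R - 2 * m))

/-- The multiple of `m + C_r²/m` after which only nearly trapped orbits are left. -/
def flightConst (ρ : ℝ) : ℝ := 4 / (1 - 2 / ρ) * (1 + ρ + 2 * (3 / (ρ - 3))) + 1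

theorem one_sub_two_div_pos {ρ : ℝ} (hρ : 3 < ρ) : 0 < 1 - 2 / ρ := by
  rw [sub_pos, div_lt_one] <;> linarith

theorem flightConst_pos {ρ : ℝ} (hρ : 3 < ρ) : 0 < flightConst ρ := by
  have h1 := one_sub_two_div_pos hρ
  have h2 : 0 < 3 / (ρ - 3) := div_pos (by norm_num) (by linarith)
  unfold flightConst
  positivity

namespace RadialOrbit

variable {m E L S : ℝ} {r p t k : ℝ → ℝ}

/-- If the orbit has been in `r ≤ ρ m`, then it was there precisely during a time interval
`[u, v]`. -/
theorem exists_interior_interval (o : RadialOrbit m E L S r p t k) {ρ : ℝ} (hρ : 3 < ρ)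
    (hex : ∃ s ∈ Icc 0 S, r s ≤ ρ * m) :
    ∃ u v, 0 ≤ u ∧ u ≤ v ∧ v ≤ S ∧ (∀ s ∈ Icc u v, r s ≤ ρ * m) ∧
      (u = 0 ∨ (r u = ρ * m ∧ (∀ s ∈ Icc 0 u, ρ * m ≤ r s) ∧ ρ * m < r 0)) ∧
      (v = S ∨ (r v = ρ * m ∧ (∀ s ∈ Icc v S, ρ * m ≤ r s) ∧ ρ * m < r S)) := by
  have hm := o.m_pos
  set Z : Set ℝ := {s ∈ Icc 0 S | r s ≤ ρ * m} with hZ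
  have hZc : IsClosed Z := o.continuousOn_r.preimage_isClosed_of_isClosed isClosed_Icc isClosed_Iic
  have hne : Z.Nonempty := let ⟨s, hs, h⟩ := hex; ⟨s, hs, h⟩
  have hbb : BddBelow Z := ⟨0, fun s hs => hs.1.1⟩
  have hba : BddAbove Z := ⟨S, fun s hs => hs.1.2⟩
  have hu := hZc.csInf_mem hne hbb
  have hv := hZc.csSup_mem hne hba
  have hlow : ∀ s ∈ Z, sInf Z ≤ s := fun s hs => csInf_le hbb hs
  have hupp : ∀ s ∈ Z, s ≤ sSup Z := fun s hs => le_csSup hba hs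
  set u := sInf Z
  set v := sSup Z
  have h3 : 3 * m ≤ ρ * m := by nlinarith
  refine ⟨u, v, hu.1.1, hlow v hv, hv.1.2, fun s hs => ?_, ?_, ?_⟩
  -- At a time with r > ρm an outgoing orbit never returns and an ingoing one has never been inside,
  -- so no such time lies between the first and the last interior time.
  · by_contra hc
    push Not at hc
    rcases le_total 0 (p s) with hp | hp
    · have := o.r_mono_of_outgoing (hu.1.1.trans hs.1) hs.2 hv.1.2 (by linarith) hp
      linarith [hv.2]
    · have := o.r_anti_of_ingoing hu.1.1 hs.1 (hs.2.trans hv.1.2) (by linarith) hp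
      linarith [hu.2]
  · rcases hu.1.1.eq_or_lt with h | h
    · exact Or.inl h.symm
    have h0 : ρ * m < r 0 := by
      by_contra hc
      push Not at hc
      exact absurd (hlow 0 ⟨⟨le_rfl, hu.1.1.trans hu.1.2⟩, hc⟩) (not_le.2 h)
    have hru : r u = ρ * m := by
      obtain ⟨s, hs, hrs⟩ := intermediate_value_Icc' hu.1.1
        (o.continuousOn_r.mono (Icc_subset_Icc_right hu.1.2)) ⟨hu.2, h0.le⟩
      have : s = u := le_antisymm hs.2 (hlow s ⟨⟨hs.1, hs.2.trans hu.1.2⟩, hrs.le⟩)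
      rw [← this, hrs]
    refine Or.inr ⟨hru, fun s hs => ?_, h0⟩
    by_contra hc
    push Not at hc
    have : s = u := le_antisymm hs.2 (hlow s ⟨⟨hs.1, hs.2.trans hu.1.2⟩, hc.le⟩)
    rw [this, hru] at hc
    exact lt_irrefl _ hc
  · rcases hv.1.2.eq_or_lt with h | h
    · exact Or.inl h
    have h0 : ρ * m < r S := by
      by_contra hc
      push Not at hc
      exact absurd (hupp S ⟨⟨hv.1.1.trans hv.1.2, le_rfl⟩, hc⟩) (not_le.2 h)
    have hrv : r v = ρ * m := by
      obtain ⟨s, hs, hrs⟩ := intermediate_value_Icc hv.1.2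
        (o.continuousOn_r.mono (Icc_subset_Icc_left hv.1.1)) ⟨hv.2, h0.le⟩
      have : s = v := le_antisymm (hupp s ⟨⟨hv.1.1.trans hs.1, hs.2⟩, hrs.le⟩) hs.1
      rw [← this, hrs]
    refine Or.inr ⟨hrv, fun s hs => ?_, h0⟩
    by_contra hc
    push Not at hc
    have : s = v := le_antisymm (hupp s ⟨⟨hv.1.1.trans hs.1, hs.2⟩, hc.le⟩) hs.1
    rw [this, hrv] at hc
    exact lt_irrefl _ hc

/-- Orbits issuing from `{τ = 0, r ≤ C_r}` at late times: they lie exponentially close to the unstable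
manifold of the photon sphere, and those outside `r = ρ m` have come from inside. -/
theorem late_time (o : RadialOrbit m E L S r p t k) {ρ Cr B : ℝ} (hρ : 3 < ρ) (hS : 0 ≤ S)
    (h0 : radialTau m (ρ * m) (r 0) (t 0) = 0) (hr0 : r 0 ≤ Cr) (hkB : k 0 ≤ B) (hEB : E ≤ B)
    (hLB : L / m ≤ B)
    (hT : flightConst ρ * (m + Cr ^ 2 / m) ≤ radialTau m (ρ * m) (r S) (t S)) :
    |p S - trapSlope m (r S) * L| ≤ 9 * ρ * B * Real.exp (-(1 / (2 * ρ ^ 4) / m *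
        (radialTau m (ρ * m) (r S) (t S) - flightConst ρ * (m + Cr ^ 2 / m)))) ∧
      (ρ * m ≤ r S → (1 - 2 / ρ) * L ^ 2 ≤ (ρ * m * E) ^ 2 ∧ (r S = ρ * m ∨ 0 ≤ p S)) := by
  have hm := o.m_pos
  have hρ0 : 0 < ρ := by linarith
  have h0' : (0 : ℝ) ∈ Icc 0 S := ⟨le_rfl, hS⟩
  have hS' : S ∈ Icc 0 S := ⟨hS, le_rfl⟩
  have hω := one_sub_two_div_pos hρ
  have hA : 0 < 3 / (ρ - 3) := div_pos (by norm_num) (by linarith)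
  have hC0 : (1 - 2 / ρ) * (flightConst ρ * (m + Cr ^ 2 / m))
      = (4 * (1 + ρ + 2 * (3 / (ρ - 3))) + (1 - 2 / ρ)) * (m + Cr ^ 2 / m) := by
    unfold flightConst
    have h1 : (1 - 2 / ρ) * (4 / (1 - 2 / ρ)) = 4 := mul_div_cancel₀ 4 hω.ne'
    linear_combination (1 + ρ + 2 * (3 / (ρ - 3))) * (m + Cr ^ 2 / m) * h1
  have h3m : 3 * m ≤ ρ * m := mul_le_mul_of_nonneg_right hρ.le hm.le
  have hCr : Cr ≤ m + Cr ^ 2 / m := by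
    have h1 : m + Cr ^ 2 / m - Cr = ((m - Cr / 2) ^ 2 + 3 / 4 * Cr ^ 2) / m := by field_simp; ring
    have h2 : 0 ≤ ((m - Cr / 2) ^ 2 + 3 / 4 * Cr ^ 2) / m := by positivity
    linarith
  have hmCr : m ≤ m + Cr ^ 2 / m := le_add_of_nonneg_right (by positivity)
  set T := radialTau m (ρ * m) (r S) (t S) with hTdef
  set ω := 1 - 2 / ρ with hωdef
  set A := 3 / (ρ - 3) with hAdef
  set τ₀ := flightConst ρ * (m + Cr ^ 2 / m) with hτ₀
  set M := m + Cr ^ 2 / m with hM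
  have hM0 : 0 < M := lt_of_lt_of_le hm hmCr
  have hAM : A * m ≤ A * M := by gcongr
  have hρM : ρ * m ≤ ρ * M := by gcongr
  have hωT : ω * τ₀ ≤ ω * T := by gcongr
  have hωM : 0 < ω * M := by positivity
  have hAM0 : 0 < A * M := by positivity
  have hρM0 : 0 < ρ * M := by positivity
  -- An orbit that stayed in r > ρm would gain at most 4(C_r + Am)/ω of τ; the summand 1 in
  -- `flightConst` makes the contradiction strict.
  have hex : ∃ s ∈ Icc 0 S, r s ≤ ρ * m := by
    by_contra hc
    push Not at hc
    have h1 := o.retarded_le hρ le_rfl hS le_rfl fun s hs => (hc s hs).le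
    rw [radialTau, if_neg (not_le.2 (hc 0 h0'))] at h0
    rw [hTdef, radialTau, if_neg (not_le.2 (hc S hS'))] at hωT
    nlinarith
  obtain ⟨u, v, hu, huv, hv, hint, hfirst, hlast⟩ := o.exists_interior_interval hρ hex
  have hu' : u ∈ Icc 0 S := ⟨hu, huv.trans hv⟩
  have hv' : v ∈ Icc 0 S := ⟨hu.trans huv, hv⟩
  -- The normalisation of τ makes it equal to t* at r = ρm, so the flight-time bound applied to the
  -- incoming leg bounds t* at entry. The outgoing leg below is treated in the same way.
  have htu : ω * t u ≤ 4 * (M + A * M) := by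
    rcases hfirst with h | ⟨hru, hge, hlt⟩
    · have h1 : r 0 ≤ ρ * m := h ▸ hint u ⟨le_rfl, huv⟩
      rw [radialTau, if_pos h1] at h0
      rw [h, h0, mul_zero]
      positivity
    · have h1 := o.retarded_le hρ le_rfl hu (huv.trans hv) hge
      rw [radialTau, if_neg (not_le.2 hlt)] at h0
      rw [hru] at h1
      have h2 : t 0 - r 0 - 4 * m * Real.log (r 0 - 2 * m)
          = -(ρ * m + 4 * m * Real.log (ρ * m - 2 * m)) := by linarith
      rw [h2] at h1
      have h3 : t u - ρ * m - 4 * m * Real.log (ρ * m - 2 * m)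
          - -(ρ * m + 4 * m * Real.log (ρ * m - 2 * m)) = t u := by ring
      rw [h3] at h1
      linarith
  have htv : ω * (T - t v) ≤ 4 * (ρ * M + A * M) := by
    rcases hlast with h | ⟨hrv, hge, hlt⟩
    · have h1 : r S ≤ ρ * m := h ▸ hint v ⟨huv, le_rfl⟩
      rw [hTdef, radialTau, if_pos h1, h, sub_self, mul_zero]
      positivity
    · have h1 := o.retarded_le hρ hv'.1 hv le_rfl hge
      rw [hrv] at h1
      have h3 : t S - r S - 4 * m * Real.log (r S - 2 * m)
          - (t v - ρ * m - 4 * m * Real.log (ρ * m - 2 * m)) = T - t v := by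
        rw [hTdef, radialTau, if_neg (not_le.2 hlt)]; ring
      rw [h3] at h1
      linarith
  have hΘ : T - τ₀ ≤ t v - t u := by
    refine le_of_mul_le_mul_left ?_ hω
    rw [mul_sub, hC0]
    nlinarith
  refine ⟨?_, fun hR => ?_⟩
  -- The decay is gained on [u, v]; afterwards the stable coordinate at least does not increase.
  · refine (o.abs_stable_antitone hv'.1 hv le_rfl).trans
      ((o.stable_decay hρ hu huv hv hint (o.k_le hLB hkB hu') hEB hLB).trans ?_)
    have hB0 : 0 ≤ B := o.E_nonneg.trans hEB
    gcongr
  · have hrv : r v = ρ * m := by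
      rcases hlast with h | h
      · rw [h]; exact le_antisymm (h ▸ hint v ⟨huv, le_rfl⟩) hR
      · exact h.1
    constructor
    -- The orbit has crossed r = ρm, and p² ≥ 0 in the effective-potential equation there bounds the
    -- conserved L by the conserved E.
    · have h1 := o.radial_eq hv'
      rw [hrv] at h1
      have h2 : ρ * m - 2 * m = ω * (ρ * m) := by rw [hωdef]; field_simp
      have h3 : (ρ * m) * (ω * L ^ 2) ≤ (ρ * m) * (ρ * m * E) ^ 2 := by
        have : (ρ * m) * (ω * L ^ 2) = (ρ * m) ^ 3 * (E ^ 2 - p v ^ 2) := by rw [h1, h2]; ring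
        rw [this]
        have : 0 ≤ (ρ * m) ^ 3 * p v ^ 2 := by positivity
        nlinarith
      exact le_of_mul_le_mul_left h3 (by positivity)
    · rcases hlast with h | ⟨-, -, hlt⟩
      · left; rw [← h, hrv]
      · right
        by_contra hc
        push Not at hc
        have := o.r_anti_of_ingoing hv'.1 hv le_rfl (h3m.trans hR) hc.le
        linarith

end RadialOrbit

/-! ### The geodesic equation in Kerr–Schild form -/

/-- The Kerr–Schild form of the metric. -/
theorem metric_eq_kerrSchild (m : ℝ) {x : Event} (hx : radius x ≠ 0) (a b : Event) :
    metric m x a b = -(a.1 * b.1) + inner ℝ a.2 b.2 + 2 * m * (radius x ^ 3)⁻¹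
      * ((a.1 * radius x + inner ℝ x.2 a.2) * (b.1 * radius x + inner ℝ x.2 b.2)) := by
  unfold metric pr Omega2
  field_simp
  ring

theorem hasFDerivAt_radius {x : Event} (hx : radius x ≠ 0) :
    HasFDerivAt radius ((radius x)⁻¹ • (innerSL ℝ x.2).comp (ContinuousLinearMap.snd ℝ ℝ E3)) x := by
  have h1 : HasFDerivAt (fun y : Event => ‖y.2‖ ^ 2)
      ((2 : ℝ) • (innerSL ℝ x.2).comp (ContinuousLinearMap.snd ℝ ℝ E3)) x := by
    have := (hasFDerivAt_snd (𝕜 := ℝ) (E := ℝ) (F := E3) (p := x)).norm_sq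
    refine this.congr_fderiv ?_
    ext z <;> simp
  have h2 := h1.sqrt (by simpa [radius] using hx)
  have h3 : (fun y : Event => √(‖y.2‖ ^ 2)) = radius := by
    ext y; exact Real.sqrt_sq (norm_nonneg _)
  rw [h3] at h2
  refine h2.congr_fderiv ?_
  have h4 : √(‖x.2‖ ^ 2) = radius x := Real.sqrt_sq (norm_nonneg _)
  rw [h4, smul_smul]
  congr 1
  field_simp

theorem fderiv_metric (m : ℝ) {x : Event} (hx : radius x ≠ 0) (a b ξ : Event) :
    fderiv ℝ (fun y => metric m y a b) x ξ =
      -(6 * m / radius x ^ 5) * inner ℝ x.2 ξ.2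
        * ((a.1 * radius x + inner ℝ x.2 a.2) * (b.1 * radius x + inner ℝ x.2 b.2))
      + 2 * m / radius x ^ 3 *
        ((a.1 * (inner ℝ x.2 ξ.2 / radius x) + inner ℝ a.2 ξ.2) * (b.1 * radius x + inner ℝ x.2 b.2)
        + (a.1 * radius x + inner ℝ x.2 a.2)
          * (b.1 * (inner ℝ x.2 ξ.2 / radius x) + inner ℝ b.2 ξ.2)) := by
  have hr := hasFDerivAt_radius hx
  have hcont : Continuous radius := continuous_norm.comp continuous_snd
  have hev : (fun y => metric m y a b) =ᶠ[nhds x] fun y =>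
      -(a.1 * b.1) + inner ℝ a.2 b.2 + 2 * m * (radius y ^ 3)⁻¹
      * ((a.1 * radius y + inner ℝ y.2 a.2) * (b.1 * radius y + inner ℝ y.2 b.2)) := by
    filter_upwards [hcont.continuousAt.eventually_ne hx] with y hy
    exact metric_eq_kerrSchild m hy a b
  have hlin : ∀ c : Event, HasFDerivAt (fun y : Event => c.1 * radius y + inner ℝ y.2 c.2)
      (c.1 • ((radius x)⁻¹ • (innerSL ℝ x.2).comp (ContinuousLinearMap.snd ℝ ℝ E3))
        + (innerSL ℝ c.2).comp (ContinuousLinearMap.snd ℝ ℝ E3)) x := fun c => by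
    refine (hr.const_mul c.1).add ?_
    have : (fun y : Event => inner ℝ y.2 c.2)
        = ((innerSL ℝ c.2).comp (ContinuousLinearMap.snd ℝ ℝ E3)) := by
      ext y; simp [real_inner_comm]
    rw [this]
    exact ContinuousLinearMap.hasFDerivAt _
  have hinv : HasFDerivAt (fun y : Event => (radius y ^ 3)⁻¹)
      (-(3 * radius x ^ 2 / (radius x ^ 3) ^ 2) •
        ((radius x)⁻¹ • (innerSL ℝ x.2).comp (ContinuousLinearMap.snd ℝ ℝ E3))) x := by
    have h1 : HasDerivAt (fun r : ℝ => (r ^ 3)⁻¹) (-(3 * radius x ^ 2) / (radius x ^ 3) ^ 2)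
        (radius x) := by
      simpa using (hasDerivAt_pow 3 (radius x)).fun_inv (pow_ne_zero 3 hx)
    have h2 := h1.comp_hasFDerivAt x hr
    rw [← neg_div]
    exact h2
  have h := ((hinv.const_mul (2 * m)).fun_mul ((hlin a).fun_mul (hlin b))).const_add
    (-(a.1 * b.1) + inner ℝ a.2 b.2)
  rw [hev.fderiv_eq, h.fderiv]
  simp only [add_apply, smul_apply,
    ContinuousLinearMap.comp_apply, ContinuousLinearMap.coe_snd', innerSL_apply_apply, smul_eq_mul]
  field_simp
  ring

/-- Null curves with the radial motion of a geodesic and central acceleration `-3mL² y / r⁵` are null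
geodesics. -/
theorem isNullGeodesic_of_orbit {m E L S : ℝ} {y q : ℝ → E3} {t k : ℝ → ℝ}
    (o : RadialOrbit m E L S (fun s => ‖y s‖) (fun s => inner ℝ (y s) (q s) / ‖y s‖) t k)
    (hy : ∀ s ∈ Icc 0 S, HasDerivAt y (q s) s)
    (hq : ∀ s ∈ Icc 0 S, HasDerivAt q (-(3 * m * L ^ 2 / ‖y s‖ ^ 5) • y s) s)
    (hL : ∀ s ∈ Icc 0 S, ‖y s‖ ^ 2 * ‖q s‖ ^ 2 - inner ℝ (y s) (q s) ^ 2 = L ^ 2) :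
    IsNullGeodesic m S (fun s => (t s, y s))
      (fun s => (k s - inner ℝ (y s) (q s) / ‖y s‖, q s)) := by
  intro s hs
  have hr := o.r_pos hs
  have hrad : radius (t s, y s) = ‖y s‖ := rfl
  have hr0 : radius (t s, y s) ≠ 0 := hr.ne'
  have hnull := o.null s hs
  have hen := o.energy_eq s hs
  have hLs := hL s hs
  set r := ‖y s‖ with hrdef
  obtain ⟨p, hp⟩ : ∃ p, p = inner ℝ (y s) (q s) / r := ⟨_, rfl⟩
  have hyq : inner ℝ (y s) (q s) = p * r := by rw [hp]; field_simp
  have hE : E = k s * (1 - 2 * m / r) - p := by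
    rw [← hp] at hen
    field_simp
    linarith
  rw [← hp] at hnull
  rw [hyq] at hLs
  -- E, L² and |q|² are all expressed through r, p, k, so that the null condition and the geodesic
  -- equation become identities between rational functions.
  have hN : k s * (k s * (r - 2 * m) - 2 * p * r) * r = L ^ 2 := by
    rw [← hnull, hE]; field_simp; ring
  refine ⟨⟨o.le_r s hs, ?_, ?_⟩, ?_, ?_⟩
  · change metric m (t s, y s) _ _ = 0
    rw [metric_eq_kerrSchild m hr0, hrad]
    simp only [real_inner_self_eq_norm_sq]
    rw [← hrdef, ← hp, hyq]
    have hq2 : ‖q s‖ ^ 2 = (L ^ 2 + (p * r) ^ 2) / r ^ 2 := by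
      rw [eq_div_iff (by positivity)]; linarith
    rw [hq2, ← hN]
    field_simp
    ring
  · exact o.future s hs
  · exact ((o.deriv_t s hs).prodMk (hy s hs)).hasDerivWithinAt
  · refine ⟨_, (((o.deriv_k s hs).sub (o.deriv_p s hs)).prodMk (hq s hs)).hasDerivWithinAt,
      fun ξ => ?_⟩
    unfold christoffel
    rw [metric_eq_kerrSchild m hr0, fderiv_metric m hr0, fderiv_metric m hr0, hrad]
    simp only [inner_smul_left, inner_smul_right, real_inner_self_eq_norm_sq]
    rw [← hrdef, ← hp, hyq]
    have hq2 : ‖q s‖ ^ 2 = (L ^ 2 + (p * r) ^ 2) / r ^ 2 := by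
      rw [eq_div_iff (by positivity)]; linarith
    rw [hq2, ← hN, real_inner_comm (q s) ξ.2]
    simp only [map_neg, conj_trivial]
    field_simp
    ring

/-! ### Backward continuation of orbits -/

namespace RadialOrbit

variable {m E L S : ℝ} {r p t k : ℝ → ℝ}

/-- This is the null condition read in Kerr–Schild form. All terms on the right are non-negative, so
p^{t*} = k − p controls the whole momentum. -/
theorem future_sq (o : RadialOrbit m E L S r p t k) {s : ℝ} (hs : s ∈ Icc 0 S) :
    (k s - p s) ^ 2 = L ^ 2 / r s ^ 2 + 2 * m / r s * k s ^ 2 + p s ^ 2 := by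
  have hr := o.r_pos hs
  rw [← o.null s hs]
  field_simp
  linear_combination (k s) * o.energy_eq s hs

end RadialOrbit

/-- The rate of change of p^{t*} is at most (p^{t*})²/m, that is, log p^{t*} has Lipschitz constant
1/m as a function of t*. Hence p^{t*} neither vanishes nor blows up in finite t*. -/
theorem deriv_future_bounds {m L r p k : ℝ} (hm : 0 < m) (hr : 2 * m ≤ r)
    (h : (k - p) ^ 2 = L ^ 2 / r ^ 2 + 2 * m / r * k ^ 2 + p ^ 2) :
    |L ^ 2 / r ^ 3 - m * k ^ 2 / r ^ 2 - L ^ 2 * (r - 3 * m) / r ^ 4| ≤ (k - p) ^ 2 / m := by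
  have hr0 : 0 < r := by linarith
  have h1 : L ^ 2 / r ^ 3 - m * k ^ 2 / r ^ 2 - L ^ 2 * (r - 3 * m) / r ^ 4
      = 3 * (m / r ^ 2) * (L ^ 2 / r ^ 2) - 1 / (2 * r) * (2 * m / r * k ^ 2) := by
    field_simp
    ring
  have h2 : m / r ^ 2 ≤ 1 / (4 * m) := by
    rw [div_le_div_iff₀ (by positivity) (by positivity)]; nlinarith
  have h3 : 1 / (2 * r) ≤ 1 / (4 * m) := one_div_le_one_div_of_le (by positivity) (by linarith)
  have h4 : 0 ≤ L ^ 2 / r ^ 2 := by positivity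
  have h5 : 0 ≤ 2 * m / r * k ^ 2 := by positivity
  have h6 : 3 * (m / r ^ 2) * (L ^ 2 / r ^ 2) ≤ 3 * (1 / (4 * m)) * (L ^ 2 / r ^ 2) := by gcongr
  have h7 : 1 / (2 * r) * (2 * m / r * k ^ 2) ≤ 1 / (4 * m) * (2 * m / r * k ^ 2) := by gcongr
  have h8 : 0 ≤ 3 * (m / r ^ 2) * (L ^ 2 / r ^ 2) := by positivity
  have h9 : 0 ≤ 1 / (2 * r) * (2 * m / r * k ^ 2) := by positivity
  have h10 : (k - p) ^ 2 / m = 4 * (1 / (4 * m)) * (k - p) ^ 2 := by field_simp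
  have h11 : 0 ≤ 1 / (4 * m) := by positivity
  have h12 := mul_nonneg h11 h4
  have h13 := mul_nonneg h11 h5
  have h14 := mul_nonneg h11 (sq_nonneg p)
  rw [h1, h10, h, abs_le]
  constructor <;> nlinarith

/-- The constraints defining a `RadialOrbit` propagate backwards from the end of the orbit. -/
theorem radialOrbit_of_final {m L S : ℝ} {r p t k : ℝ → ℝ} (hm : 0 < m) (hL : 0 ≤ L) (hS : 0 ≤ S)
    (hr0 : ∀ s ∈ Icc 0 S, 0 < r s)
    (hr : ∀ s ∈ Icc 0 S, HasDerivAt r (p s) s)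
    (hp : ∀ s ∈ Icc 0 S, HasDerivAt p (L ^ 2 * (r s - 3 * m) / r s ^ 4) s)
    (ht : ∀ s ∈ Icc 0 S, HasDerivAt t (k s - p s) s)
    (hk : ∀ s ∈ Icc 0 S, HasDerivAt k (L ^ 2 / r s ^ 3 - m * k s ^ 2 / r s ^ 2) s)
    (hrS : 2 * m ≤ r S) (hN : k S * (k S * (1 - 2 * m / r S) - 2 * p S) - L ^ 2 / r S ^ 2 = 0)
    (hE : 0 ≤ k S * (1 - 2 * m / r S) - p S) (hfut : 0 < k S - p S) :
    RadialOrbit m (k S * (1 - 2 * m / r S) - p S) L S r p t k := by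
  have hSm : S ∈ Icc 0 S := ⟨hS, le_rfl⟩
  have hrc : ContinuousOn r (Icc 0 S) := fun s hs => (hr s hs).continuousAt.continuousWithinAt
  have hkc : ContinuousOn k (Icc 0 S) := fun s hs => (hk s hs).continuousAt.continuousWithinAt
  have hO : ∀ s ∈ Icc 0 S, HasDerivAt (fun s => 1 - 2 * m / r s) (2 * m * p s / r s ^ 2) s :=
    fun s hs => by
      have := ((hasDerivAt_const s (2 * m)).div (hr s hs) (hr0 s hs).ne').const_sub 1
      refine this.congr_deriv ?_
      ring
  -- the null constraint
  obtain ⟨H, hH⟩ := exists_hasDerivAt_of_continuousOn hS (c := fun s => -(2 * m * k s / r s ^ 2))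
    ((continuousOn_const.mul hkc).div (hrc.pow 2) fun s hs => (pow_pos (hr0 s hs) 2).ne').neg
  have hNd : ∀ s ∈ Icc 0 S, HasDerivAt
      (fun s => k s * (k s * (1 - 2 * m / r s) - 2 * p s) - L ^ 2 / r s ^ 2)
      (-(2 * m * k s / r s ^ 2) * (k s * (k s * (1 - 2 * m / r s) - 2 * p s) - L ^ 2 / r s ^ 2)) s :=
    fun s hs => by
      have h1 := ((hk s hs).mul (((hk s hs).mul (hO s hs)).sub ((hp s hs).const_mul 2))).sub
        ((hasDerivAt_const s (L ^ 2)).div ((hr s hs).fun_pow 2) (pow_pos (hr0 s hs) 2).ne')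
      refine h1.congr_deriv ?_
      have := hr0 s hs
      simp only [Pi.mul_apply, Pi.sub_apply]
      field_simp
      push_cast
      ring
  have hN0 : ∀ s ∈ Icc 0 S, k s * (k s * (1 - 2 * m / r s) - 2 * p s) - L ^ 2 / r s ^ 2 = 0 := by
    intro s hs
    have := eq_mul_exp_of_hasDerivAt hH hNd hs hSm hs.2
    rw [hN] at this
    exact (mul_eq_zero.1 this.symm).resolve_right (Real.exp_pos _).ne'
  have hEd : ∀ s ∈ Icc 0 S, HasDerivAt (fun s => k s * (1 - 2 * m / r s) - p s) 0 s := fun s hs => by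
    refine (((hk s hs).mul (hO s hs)).sub (hp s hs)).congr_deriv ?_
    have := hr0 s hs
    have h1 := hN0 s hs
    -- The derivative of the energy is a multiple of the null constraint; so the constraint has to
    -- be propagated before the energy.
    have h2 : (L ^ 2 / r s ^ 3 - m * k s ^ 2 / r s ^ 2) * (1 - 2 * m / r s)
        + k s * (2 * m * p s / r s ^ 2) - L ^ 2 * (r s - 3 * m) / r s ^ 4
        = -(m / r s ^ 2) * (k s * (k s * (1 - 2 * m / r s) - 2 * p s) - L ^ 2 / r s ^ 2) := by
      field_simp
      ring
    rw [h2, h1, mul_zero]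
  have hEc : ∀ s ∈ Icc 0 S, k s * (1 - 2 * m / r s) - p s = k S * (1 - 2 * m / r S) - p S := by
    intro s hs
    have hd : ∀ σ ∈ Icc s S, HasDerivAt (fun s => k s * (1 - 2 * m / r s) - p s) 0 σ :=
      fun σ hσ => hEd σ ⟨hs.1.trans hσ.1, hσ.2⟩
    exact le_antisymm (le_of_hasDerivAt_nonneg hs.2 hd fun _ _ => le_rfl)
      (le_of_hasDerivAt_nonpos hs.2 hd fun _ _ => le_rfl)
  set E := k S * (1 - 2 * m / r S) - p S with hEdef
  -- the orbit does not come from beyond the horizon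
  obtain ⟨G, hG⟩ := exists_hasDerivAt_of_continuousOn hS (c := fun s => k s / r s)
    (hkc.div hrc fun s hs => (hr0 s hs).ne')
  have h2m : ∀ s ∈ Icc 0 S, 2 * m ≤ r s := by
    intro s hs
    -- With G' = k/r, energy conservation reads (r − 2m)' = G'(r − 2m) − E. Since E ≥ 0, the product
    -- with exp(−G) is non-increasing, so r ≥ 2m propagates to the past.
    have hd : ∀ σ ∈ Icc s S, HasDerivAt (fun s => (r s - 2 * m) * Real.exp (-G s))
        (p σ * Real.exp (-G σ) + (r σ - 2 * m) * (Real.exp (-G σ) * -(k σ / r σ))) σ := fun σ hσ =>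
      have hσ' : σ ∈ Icc 0 S := ⟨hs.1.trans hσ.1, hσ.2⟩
      ((hr σ hσ').sub_const (2 * m)).mul (hG σ hσ').neg.exp
    have h1 := le_of_hasDerivAt_nonpos hs.2 hd fun σ hσ => by
      have hσ' : σ ∈ Icc 0 S := ⟨hs.1.trans hσ.1, hσ.2⟩
      have h3 := hEc σ hσ'
      have h4 := hr0 σ hσ'
      have h5 : p σ * Real.exp (-G σ) + (r σ - 2 * m) * (Real.exp (-G σ) * -(k σ / r σ))
          = -(Real.exp (-G σ) * E) := by
        rw [← h3]
        field_simp
        ring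
      rw [h5]
      exact neg_nonpos.2 (mul_nonneg (Real.exp_pos _).le hE)
    have h6 : 0 ≤ (r s - 2 * m) * Real.exp (-G s) :=
      (mul_nonneg (by linarith) (Real.exp_pos _).le).trans h1
    linarith [nonneg_of_mul_nonneg_left h6 (Real.exp_pos _)]
  have hsq : ∀ s ∈ Icc 0 S, (k s - p s) ^ 2
      = L ^ 2 / r s ^ 2 + 2 * m / r s * k s ^ 2 + p s ^ 2 := fun s hs => by
    linear_combination hN0 s hs
  refine ⟨hm, hE, hL, hr, hp, ht, hk, h2m, fun s hs => ?_, fun s hs => ?_, fun s hs => ?_⟩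
  · have h1 := hN0 s hs
    have h3 := hr0 s hs
    rw [← hEc s hs]
    field_simp at h1 ⊢
    linarith
  · have h3 := hr0 s hs
    rw [← hEc s hs]
    field_simp
    ring
  -- This product is non-increasing irrespective of the sign of k − p, so its positive final value
  -- forces positivity at all earlier times.
  · have hd : ∀ σ ∈ Icc s S, HasDerivAt (fun s => (k s - p s) * Real.exp (-(t s / m)))
        ((L ^ 2 / r σ ^ 3 - m * k σ ^ 2 / r σ ^ 2 - L ^ 2 * (r σ - 3 * m) / r σ ^ 4)
          * Real.exp (-(t σ / m)) + (k σ - p σ) * (Real.exp (-(t σ / m)) * -((k σ - p σ) / m))) σ :=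
      fun σ hσ =>
      have hσ' : σ ∈ Icc 0 S := ⟨hs.1.trans hσ.1, hσ.2⟩
      ((hk σ hσ').sub (hp σ hσ')).mul ((ht σ hσ').div_const m).neg.exp
    have h1 := le_of_hasDerivAt_nonpos hs.2 hd fun σ hσ => by
      have hσ' : σ ∈ Icc 0 S := ⟨hs.1.trans hσ.1, hσ.2⟩
      have h3 := (abs_le.1 (deriv_future_bounds hm (h2m σ hσ') (hsq σ hσ'))).2
      have h4 := mul_le_mul_of_nonneg_right h3 (Real.exp_pos (-(t σ / m))).le
      have h5 : (k σ - p σ) * (Real.exp (-(t σ / m)) * -((k σ - p σ) / m))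
          = -((k σ - p σ) ^ 2 / m * Real.exp (-(t σ / m))) := by ring
      rw [h5]
      linarith
    have h6 : 0 < (k s - p s) * Real.exp (-(t s / m)) :=
      (mul_pos hfut (Real.exp_pos _)).trans_le h1
    exact pos_of_mul_pos_left h6 (Real.exp_pos _).le

namespace RadialOrbit

variable {m E L S : ℝ} {r p t k : ℝ → ℝ}

/-- Integrating `deriv_future_bounds` in t* rules out blow-up of the momentum towards the past. -/
theorem future_le (o : RadialOrbit m E L S r p t k) {s : ℝ} (hs : s ∈ Icc 0 S) :
    k s - p s ≤ (k S - p S) * Real.exp ((t S - t s) / m) := by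
  have hm := o.m_pos
  have hd : ∀ σ ∈ Icc s S, HasDerivAt (fun s => (k s - p s) * Real.exp (t s / m))
      ((L ^ 2 / r σ ^ 3 - m * k σ ^ 2 / r σ ^ 2 - L ^ 2 * (r σ - 3 * m) / r σ ^ 4)
        * Real.exp (t σ / m) + (k σ - p σ) * (Real.exp (t σ / m) * ((k σ - p σ) / m))) σ :=
    fun σ hσ =>
    have hσ' : σ ∈ Icc 0 S := ⟨hs.1.trans hσ.1, hσ.2⟩
    ((o.deriv_k σ hσ').sub (o.deriv_p σ hσ')).mul ((o.deriv_t σ hσ').div_const m).exp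
  have h1 := le_of_hasDerivAt_nonneg hs.2 hd fun σ hσ => by
    have hσ' : σ ∈ Icc 0 S := ⟨hs.1.trans hσ.1, hσ.2⟩
    have h3 := (abs_le.1 (deriv_future_bounds hm (o.le_r σ hσ') (o.future_sq hσ'))).1
    have h4 := mul_le_mul_of_nonneg_right h3 (Real.exp_pos (t σ / m)).le
    have h5 : (k σ - p σ) * (Real.exp (t σ / m) * ((k σ - p σ) / m))
        = (k σ - p σ) ^ 2 / m * Real.exp (t σ / m) := by ring
    rw [h5]
    linarith
  rw [sub_div, Real.exp_sub, ← mul_div_assoc, le_div_iff₀ (Real.exp_pos _)]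
  exact h1

/-- The companion lower bound: t* decreases to the past at a definite rate, so every earlier value
is reached in bounded affine time. -/
theorem le_future (o : RadialOrbit m E L S r p t k) {s : ℝ} (hs : s ∈ Icc 0 S) :
    (k S - p S) * Real.exp (-((t S - t s) / m)) ≤ k s - p s := by
  have hm := o.m_pos
  have hd : ∀ σ ∈ Icc s S, HasDerivAt (fun s => (k s - p s) * Real.exp (-(t s / m)))
      ((L ^ 2 / r σ ^ 3 - m * k σ ^ 2 / r σ ^ 2 - L ^ 2 * (r σ - 3 * m) / r σ ^ 4)
        * Real.exp (-(t σ / m)) + (k σ - p σ) * (Real.exp (-(t σ / m)) * -((k σ - p σ) / m))) σ :=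
    fun σ hσ =>
    have hσ' : σ ∈ Icc 0 S := ⟨hs.1.trans hσ.1, hσ.2⟩
    ((o.deriv_k σ hσ').sub (o.deriv_p σ hσ')).mul ((o.deriv_t σ hσ').div_const m).neg.exp
  have h1 := le_of_hasDerivAt_nonpos hs.2 hd fun σ hσ => by
    have hσ' : σ ∈ Icc 0 S := ⟨hs.1.trans hσ.1, hσ.2⟩
    have h3 := (abs_le.1 (deriv_future_bounds hm (o.le_r σ hσ') (o.future_sq hσ'))).2
    have h4 := mul_le_mul_of_nonneg_right h3 (Real.exp_pos (-(t σ / m))).le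
    have h5 : (k σ - p σ) * (Real.exp (-(t σ / m)) * -((k σ - p σ) / m))
        = -((k σ - p σ) ^ 2 / m * Real.exp (-(t σ / m))) := by ring
    rw [h5]
    linarith
  have h2 : -((t S - t s) / m) = -(t S / m) - -(t s / m) := by ring
  rw [h2, Real.exp_sub, ← mul_div_assoc, div_le_iff₀ (Real.exp_pos _)]
  exact h1

theorem shift (o : RadialOrbit m E L S r p t k) {a : ℝ} (ha : 0 ≤ a) :
    RadialOrbit m E L (S - a) (fun s => r (s + a)) (fun s => p (s + a)) (fun s => t (s + a))
      (fun s => k (s + a)) := by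
  have hsub : ∀ s ∈ Icc 0 (S - a), s + a ∈ Icc 0 S := fun s hs =>
    ⟨by linarith [hs.1], by linarith [hs.2]⟩
  exact ⟨o.m_pos, o.E_nonneg, o.L_nonneg, fun s hs => (o.deriv_r _ (hsub s hs)).comp_add_const s a,
    fun s hs => (o.deriv_p _ (hsub s hs)).comp_add_const s a,
    fun s hs => (o.deriv_t _ (hsub s hs)).comp_add_const s a,
    fun s hs => (o.deriv_k _ (hsub s hs)).comp_add_const s a,
    fun s hs => o.le_r _ (hsub s hs), fun s hs => o.null _ (hsub s hs),
    fun s hs => o.energy_eq _ (hsub s hs), fun s hs => o.future _ (hsub s hs)⟩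

end RadialOrbit

/-- The angular momentum is conserved in a central force field. -/
theorem angular_momentum_const {S : ℝ} {y q : ℝ → E3} {c : ℝ → ℝ}
    (hy : ∀ s ∈ Icc 0 S, HasDerivAt y (q s) s) (hq : ∀ s ∈ Icc 0 S, HasDerivAt q (c s • y s) s)
    {s : ℝ} (hs : s ∈ Icc 0 S) :
    ‖y s‖ ^ 2 * ‖q s‖ ^ 2 - inner ℝ (y s) (q s) ^ 2
      = ‖y S‖ ^ 2 * ‖q S‖ ^ 2 - inner ℝ (y S) (q S) ^ 2 := by
  have hd : ∀ σ ∈ Icc s S, HasDerivAt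
      (fun s => ‖y s‖ ^ 2 * ‖q s‖ ^ 2 - inner ℝ (y s) (q s) ^ 2) 0 σ := fun σ hσ => by
    have hσ' : σ ∈ Icc 0 S := ⟨hs.1.trans hσ.1, hσ.2⟩
    refine (((hy σ hσ').norm_sq.mul (hq σ hσ').norm_sq).sub
      (((hy σ hσ').inner ℝ (hq σ hσ')).fun_pow 2)).congr_deriv ?_
    simp only [inner_smul_right, real_inner_self_eq_norm_sq]
    rw [real_inner_comm (y σ) (q σ)]
    push_cast
    ring
  exact le_antisymm (le_of_hasDerivAt_nonneg hs.2 hd fun _ _ => le_rfl)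
    (le_of_hasDerivAt_nonpos hs.2 hd fun _ _ => le_rfl)

theorem hasDerivAt_norm_of_ne {y : ℝ → E3} {q : E3} {s : ℝ} (hy : HasDerivAt y q s) (h0 : y s ≠ 0) :
    HasDerivAt (fun s => ‖y s‖) (inner ℝ (y s) q / ‖y s‖) s := by
  have hn : 0 < ‖y s‖ := norm_pos_iff.2 h0
  have h1 := hy.norm_sq.sqrt (by positivity)
  simp only [Real.sqrt_sq (norm_nonneg _)] at h1
  refine h1.congr_deriv ?_
  field_simp

theorem hasDerivAt_radial_velocity {m L : ℝ} {y q : ℝ → E3} {s : ℝ} (h0 : y s ≠ 0)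
    (hy : HasDerivAt y (q s) s) (hq : HasDerivAt q (-(3 * m * L ^ 2 / ‖y s‖ ^ 5) • y s) s)
    (hL : ‖y s‖ ^ 2 * ‖q s‖ ^ 2 - inner ℝ (y s) (q s) ^ 2 = L ^ 2) :
    HasDerivAt (fun s => inner ℝ (y s) (q s) / ‖y s‖) (L ^ 2 * (‖y s‖ - 3 * m) / ‖y s‖ ^ 4) s := by
  have hn : 0 < ‖y s‖ := norm_pos_iff.2 h0
  refine ((hy.inner ℝ hq).fun_div (hasDerivAt_norm_of_ne hy h0) hn.ne').congr_deriv ?_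
  simp only [inner_smul_right, real_inner_self_eq_norm_sq]
  have hq2 : ‖q s‖ ^ 2 = (L ^ 2 + inner ℝ (y s) (q s) ^ 2) / ‖y s‖ ^ 2 := by
    rw [eq_div_iff (by positivity)]; linarith
  rw [hq2]
  field_simp
  ring

/-- A formula without cases, from which continuity across r = R and τ ≤ t* can be read off. -/
theorem radialTau_eq_max (m R r t : ℝ) : radialTau m R r t
    = t - max r R - 4 * m * Real.log (max r R - 2 * m) + (R + 4 * m * Real.log (R - 2 * m)) := by
  unfold radialTau
  split_ifs with h
  · rw [max_eq_right h]; ring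
  · rw [max_eq_left (not_le.1 h).le]

theorem radialTau_le {m R r t : ℝ} (hm : 0 < m) (hR : 2 * m < R) : radialTau m R r t ≤ t := by
  rw [radialTau_eq_max]
  have h1 : R ≤ max r R := le_max_right _ _
  have h2 : Real.log (R - 2 * m) ≤ Real.log (max r R - 2 * m) :=
    Real.log_le_log (by linarith) (by linarith)
  nlinarith

theorem tau_eq_radialTau (m R : ℝ) (x : Event) : tau m R x = radialTau m R (radius x) x.1 := by
  unfold tau radialTau nullU tBL rStar
  split_ifs
  · rfl
  · ring

theorem continuousOn_radialTau {m R : ℝ} (hR : 2 * m < R) {r t : ℝ → ℝ} {s : Set ℝ}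
    (hr : ContinuousOn r s) (ht : ContinuousOn t s) :
    ContinuousOn (fun σ => radialTau m R (r σ) (t σ)) s := by
  simp only [radialTau_eq_max]
  have h1 : ContinuousOn (fun σ => max (r σ) R) s := hr.sup continuousOn_const
  refine ((ht.sub h1).sub (continuousOn_const.mul ((h1.sub continuousOn_const).log
    fun σ _ => ?_))).add continuousOn_const
  have : R ≤ max (r σ) R := le_max_right _ _
  change max (r σ) R - 2 * m ≠ 0
  linarith

/-- The phase space `(y, q, t*, k)` with `k = p^{t*} + p^r`. -/
abbrev OrbitSpace := (E3 × E3) × (ℝ × ℝ)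

/-- The null geodesic equation with angular momentum `L` as a first order system. -/
def orbitField (m L : ℝ) (z : OrbitSpace) : OrbitSpace :=
  ((z.1.2, -(3 * m * L ^ 2 / ‖z.1.1‖ ^ 5) • z.1.1),
    (z.2.2 - inner ℝ z.1.1 z.1.2 / ‖z.1.1‖,
      L ^ 2 / ‖z.1.1‖ ^ 3 - m * z.2.2 ^ 2 / ‖z.1.1‖ ^ 2))

theorem contDiffOn_orbitField (m L : ℝ) :
    ContDiffOn ℝ 1 (orbitField m L) {z : OrbitSpace | z.1.1 ≠ 0} := by
  intro z hz
  have hz' : z.1.1 ≠ 0 := hz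
  have hn : ‖z.1.1‖ ≠ 0 := norm_ne_zero_iff.2 hz'
  have h1 : ContDiffAt ℝ 1 (fun z : OrbitSpace => z.1.1) z := by fun_prop
  have h2 : ContDiffAt ℝ 1 (fun z : OrbitSpace => z.1.2) z := by fun_prop
  have h3 : ContDiffAt ℝ 1 (fun z : OrbitSpace => z.2.2) z := by fun_prop
  have hr : ContDiffAt ℝ 1 (fun z : OrbitSpace => ‖z.1.1‖) z := h1.norm ℝ hz'
  refine ContDiffAt.contDiffWithinAt ?_
  refine (h2.prodMk (((contDiffAt_const.div (hr.pow 5) (pow_ne_zero 5 hn)).neg).smul h1)).prodMk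
    ((h3.sub ((h1.inner ℝ h2).div hr hn)).prodMk
      ((contDiffAt_const.div (hr.pow 3) (pow_ne_zero 3 hn)).sub
        ((contDiffAt_const.mul (h3.pow 2)).div (hr.pow 2) (pow_ne_zero 2 hn))))

/-- The region `m ≤ r ≤ B`, `|q|, |k| ≤ B`, `-1 ≤ t* ≤ B`. -/
def orbitBox (m B : ℝ) : Set OrbitSpace :=
  {z | m ≤ ‖z.1.1‖ ∧ ‖z.1.1‖ ≤ B ∧ ‖z.1.2‖ ≤ B ∧ -1 ≤ z.2.1 ∧ z.2.1 ≤ B ∧ |z.2.2| ≤ B}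

theorem isCompact_orbitBox (m B : ℝ) : IsCompact (orbitBox m B) := by
  have h1 : IsCompact ((Metric.closedBall (0 : E3) B ×ˢ Metric.closedBall (0 : E3) B) ×ˢ
      (Icc (-1) B ×ˢ Icc (-B) B)) :=
    ((isCompact_closedBall _ _).prod (isCompact_closedBall _ _)).prod (isCompact_Icc.prod isCompact_Icc)
  have h2 : IsClosed {z : OrbitSpace | m ≤ ‖z.1.1‖} :=
    isClosed_le continuous_const (by fun_prop)
  convert h1.inter_right h2 using 1
  ext z
  simp only [orbitBox, mem_ofPred_eq, mem_inter_iff, mem_prod, mem_closedBall_zero_iff, mem_Icc, abs_le]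
  tauto

theorem mem_interior_orbitBox {m B : ℝ} {z : OrbitSpace} (h1 : m < ‖z.1.1‖) (h2 : ‖z.1.1‖ < B)
    (h3 : ‖z.1.2‖ < B) (h4 : -1 < z.2.1) (h5 : z.2.1 < B) (h6 : |z.2.2| < B) :
    z ∈ interior (orbitBox m B) := by
  have hopen : IsOpen {z : OrbitSpace | m < ‖z.1.1‖ ∧ ‖z.1.1‖ < B ∧ ‖z.1.2‖ < B ∧ -1 < z.2.1 ∧
      z.2.1 < B ∧ |z.2.2| < B} := by
    have hr : Continuous fun z : OrbitSpace => ‖z.1.1‖ := by fun_prop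
    have hq : Continuous fun z : OrbitSpace => ‖z.1.2‖ := by fun_prop
    have ht : Continuous fun z : OrbitSpace => z.2.1 := by fun_prop
    have hk : Continuous fun z : OrbitSpace => |z.2.2| := by fun_prop
    exact (isOpen_lt continuous_const hr).inter ((isOpen_lt hr continuous_const).inter
      ((isOpen_lt hq continuous_const).inter ((isOpen_lt continuous_const ht).inter
        ((isOpen_lt ht continuous_const).inter (isOpen_lt hk continuous_const)))))
  refine interior_maximal ?_ hopen ⟨h1, h2, h3, h4, h5, h6⟩
  exact fun z hz => ⟨hz.1.le, hz.2.1.le, hz.2.2.1.le, hz.2.2.2.1.le, hz.2.2.2.2.1.le, hz.2.2.2.2.2.le⟩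

/-- The curve `(y, q, t, k)` on `[0, S]` is a null geodesic of energy `E` and angular momentum `L`. -/
structure IsOrbit (m E L S : ℝ) (y q : ℝ → E3) (t k : ℝ → ℝ) : Prop where
  radial : RadialOrbit m E L S (fun s => ‖y s‖) (fun s => inner ℝ (y s) (q s) / ‖y s‖) t k
  deriv_y : ∀ s ∈ Icc 0 S, HasDerivAt y (q s) s
  deriv_q : ∀ s ∈ Icc 0 S, HasDerivAt q (-(3 * m * L ^ 2 / ‖y s‖ ^ 5) • y s) s
  angular : ∀ s ∈ Icc 0 S, ‖y s‖ ^ 2 * ‖q s‖ ^ 2 - inner ℝ (y s) (q s) ^ 2 = L ^ 2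

/-- The kinematic constraints at the end of an orbit. -/
structure IsNullState (m L : ℝ) (y q : E3) (k : ℝ) : Prop where
  le_r : 2 * m ≤ ‖y‖
  null : k * (k * (1 - 2 * m / ‖y‖) - 2 * (inner ℝ y q / ‖y‖)) - L ^ 2 / ‖y‖ ^ 2 = 0
  energy_nonneg : 0 ≤ k * (1 - 2 * m / ‖y‖) - inner ℝ y q / ‖y‖
  future : 0 < k - inner ℝ y q / ‖y‖
  angular : ‖y‖ ^ 2 * ‖q‖ ^ 2 - inner ℝ y q ^ 2 = L ^ 2

theorem isOrbit_of_field {m L S : ℝ} (hm : 0 < m) (hL : 0 ≤ L) (hS : 0 ≤ S) {Z : ℝ → OrbitSpace}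
    (hZ0 : ∀ s ∈ Icc 0 S, (Z s).1.1 ≠ 0) (hZ : ∀ s ∈ Icc 0 S, HasDerivAt Z (orbitField m L (Z s)) s)
    (hf : IsNullState m L (Z S).1.1 (Z S).1.2 (Z S).2.2) :
    ∃ E, IsOrbit m E L S (fun s => (Z s).1.1) (fun s => (Z s).1.2) (fun s => (Z s).2.1)
      (fun s => (Z s).2.2) := by
  have hy : ∀ s ∈ Icc 0 S, HasDerivAt (fun s => (Z s).1.1) ((Z s).1.2) s := fun s hs =>
    (hZ s hs).fst.fst
  have hq : ∀ s ∈ Icc 0 S, HasDerivAt (fun s => (Z s).1.2)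
      (-(3 * m * L ^ 2 / ‖(Z s).1.1‖ ^ 5) • (Z s).1.1) s := fun s hs => (hZ s hs).fst.snd
  have hang : ∀ s ∈ Icc 0 S, ‖(Z s).1.1‖ ^ 2 * ‖(Z s).1.2‖ ^ 2
      - inner ℝ (Z s).1.1 (Z s).1.2 ^ 2 = L ^ 2 := fun s hs =>
    (angular_momentum_const hy hq hs).trans hf.angular
  refine ⟨_, radialOrbit_of_final hm hL hS (fun s hs => norm_pos_iff.2 (hZ0 s hs))
    (fun s hs => hasDerivAt_norm_of_ne (hy s hs) (hZ0 s hs))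
    (fun s hs => hasDerivAt_radial_velocity (hZ0 s hs) (hy s hs) (hq s hs) (hang s hs))
    (fun s hs => (hZ s hs).snd.fst) (fun s hs => (hZ s hs).snd.snd)
    hf.le_r hf.null hf.energy_nonneg hf.future, hy, hq, hang⟩

theorem IsOrbit.norm_q_le {m E L S : ℝ} {y q : ℝ → E3} {t k : ℝ → ℝ} (o : IsOrbit m E L S y q t k)
    {s : ℝ} (hs : s ∈ Icc 0 S) : ‖q s‖ ≤ k s - inner ℝ (y s) (q s) / ‖y s‖ := by
  have hr := o.radial.r_pos hs
  have hm := o.radial.m_pos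
  have h1 := o.radial.future_sq hs
  have h2 := o.angular s hs
  refine abs_le_of_sq_le_sq' ?_ (o.radial.future s hs).le |>.2
  have h3 : ‖q s‖ ^ 2 = L ^ 2 / ‖y s‖ ^ 2 + (inner ℝ (y s) (q s) / ‖y s‖) ^ 2 := by
    rw [← h2]; field_simp; ring
  have h4 : 0 ≤ 2 * m / ‖y s‖ * k s ^ 2 := by positivity
  linarith

theorem IsOrbit.shift {m E L S : ℝ} {y q : ℝ → E3} {t k : ℝ → ℝ} (o : IsOrbit m E L S y q t k)
    {a : ℝ} (ha : 0 ≤ a) : IsOrbit m E L (S - a) (fun s => y (s + a)) (fun s => q (s + a))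
      (fun s => t (s + a)) (fun s => k (s + a)) := by
  have hsub : ∀ s ∈ Icc 0 (S - a), s + a ∈ Icc 0 S := fun s hs =>
    ⟨by linarith [hs.1], by linarith [hs.2]⟩
  exact ⟨o.radial.shift ha, fun s hs => (o.deriv_y _ (hsub s hs)).comp_add_const s a,
    fun s hs => (o.deriv_q _ (hsub s hs)).comp_add_const s a, fun s hs => o.angular _ (hsub s hs)⟩

/-- Every null state is the end of an orbit that starts at `t* ≤ -1`. -/
theorem exists_orbit_backwards {m L t₁ k₁ : ℝ} {y₁ q₁ : E3} (hm : 0 < m) (hL : 0 ≤ L) (ht : 0 < t₁)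
    (hf : IsNullState m L y₁ q₁ k₁) :
    ∃ (E S : ℝ) (y q : ℝ → E3) (t k : ℝ → ℝ), 0 ≤ S ∧ IsOrbit m E L S y q t k ∧ t 0 ≤ -1 ∧
      y S = y₁ ∧ q S = q₁ ∧ t S = t₁ ∧ k S = k₁ := by
  set P := k₁ - inner ℝ y₁ q₁ / ‖y₁‖ with hP
  have hP0 : 0 < P := hf.future
  set e := Real.exp ((t₁ + 1) / m) with he
  have he1 : 1 ≤ e := Real.one_le_exp (by positivity)
  have he0 : 0 < e := by linarith
  -- The box is large enough for everything with t* > −1: r + t* has derivative k ≥ 0, which bounds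
  -- r in the past, and p^{t*} ≤ P e bounds |q|, |p| and, with factor 2, |k|.
  set B := ‖y₁‖ + t₁ + 2 + 2 * (P * e) with hB
  have hPe : 0 < P * e := by positivity
  have hy1 := norm_nonneg y₁
  -- A lower bound for dt*/ds as long as t* ≥ −1; affine time (t₁ + 1)/c therefore suffices to
  -- descend from t₁ to −1.
  set c := P * Real.exp (-((t₁ + 1) / m)) with hc
  have hc0 : 0 < c := by positivity
  set S := (t₁ + 1) / c with hSdef
  have hS0 : 0 ≤ S := by positivity
  have hPle : P ≤ P * e := le_mul_of_one_le_right hP0.le he1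
  have hn1 : 0 < ‖y₁‖ := by linarith [hf.le_r]
  -- bounds at the final state
  have hinit : ((y₁, q₁), (t₁, k₁)) ∈ orbitBox m B := by
    have hang := hf.angular
    have hnull := hf.null
    have hsq : P ^ 2 = ‖q₁‖ ^ 2 + 2 * m / ‖y₁‖ * k₁ ^ 2 := by
      have h3 : ‖q₁‖ ^ 2 = L ^ 2 / ‖y₁‖ ^ 2 + (inner ℝ y₁ q₁ / ‖y₁‖) ^ 2 := by
        rw [← hang]; field_simp; ring
      rw [h3, hP]
      linear_combination hnull
    have h4 : 0 ≤ 2 * m / ‖y₁‖ * k₁ ^ 2 := by positivity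
    have hq : ‖q₁‖ ≤ P := abs_le_of_sq_le_sq' (by linarith) hP0.le |>.2
    have hp : |inner ℝ y₁ q₁ / ‖y₁‖| ≤ ‖q₁‖ := by
      rw [abs_div, abs_of_pos hn1, div_le_iff₀ hn1, mul_comm]
      exact abs_real_inner_le_norm _ _
    have hk : |k₁| ≤ 2 * P := by
      have : k₁ = P + inner ℝ y₁ q₁ / ‖y₁‖ := by rw [hP]; ring
      rw [this]
      refine (abs_add_le _ _).trans ?_
      rw [abs_of_pos hP0]; linarith
    refine ⟨by linarith [hf.le_r], ?_, ?_, ?_, ?_, ?_⟩ <;> simp only <;> linarith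
  obtain ⟨Z, s₁, hs₁, hZ0, hZ, hexit⟩ := exists_integralCurve_until_exit
    (v := fun z => -orbitField m L z) (U := {z : OrbitSpace | z.1.1 ≠ 0})
    (isOpen_ne_fun (by fun_prop) continuous_const) (contDiffOn_orbitField m L).neg
    (isCompact_orbitBox m B) (fun z hz => norm_pos_iff.1 (hm.trans_le hz.1)) hinit hS0
  have hrev : ∀ s ∈ Icc 0 s₁, s₁ - s ∈ Icc 0 s₁ := fun s hs =>
    ⟨by linarith [hs.2], by linarith [hs.1]⟩
  have hend : Z (s₁ - s₁) = ((y₁, q₁), (t₁, k₁)) := by rw [sub_self, hZ0]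
  -- The curve was obtained for the reversed field; reversing its parameter turns its starting point
  -- into the end of an orbit.
  obtain ⟨E, o⟩ := isOrbit_of_field hm hL hs₁.1 (Z := fun s => Z (s₁ - s))
    (fun s hs => norm_pos_iff.1 (hm.trans_le (hZ _ (hrev s hs)).1.1))
    (fun s hs => by
      have := HasDerivAt.scomp s (hZ _ (hrev s hs)).2 ((hasDerivAt_id s).const_sub s₁)
      refine this.congr_deriv ?_
      simp)
    (by rw [hend]; exact hf)
  have hbox : ∀ s ∈ Icc 0 s₁, Z (s₁ - s) ∈ orbitBox m B := fun s hs => (hZ _ (hrev s hs)).1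
  have hs₁' : s₁ ∈ Icc 0 s₁ := ⟨hs₁.1, le_rfl⟩
  have h0' : (0 : ℝ) ∈ Icc 0 s₁ := ⟨le_rfl, hs₁.1⟩
  refine ⟨E, s₁, _, _, _, _, hs₁.1, o, ?_, ?_, ?_, ?_, ?_⟩
  · rcases hexit with hexit | hexit
    · have hd : ∀ s ∈ Icc 0 s₁, HasDerivAt (fun s => (Z (s₁ - s)).2.1 - c * s)
          ((Z (s₁ - s)).2.2 - inner ℝ (Z (s₁ - s)).1.1 (Z (s₁ - s)).1.2 / ‖(Z (s₁ - s)).1.1‖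
            - c * 1) s := fun s hs =>
        (o.radial.deriv_t s hs).sub ((hasDerivAt_id s).const_mul c)
      have h1 := le_of_hasDerivAt_nonneg hs₁.1 hd fun s hs => by
        have h2 := o.radial.le_future hs
        simp only [hend] at h2
        have h3 : c ≤ P * Real.exp (-((t₁ - (Z (s₁ - s)).2.1) / m)) := by
          rw [hc]
          gcongr
          linarith [(hbox s hs).2.2.2.1]
        linarith
      rw [hend, hexit] at h1
      have h4 : c * S = t₁ + 1 := by rw [hSdef]; field_simp
      rw [h4] at h1
      simp only [mul_zero, sub_zero] at h1
      simp only [hexit, sub_zero]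
      linarith
    -- With t* > −1 all defining inequalities of the box would be strict (r ≥ 2m > m in particular),
    -- so the exit can only take place at t* ≤ −1.
    · by_contra hcon
      push Not at hcon
      simp only [sub_zero] at hcon
      refine hexit ?_
      have hfl := o.radial.future_le h0'
      have hrm := o.radial.le_r 0 h0'
      have hq := o.norm_q_le h0'
      have htm := o.radial.t_mono le_rfl hs₁.1 le_rfl
      simp only [hend, sub_zero] at hfl hrm hq htm
      have hexp : Real.exp ((t₁ - (Z s₁).2.1) / m) ≤ e := by
        rw [he]; gcongr; linarith
      have hP1 : (Z s₁).2.2 - inner ℝ (Z s₁).1.1 (Z s₁).1.2 / ‖(Z s₁).1.1‖ ≤ P * e :=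
        hfl.trans (mul_le_mul_of_nonneg_left hexp hP0.le)
      have hn : 0 < ‖(Z s₁).1.1‖ := by linarith
      have hp : |inner ℝ (Z s₁).1.1 (Z s₁).1.2 / ‖(Z s₁).1.1‖| ≤ ‖(Z s₁).1.2‖ := by
        rw [abs_div, abs_of_pos hn, div_le_iff₀ hn, mul_comm]
        exact abs_real_inner_le_norm _ _
      have hp' := abs_le.1 hp
      have hv : ‖(Z s₁).1.1‖ + (Z s₁).2.1 ≤ ‖y₁‖ + t₁ := by
        have hd : ∀ s ∈ Icc 0 s₁, HasDerivAt (fun s => ‖(Z (s₁ - s)).1.1‖ + (Z (s₁ - s)).2.1)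
            _ s := fun s hs => (o.radial.deriv_r s hs).add (o.radial.deriv_t s hs)
        have h1 := le_of_hasDerivAt_nonneg hs₁.1 hd fun s hs => by
          have := o.radial.k_nonneg hs
          simpa using this
        simpa [hZ0] using h1
      refine mem_interior_orbitBox (by linarith) (by linarith) (by linarith) hcon (by linarith) ?_
      rw [abs_lt]
      constructor <;> linarith
  all_goals simp only [hend]

/-! ### Transport of the data and bounds on the support -/

theorem angMom_nonneg (x p : Event) : 0 ≤ angMom x p := mul_nonneg (norm_nonneg _) (norm_nonneg _)

theorem angMom_sq {x p : Event} (hx : radius x ≠ 0) :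
    ‖x.2‖ ^ 2 * ‖p.2‖ ^ 2 - inner ℝ x.2 p.2 ^ 2 = angMom x p ^ 2 := by
  rw [angMom, mul_pow, angNorm_sq x p hx]
  unfold pr
  change radius x ^ 2 * _ - _ = _
  field_simp

theorem isNullState_of_mem_massShell {m : ℝ} (hm : 0 < m) {x p : Event} (h : (x, p) ∈ massShell m) :
    IsNullState m (angMom x p) x.2 p.2 (p.1 + pr x p) := by
  obtain ⟨hx, hnull, hfut⟩ := h
  have hx2 : 2 * m ≤ radius x := hx
  have hr : 0 < radius x := by linarith
  have hnr : ‖x.2‖ = radius x := rfl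
  have hpr : inner ℝ x.2 p.2 / ‖x.2‖ = pr x p := rfl
  have hang := angMom_sq (p := p) hr.ne'
  have hfut' : 0 < p.1 := hfut
  have hinner : inner ℝ x.2 p.2 = pr x p * radius x := by unfold pr; field_simp
  have hN : (p.1 + pr x p) * ((p.1 + pr x p) * (1 - 2 * m / radius x) - 2 * pr x p)
      - angMom x p ^ 2 / radius x ^ 2 = 0 := by
    have h1 : metric m x p p = 0 := hnull
    rw [metric_eq_kerrSchild m hr.ne', real_inner_self_eq_norm_sq, hinner] at h1
    rw [hnr, hinner] at hang
    rw [← hang]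
    field_simp at h1 ⊢
    linear_combination -h1
  refine ⟨hx, by rw [hpr, hnr]; exact hN, ?_, by rw [hpr]; simpa using hfut', hang⟩
  rw [hpr, hnr]
  have hO : 0 ≤ 1 - 2 * m / radius x := by rw [sub_nonneg, div_le_one hr]; exact hx
  have hO1 : 1 - 2 * m / radius x ≤ 1 := by
    have : 0 ≤ 2 * m / radius x := by positivity
    linarith
  set k := p.1 + pr x p with hk
  set O := 1 - 2 * m / radius x
  have hL2 : 0 ≤ angMom x p ^ 2 / radius x ^ 2 := by positivity
  -- If E < 0, then p > kΩ². For k ≤ 0 this contradicts p < k ≤ kΩ²; for k > 0 the null condition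
  -- gives 2p ≤ kΩ², a contradiction as kΩ² ≥ 0.
  by_contra hc
  push Not at hc
  rcases le_total k 0 with h0 | h0
  · nlinarith
  · have h1 : 0 ≤ k * O := mul_nonneg h0 hO
    have h2 : 0 ≤ k * (k * O - 2 * pr x p) := by linarith
    rcases h0.eq_or_lt with h3 | h3
    · linarith
    · have := nonneg_of_mul_nonneg_right h2 h3
      linarith

/-- Every point of the mass shell in the future of `{τ = 0}` is reached by an orbit from `{τ = 0}`. -/
theorem exists_orbit_from_tau_zero {m R : ℝ} (hm : 0 < m) (hR : 2 * m < R) {x p : Event}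
    (hz : (x, p) ∈ massShellFuture m R) :
    ∃ (E S : ℝ) (y q : ℝ → E3) (t k : ℝ → ℝ), 0 ≤ S ∧ IsOrbit m E (angMom x p) S y q t k ∧
      tau m R (t 0, y 0) = 0 ∧ y S = x.2 ∧ q S = p.2 ∧ t S = x.1 ∧ k S = p.1 + pr x p := by
  have hτ : 0 < tau m R x := hz.2
  have ht : 0 < x.1 := by
    rw [tau_eq_radialTau] at hτ
    exact hτ.trans_le (radialTau_le hm hR)
  obtain ⟨E, S, y, q, t, k, hS, o, ht0, hyS, hqS, htS, hkS⟩ :=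
    exists_orbit_backwards hm (angMom_nonneg x p) ht (isNullState_of_mem_massShell hm hz.1)
  have hc : ContinuousOn (fun s => radialTau m R ‖y s‖ (t s)) (Icc 0 S) :=
    continuousOn_radialTau hR o.radial.continuousOn_r
      fun s hs => (o.radial.deriv_t s hs).continuousAt.continuousWithinAt
  have hτS : radialTau m R ‖y S‖ (t S) = tau m R x := by
    rw [hyS, htS, tau_eq_radialTau]; rfl
  -- The orbit begins with τ ≤ t* ≤ −1 and ends with τ > 0; the part before a zero of τ is discarded
  -- by shifting the parameter.
  obtain ⟨a, ha, hτa⟩ := intermediate_value_Icc hS hc (show (0 : ℝ) ∈ _ from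
    ⟨(radialTau_le hm hR).trans (by linarith), by simp only [hτS]; exact hτ.le⟩)
  refine ⟨E, S - a, _, _, _, _, by linarith [ha.2], o.shift ha.1, ?_, ?_, ?_, ?_, ?_⟩
  · rw [tau_eq_radialTau]
    simpa [radius] using hτa
  all_goals simpa

/-- What is known about a point of the support of the solution. -/
structure SupportBounds (m ρ Cr Cp : ℝ) (x p : Event) : Prop where
  two_m_le : 2 * m ≤ Cr
  energy_nonneg : 0 ≤ energy m x p
  energy_le : energy m x p ≤ Cp
  abs_pr_le : |pr x p| ≤ energy m x p
  angMom_le : angMom x p ≤ Cr * Cp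
  k_nonneg : 0 ≤ p.1 + pr x p
  k_le : p.1 + pr x p ≤ 2 * (Cp * (Cr / m))
  null : (p.1 + pr x p) * (energy m x p - pr x p) * radius x ^ 2 = angMom x p ^ 2
  late : flightConst ρ * (m + Cr ^ 2 / m) ≤ tau m (ρ * m) x →
    |pr x p - trapSlope m (radius x) * angMom x p| ≤ 9 * ρ * (2 * (Cp * (Cr / m))) *
      Real.exp (-(1 / (2 * ρ ^ 4) / m * (tau m (ρ * m) x - flightConst ρ * (m + Cr ^ 2 / m)))) ∧
    (ρ * m ≤ radius x → (1 - 2 / ρ) * angMom x p ^ 2 ≤ (ρ * m * energy m x p) ^ 2 ∧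
      (radius x = ρ * m ∨ 0 ≤ pr x p))

/-- The representation formula: the solution is the datum evaluated at the foot of the backward
geodesic. The orbit is kept for transporting bounds. -/
theorem exists_initial_value {m R : ℝ} {f₀ f : Phase → ℝ} (hm : 0 < m) (hR : 2 * m < R)
    (hf : IsVlasovSolution m R f₀ f) {x p : Event} (hz : (x, p) ∈ massShellFuture m R) :
    ∃ (E S : ℝ) (y q : ℝ → E3) (t k : ℝ → ℝ), 0 ≤ S ∧ IsOrbit m E (angMom x p) S y q t k ∧
      y S = x.2 ∧ q S = p.2 ∧ t S = x.1 ∧ k S = p.1 + pr x p ∧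
      ((t 0, y 0), (k 0 - inner ℝ (y 0) (q 0) / ‖y 0‖, q 0)) ∈ massShell0 m R ∧
      f (x, p) = f₀ ((t 0, y 0), (k 0 - inner ℝ (y 0) (q 0) / ‖y 0‖, q 0)) := by
  obtain ⟨E, S, y, q, t, k, hS, o, hτ0, hyS, hqS, htS, hkS⟩ := exists_orbit_from_tau_zero hm hR hz
  have hgeo := isNullGeodesic_of_orbit o.radial o.deriv_y o.deriv_q o.angular
  have hxe : (t S, y S) = x := by rw [htS, hyS]
  have hpe : (k S - inner ℝ (y S) (q S) / ‖y S‖, q S) = p := by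
    rw [hkS, hyS, hqS]
    change (p.1 + pr x p - pr x p, p.2) = p
    rw [add_sub_cancel_right]
  refine ⟨E, S, y, q, t, k, hS, o, hyS, hqS, htS, hkS, ⟨(hgeo 0 ⟨le_rfl, hS⟩).1, hτ0⟩, ?_⟩
  have := hf.initial S _ _ hS hgeo hτ0 (by simp only [hxe]; exact hz.2)
  simp only [hxe, hpe] at this
  exact this

theorem value_bounds {m R Cr Cp : ℝ} {f₀ f : Phase → ℝ} (hm : 0 < m) (hR : 2 * m < R)
    (h₀ : IsInitialDatum m R Cr Cp f₀) (hf : IsVlasovSolution m R f₀ f) {x p : Event}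
    (hz : (x, p) ∈ massShellFuture m R) : 0 ≤ f (x, p) ∧ f (x, p) ≤ dataNorm m R f₀ := by
  obtain ⟨E, S, y, q, t, k, -, -, -, -, -, -, hmem, heq⟩ := exists_initial_value hm hR hf hz
  rw [heq]
  exact ⟨h₀.nonneg _ hmem, (le_abs_self _).trans (le_csSup h₀.bounded ⟨_, hmem, rfl⟩)⟩

/-- Where f does not vanish, the orbit starts in the support of the datum. E and L are conserved and
can be estimated there, k is propagated by `RadialOrbit.k_le`, and the late-time statement is
`RadialOrbit.late_time`. -/
theorem supportBounds_of_ne_zero {m ρ Cr Cp : ℝ} {f₀ f : Phase → ℝ} (hm : 0 < m) (hρ : 3 < ρ)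
    (hCp : 0 < Cp) (h₀ : IsInitialDatum m (ρ * m) Cr Cp f₀) (hf : IsVlasovSolution m (ρ * m) f₀ f)
    {x p : Event} (hz : (x, p) ∈ massShellFuture m (ρ * m)) (hne : f (x, p) ≠ 0) :
    SupportBounds m ρ Cr Cp x p := by
  have hR : 2 * m < ρ * m := by nlinarith
  obtain ⟨E, S, y, q, t, k, hS, o, hyS, hqS, htS, hkS, hmem, heq⟩ := exists_initial_value hm hR hf hz
  rw [heq] at hne
  obtain ⟨hr0, hp0, hpr0, hang0⟩ := h₀.support _ ⟨subset_closure ⟨hmem, hne⟩, hmem⟩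
  have h0' : (0 : ℝ) ∈ Icc 0 S := ⟨le_rfl, hS⟩
  have hS' : S ∈ Icc 0 S := ⟨hS, le_rfl⟩
  have o' := o.radial
  have hrS : ‖y S‖ = radius x := by rw [hyS]; rfl
  have hpS : inner ℝ (y S) (q S) / ‖y S‖ = pr x p := by rw [hyS, hqS]; rfl
  have h2m : 2 * m ≤ ‖y 0‖ := o'.le_r 0 h0'
  have hr0' : ‖y 0‖ ≤ Cr := hr0
  have hp0' : k 0 - inner ℝ (y 0) (q 0) / ‖y 0‖ ≤ Cp := hp0
  have hpr0' : |inner ℝ (y 0) (q 0) / ‖y 0‖| ≤ Cp := hpr0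
  have hCr : 2 * m ≤ Cr := h2m.trans hr0'
  have hrpos : 0 < radius x := by rw [← hrS]; exact o'.r_pos hS'
  have hEeq : E = energy m x p := by
    have h1 := o'.energy_eq S hS'
    rw [hpS, hrS, hkS] at h1
    unfold energy Omega2
    field_simp
    linarith
  have hLeq : angMom x p = ‖y 0‖ * angNorm (t 0, y 0) (k 0 - inner ℝ (y 0) (q 0) / ‖y 0‖, q 0) := by
    have h1 := o.angular 0 h0'
    have h2 := angMom_sq (x := (t 0, y 0)) (p := (k 0 - inner ℝ (y 0) (q 0) / ‖y 0‖, q 0))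
      (o'.r_pos h0').ne'
    have h3 := (sq_eq_sq₀ (angMom_nonneg x p) (angMom_nonneg _ _)).1 (h1.symm.trans h2)
    rw [h3]; rfl
  have hLle : angMom x p ≤ Cr * Cp := by
    rw [hLeq]
    exact mul_le_mul hr0' hang0 (norm_nonneg _) (by linarith)
  -- From r(E + p) = k(r − 2m) ≤ kr one gets E ≤ k − p = p^{t*} at the initial point.
  have hEle : E ≤ Cp := by
    have h1 := o'.energy_eq 0 h0'
    have h2 := o'.k_nonneg h0'
    have h3 := o'.r_pos h0'
    have h4 : ‖y 0‖ * (E + inner ℝ (y 0) (q 0) / ‖y 0‖) ≤ ‖y 0‖ * k 0 := by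
      rw [← h1]; nlinarith
    have := le_of_mul_le_mul_left h4 h3
    linarith
  have hratio : 2 ≤ Cr / m := by rw [le_div_iff₀ hm]; exact hCr
  have hB1 : 2 * Cp ≤ Cp * (Cr / m) := by
    rw [mul_comm]; exact mul_le_mul_of_nonneg_left hratio hCp.le
  have hk0 : k 0 ≤ 2 * (Cp * (Cr / m)) := by linarith [(abs_le.1 hpr0').2]
  have hEB : E ≤ 2 * (Cp * (Cr / m)) := by linarith
  have hLB : angMom x p / m ≤ 2 * (Cp * (Cr / m)) := by
    have : angMom x p / m ≤ Cr * Cp / m := by gcongr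
    have h2 : Cr * Cp / m = Cp * (Cr / m) := by ring
    linarith
  have hτ0 : radialTau m (ρ * m) ‖y 0‖ (t 0) = 0 := by
    have := hmem.2
    rw [tau_eq_radialTau] at this
    exact this
  have hτS : radialTau m (ρ * m) ‖y S‖ (t S) = tau m (ρ * m) x := by
    rw [hrS, htS, tau_eq_radialTau]
  refine ⟨hCr, hEeq ▸ o'.E_nonneg, hEeq ▸ hEle, ?_, hLle, ?_, ?_, ?_, fun hT => ?_⟩
  · rw [← hpS, ← hEeq]; exact o'.abs_p_le hS'
  · rw [← hkS]; exact o'.k_nonneg hS'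
  · rw [← hkS]; exact o'.k_le hLB hk0 hS'
  · have := o'.null S hS'
    rw [hpS, hrS, hkS, hEeq] at this
    exact this
  · have := o'.late_time hρ hS hτ0 hr0' hk0 hEB hLB (by rw [hτS]; exact hT)
    rw [hτS, hpS, hrS, hEeq] at this
    exact this

/-! ### Singular integrals over thin slabs in momentum space -/

/-- The weight `|a|^{-1/2}` with value `∞` at `0`. -/
def invSqrt (a : ℝ) : ENNReal := (ENNReal.ofReal √|a|)⁻¹

theorem measurable_invSqrt : Measurable invSqrt := by
  unfold invSqrt
  fun_prop

theorem lintegral_invSqrt_Ioc {A : ℝ} (hA : 0 ≤ A) :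
    ∫⁻ a in Ioc 0 A, invSqrt a = ENNReal.ofReal (2 * √A) := by
  have h1 : ∫⁻ a in Ioc 0 A, invSqrt a = ∫⁻ a in Ioc 0 A, ENNReal.ofReal (a ^ (-(1 / 2) : ℝ)) := by
    refine setLIntegral_congr_fun measurableSet_Ioc fun a ha => ?_
    have ha0 : 0 < a := ha.1
    simp only [invSqrt]
    rw [abs_of_pos ha0, ← ENNReal.ofReal_inv_of_pos (Real.sqrt_pos.2 ha0), Real.rpow_neg ha0.le,
      Real.sqrt_eq_rpow]
  have h2 : IntervalIntegrable (fun a : ℝ => a ^ (-(1 / 2) : ℝ)) volume 0 A :=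
    intervalIntegral.intervalIntegrable_rpow' (by norm_num)
  have h3 : ∫ a in (0 : ℝ)..A, a ^ (-(1 / 2) : ℝ) = 2 * √A := by
    rw [integral_rpow (Or.inl (by norm_num)), Real.sqrt_eq_rpow, Real.zero_rpow (by norm_num)]
    norm_num
    ring
  rw [h1, ← ofReal_integral_eq_lintegral_ofReal ((intervalIntegrable_iff_integrableOn_Ioc_of_le hA).1 h2),
    ← intervalIntegral.integral_of_le hA, h3]
  filter_upwards [ae_restrict_mem measurableSet_Ioc] with a ha
  exact Real.rpow_nonneg ha.1.le _

theorem lintegral_invSqrt_Icc {A : ℝ} (hA : 0 ≤ A) :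
    ∫⁻ a in Icc (-A) A, invSqrt a ≤ ENNReal.ofReal (4 * √A) := by
  have h1 : ∫⁻ a in Ico (-A) 0, invSqrt a = ∫⁻ a in Ioc 0 A, invSqrt a := by
    have h := (Measure.measurePreserving_neg (volume : Measure ℝ)).setLIntegral_comp_preimage
      (s := Ico (-A) 0) measurableSet_Ico measurable_invSqrt
    rw [← h]
    have h2 : (Neg.neg ⁻¹' Ico (-A) 0 : Set ℝ) = Ioc 0 A := by
      ext a; simp only [mem_preimage, mem_Ico, mem_Ioc]; constructor <;> rintro ⟨h, h'⟩ <;>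
        constructor <;> linarith
    rw [h2]
    refine setLIntegral_congr_fun measurableSet_Ioc fun a _ => ?_
    simp [invSqrt]
  have h2 : Icc (-A) A ⊆ (Ico (-A) 0 ∪ Ioc 0 A) ∪ {0} := by
    intro a ha
    rcases lt_trichotomy a 0 with h | h | h
    · exact Or.inl (Or.inl ⟨ha.1, h⟩)
    · exact Or.inr h
    · exact Or.inl (Or.inr ⟨h, ha.2⟩)
  calc ∫⁻ a in Icc (-A) A, invSqrt a ≤ ∫⁻ a in (Ico (-A) 0 ∪ Ioc 0 A) ∪ {0}, invSqrt a :=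
        lintegral_mono_set h2
    _ ≤ ((∫⁻ a in Ico (-A) 0, invSqrt a) + ∫⁻ a in Ioc 0 A, invSqrt a) + ∫⁻ a in {0}, invSqrt a :=
        (lintegral_union_le _ _ _).trans (by gcongr; exact lintegral_union_le _ _ _)
    _ = ENNReal.ofReal (4 * √A) := by
        rw [h1, lintegral_invSqrt_Ioc hA, ← ENNReal.ofReal_add (by positivity) (by positivity),
          setLIntegral_measure_zero _ _ (by simp), add_zero]
        congr 1
        ring

/-- The bound is uniform in the centre: the part in [−D, D] contributes at most 4√D, and elsewhere
the weight is at most D^(-1/2) on a set of length at most 2D. -/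
theorem lintegral_invSqrt_ball_le (c : ℝ) {D : ℝ} (hD : 0 < D) :
    ∫⁻ a in Icc (c - D) (c + D), invSqrt a ≤ ENNReal.ofReal (6 * √D) := by
  have hs := Real.sqrt_pos.2 hD
  have h1 : Icc (c - D) (c + D) ⊆ Icc (-D) D ∪ (Icc (c - D) (c + D) \ Icc (-D) D) := by
    rw [union_sdiff_self]; exact subset_union_right
  have h2 : ∫⁻ a in Icc (c - D) (c + D) \ Icc (-D) D, invSqrt a
      ≤ ENNReal.ofReal (2 * √D) := by
    calc ∫⁻ a in Icc (c - D) (c + D) \ Icc (-D) D, invSqrt a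
        ≤ ∫⁻ _ in Icc (c - D) (c + D) \ Icc (-D) D, ENNReal.ofReal (√D)⁻¹ := by
          refine setLIntegral_mono' (measurableSet_Icc.diff measurableSet_Icc) fun a ha => ?_
          have h3 : D ≤ |a| := by
            by_contra hc
            push Not at hc
            exact ha.2 ⟨(abs_le.1 hc.le).1, (abs_le.1 hc.le).2⟩
          rw [invSqrt, ENNReal.ofReal_inv_of_pos hs]
          gcongr
      _ ≤ ENNReal.ofReal (√D)⁻¹ * volume (Icc (c - D) (c + D)) := by
          rw [setLIntegral_const]
          gcongr
          exact sdiff_subset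
      _ = ENNReal.ofReal (2 * √D) := by
          rw [Real.volume_Icc, ← ENNReal.ofReal_mul (by positivity)]
          congr 1
          have : D = √D * √D := (Real.mul_self_sqrt hD.le).symm
          field_simp
          rw [Real.sq_sqrt hD.le]
          ring
  calc ∫⁻ a in Icc (c - D) (c + D), invSqrt a
      ≤ (∫⁻ a in Icc (-D) D, invSqrt a) + ∫⁻ a in Icc (c - D) (c + D) \ Icc (-D) D, invSqrt a :=
        (lintegral_mono_set h1).trans (lintegral_union_le _ _ _)
    _ ≤ ENNReal.ofReal (4 * √D) + ENNReal.ofReal (2 * √D) := by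
        gcongr
        exact lintegral_invSqrt_Icc hD.le
    _ = _ := by
        rw [← ENNReal.ofReal_add (by positivity) (by positivity)]
        congr 1
        ring

/-- The region `|a|, |b| ≤ A`, `|P - σ √(a² + b²)| ≤ D` in coordinates `(P, a, b)`. -/
def slab (σ A D : ℝ) : Set (ℝ × (ℝ × ℝ)) :=
  {z | |z.1 - σ * √(z.2.1 ^ 2 + z.2.2 ^ 2)| ≤ D ∧ |z.2.1| ≤ A ∧ |z.2.2| ≤ A}

theorem measurableSet_slab (σ A D : ℝ) : MeasurableSet (slab σ A D) := by
  refine IsClosed.measurableSet ?_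
  have h1 : Continuous fun z : ℝ × (ℝ × ℝ) => |z.1 - σ * √(z.2.1 ^ 2 + z.2.2 ^ 2)| := by fun_prop
  have h2 : Continuous fun z : ℝ × (ℝ × ℝ) => |z.2.1| := by fun_prop
  have h3 : Continuous fun z : ℝ × (ℝ × ℝ) => |z.2.2| := by fun_prop
  exact (isClosed_le h1 continuous_const).inter
    ((isClosed_le h2 continuous_const).inter (isClosed_le h3 continuous_const))

theorem measurable_slab_indicator (σ A D : ℝ) : Measurable ((slab σ A D).indicator
    (fun z : ℝ × (ℝ × ℝ) => invSqrt z.1 * (invSqrt z.2.1 * invSqrt z.2.2))) := by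
  refine Measurable.indicator ?_ (measurableSet_slab σ A D)
  exact (measurable_invSqrt.comp measurable_fst).mul
    ((measurable_invSqrt.comp (measurable_fst.comp measurable_snd)).mul
      (measurable_invSqrt.comp (measurable_snd.comp measurable_snd)))

/-- For fixed (a, b) the first variable ranges over an interval of radius D, whose centre is
irrelevant: 6√D, times (4√A)² for a and b. No bound on the slope σ is needed. -/
theorem lintegral_slab_le (σ : ℝ) {A D : ℝ} (hA : 0 ≤ A) (hD : 0 < D) :
    ∫⁻ z, (slab σ A D).indicator (fun z => invSqrt z.1 * (invSqrt z.2.1 * invSqrt z.2.2)) z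
      ≤ ENNReal.ofReal (96 * A * √D) := by
  have hmeas := measurable_slab_indicator σ A D
  have hI := lintegral_invSqrt_Icc hA
  set J : ℝ → ENNReal := (Icc (-A) A).indicator invSqrt with hJ
  have hJm : Measurable J := measurable_invSqrt.indicator measurableSet_Icc
  have hJi : ∫⁻ a, J a ≤ ENNReal.ofReal (4 * √A) := by
    rw [hJ, lintegral_indicator measurableSet_Icc]; exact hI
  rw [Measure.volume_eq_prod, lintegral_prod_symm _ hmeas.aemeasurable]
  calc ∫⁻ y : ℝ × ℝ, ∫⁻ x, (slab σ A D).indicator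
        (fun z => invSqrt z.1 * (invSqrt z.2.1 * invSqrt z.2.2)) (x, y)
      ≤ ∫⁻ y : ℝ × ℝ, ENNReal.ofReal (6 * √D) * (J y.1 * J y.2) := by
        refine lintegral_mono fun y => ?_
        have hle : ∀ x, (slab σ A D).indicator
            (fun z => invSqrt z.1 * (invSqrt z.2.1 * invSqrt z.2.2)) (x, y)
            ≤ (Icc (σ * √(y.1 ^ 2 + y.2 ^ 2) - D) (σ * √(y.1 ^ 2 + y.2 ^ 2) + D)).indicator invSqrt x
              * (J y.1 * J y.2) := by
          intro x
          by_cases hx : (x, y) ∈ slab σ A D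
          · rw [indicator_of_mem hx]
            obtain ⟨h1, h2, h3⟩ := hx
            have h1' := abs_le.1 h1
            rw [indicator_of_mem (show x ∈ Icc _ _ from ⟨by linarith [h1'.1], by linarith [h1'.2]⟩),
              hJ, indicator_of_mem (show y.1 ∈ Icc (-A) A from abs_le.1 h2),
              indicator_of_mem (show y.2 ∈ Icc (-A) A from abs_le.1 h3)]
          · rw [indicator_of_notMem hx]; exact zero_le
        calc _ ≤ ∫⁻ x, (Icc (σ * √(y.1 ^ 2 + y.2 ^ 2) - D)
              (σ * √(y.1 ^ 2 + y.2 ^ 2) + D)).indicator invSqrt x * (J y.1 * J y.2) :=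
              lintegral_mono hle
          _ = (∫⁻ x in Icc (σ * √(y.1 ^ 2 + y.2 ^ 2) - D) (σ * √(y.1 ^ 2 + y.2 ^ 2) + D), invSqrt x)
              * (J y.1 * J y.2) := by
              rw [lintegral_mul_const _ (measurable_invSqrt.indicator measurableSet_Icc),
                lintegral_indicator measurableSet_Icc]
          _ ≤ _ := by
              gcongr
              exact lintegral_invSqrt_ball_le _ hD
    _ = ENNReal.ofReal (6 * √D) * ((∫⁻ a, J a) * ∫⁻ b, J b) := by
        have hm : Measurable fun y : ℝ × ℝ => J y.1 * J y.2 :=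
          (hJm.comp measurable_fst).mul (hJm.comp measurable_snd)
        rw [lintegral_const_mul _ hm, Measure.volume_eq_prod, lintegral_prod_mul hJm.aemeasurable hJm.aemeasurable]
    _ ≤ ENNReal.ofReal (6 * √D) * (ENNReal.ofReal (4 * √A) * ENNReal.ofReal (4 * √A)) := by gcongr
    _ = ENNReal.ofReal (96 * A * √D) := by
        rw [← ENNReal.ofReal_mul (by positivity), ← ENNReal.ofReal_mul (by positivity)]
        congr 1
        have : √A * √A = A := Real.mul_self_sqrt hA
        linear_combination 96 * √D * this

/-- Orthonormal coordinates `(P, a, b)` on momentum space with `P = p^r`. -/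
theorem exists_fibre_coordinates {x : Event} (hx : radius x ≠ 0) :
    ∃ φ : E3 → ℝ × (ℝ × ℝ), MeasurePreserving φ ∧ ∀ q, (φ q).1 = pr x (0, q) ∧
      (φ q).2.1 ^ 2 + (φ q).2.2 ^ 2 = angNorm x (0, q) ^ 2 := by
  have hn : ‖x.2‖ ≠ 0 := hx
  have horth : Orthonormal ℝ (({0} : Set (Fin 3)).domRestrict fun _ => (‖x.2‖)⁻¹ • x.2) := by
    refine ⟨fun i => ?_, fun i j hij => absurd (Subsingleton.elim i j) hij⟩
    change ‖(‖x.2‖)⁻¹ • x.2‖ = 1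
    rw [norm_smul, norm_inv, norm_norm, inv_mul_cancel₀ hn]
  obtain ⟨b, hb⟩ := horth.exists_orthonormalBasis_extension_of_card_eq (by simp)
  have hb0 : b 0 = (‖x.2‖)⁻¹ • x.2 := hb 0 rfl
  have hmp := ((MeasurePreserving.id (volume : Measure ℝ)).prod (volume_preserving_finTwoArrow ℝ)).comp
    ((volume_preserving_piFinSuccAbove (fun _ : Fin 3 => ℝ) 0).comp
      ((PiLp.volume_preserving_ofLp (Fin 3)).comp b.measurePreserving_repr))
  refine ⟨_, hmp, fun q => ?_⟩
  have h0 : b.repr q 0 = pr x (0, q) := by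
    rw [b.repr_apply_apply, hb0, inner_smul_left]
    unfold pr radius
    simp [div_eq_inv_mul]
  have hsum : b.repr q 0 ^ 2 + b.repr q 1 ^ 2 + b.repr q 2 ^ 2 = ‖q‖ ^ 2 := by
    rw [← b.repr.norm_map q, EuclideanSpace.norm_sq_eq, Fin.sum_univ_three]
    simp
  refine ⟨h0, ?_⟩
  rw [angNorm_sq x (0, q) hx, ← h0]
  change b.repr q 1 ^ 2 + b.repr q 2 ^ 2 = ‖q‖ ^ 2 - _
  linarith

/-- Splitting 1/N by |ab| ≤ N² turns the singularity in the plane into a product of one-dimensional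
ones, so that Tonelli applies without polar coordinates. -/
theorem inv_ofReal_angNorm_le {a b N : ℝ} (hN : 0 ≤ N) (h : a ^ 2 + b ^ 2 = N ^ 2) :
    (ENNReal.ofReal N)⁻¹ ≤ invSqrt a * invSqrt b := by
  have h1 : √|a| * √|b| ≤ N := by
    rw [← Real.sqrt_mul (abs_nonneg a)]
    refine Real.sqrt_le_iff.2 ⟨hN, ?_⟩
    rw [← h, ← sq_abs a, ← sq_abs b]
    nlinarith [sq_nonneg (|a| - |b|), abs_nonneg a, abs_nonneg b, mul_nonneg (abs_nonneg a) (abs_nonneg b)]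
  unfold invSqrt
  rw [← ENNReal.mul_inv (Or.inr ENNReal.ofReal_ne_top) (Or.inl ENNReal.ofReal_ne_top),
    ← ENNReal.ofReal_mul (Real.sqrt_nonneg _)]
  gcongr

/-- Integration over momenta in a slab around the unstable cone. -/
theorem lintegral_fibre_le {x : Event} (hx : radius x ≠ 0) (σ : ℝ) {A D : ℝ} (hA : 0 ≤ A) (hD : 0 < D)
    (c : ENNReal) {G : E3 → ENNReal}
    (hG : ∀ q, G q ≠ 0 → angNorm x (0, q) ≤ A ∧ |pr x (0, q) - σ * angNorm x (0, q)| ≤ D ∧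
      G q ≤ c * (invSqrt (pr x (0, q)) * (ENNReal.ofReal (angNorm x (0, q)))⁻¹)) :
    ∫⁻ q, G q ≤ c * ENNReal.ofReal (96 * A * √D) := by
  obtain ⟨φ, hφ, hφ'⟩ := exists_fibre_coordinates hx
  have hmeas := measurable_slab_indicator σ A D
  have hle : ∀ q, G q ≤ c * (slab σ A D).indicator
      (fun z => invSqrt z.1 * (invSqrt z.2.1 * invSqrt z.2.2)) (φ q) := by
    intro q
    by_cases h0 : G q = 0
    · rw [h0]; exact zero_le
    obtain ⟨hN, hP, hGq⟩ := hG q h0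
    obtain ⟨h1, h2⟩ := hφ' q
    have hN0 : 0 ≤ angNorm x (0, q) := norm_nonneg _
    have hmem : φ q ∈ slab σ A D := by
      refine ⟨?_, ?_, ?_⟩
      · rw [h1, h2, Real.sqrt_sq hN0]; exact hP
      · refine (abs_le_of_sq_le_sq ?_ hN0).trans hN
        nlinarith [sq_nonneg (φ q).2.2]
      · refine (abs_le_of_sq_le_sq ?_ hN0).trans hN
        nlinarith [sq_nonneg (φ q).2.1]
    rw [indicator_of_mem hmem]
    refine hGq.trans ?_
    rw [h1]
    gcongr
    exact inv_ofReal_angNorm_le hN0 h2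
  calc ∫⁻ q, G q ≤ ∫⁻ q, c * (slab σ A D).indicator
        (fun z => invSqrt z.1 * (invSqrt z.2.1 * invSqrt z.2.2)) (φ q) := lintegral_mono hle
    _ = c * ∫⁻ z, (slab σ A D).indicator
        (fun z => invSqrt z.1 * (invSqrt z.2.1 * invSqrt z.2.2)) z := by
        have hm : Measurable fun q => (slab σ A D).indicator
            (fun z => invSqrt z.1 * (invSqrt z.2.1 * invSqrt z.2.2)) (φ q) :=
          hmeas.comp hφ.measurable
        rw [lintegral_const_mul _ hm, hφ.lintegral_comp hmeas]
    _ ≤ _ := by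
        gcongr
        exact lintegral_slab_le σ hA hD

/-! ### The basic moment estimate -/

theorem measurable_lift_fst (m : ℝ) (x : Event) : Measurable fun q : E3 => (lift m x q).1 := by
  have h1 : Measurable fun q : E3 => pr x (0, q) := by unfold pr; fun_prop
  have h2 : Measurable fun q : E3 => angNorm x (0, q) := by unfold angNorm; fun_prop
  unfold lift
  fun_prop

theorem measurable_energy_lift (m : ℝ) (x : Event) :
    Measurable fun q : E3 => energy m x (lift m x q) := by
  have h1 : Measurable fun q : E3 => pr x (lift m x q) := by
    have : (fun q : E3 => pr x (lift m x q)) = fun q => inner ℝ x.2 q / radius x := rfl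
    rw [this]; fun_prop
  have h2 := measurable_lift_fst m x
  unfold energy
  fun_prop

theorem measurableSet_fibre {m : ℝ} (hm : 0 < m) {x : Event} (hx : x ∈ exterior m) :
    MeasurableSet {q : E3 | (x, lift m x q) ∈ massShell m} := by
  have h : {q : E3 | (x, lift m x q) ∈ massShell m} = {q | 0 < (lift m x q).1} := by
    ext q
    refine ⟨fun h => h.2.2, fun h => ?_⟩
    have h' : 0 < (lift m x q).1 := h
    -- At q = 0 the quotient defining the time component is 0/0 = 0, so the condition 0 < (lift m x
    -- q).1 already excludes the origin.
    have hq : q ≠ 0 := by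
      rintro rfl
      simp [lift, pr, angNorm] at h'
    exact (mem_massShell_iff m hm x hx q hq _).2 ⟨h', rfl⟩
  rw [h]
  exact measurableSet_lt measurable_const (measurable_lift_fst m x)

theorem ofReal_inv_le_invSqrt_mul {E P N Γ : ℝ} (hE : 0 ≤ E) (hΓ : 0 < Γ)
    (h : √|P| * N ≤ Γ * E) :
    ENNReal.ofReal E⁻¹ ≤ ENNReal.ofReal Γ * (invSqrt P * (ENNReal.ofReal N)⁻¹) := by
  -- At E = 0 the real inverse is 0 and the claim is trivial.
  rcases hE.eq_or_lt with h0 | h0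
  · simp [← h0]
  have h1 : invSqrt P * (ENNReal.ofReal N)⁻¹ = (ENNReal.ofReal (√|P| * N))⁻¹ := by
    rw [invSqrt, ← ENNReal.mul_inv (Or.inr ENNReal.ofReal_ne_top) (Or.inl ENNReal.ofReal_ne_top),
      ← ENNReal.ofReal_mul (Real.sqrt_nonneg _)]
  have h2 : (ENNReal.ofReal (Γ * E))⁻¹ ≤ (ENNReal.ofReal (√|P| * N))⁻¹ := by gcongr
  rw [h1]
  calc ENNReal.ofReal E⁻¹ = ENNReal.ofReal Γ * (ENNReal.ofReal (Γ * E))⁻¹ := by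
        rw [← ENNReal.ofReal_inv_of_pos (by positivity), ← ENNReal.ofReal_mul hΓ.le]
        congr 1
        field_simp
    _ ≤ _ := by gcongr

/-- On the support of the solution at late times, `√|p^r| |p̸|` is controlled by the energy. -/
theorem SupportBounds.sqrt_pr_mul_angNorm_le {m ρ Cr Cp : ℝ} {x p : Event} (hm : 0 < m) (hρ : 3 < ρ)
    (hCp : 0 < Cp) (hx : 2 * m ≤ radius x) (b : SupportBounds m ρ Cr Cp x p)
    (hτ : flightConst ρ * (m + Cr ^ 2 / m) ≤ tau m (ρ * m) x) :
    √|pr x p| * angNorm x p ≤ 2 * ρ * (m / radius x) * √(Cp * (Cr / m)) * energy m x p := by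
  have hr : 0 < radius x := by linarith
  have hCr : 0 < Cr := by linarith [b.two_m_le]
  set Q := Cp * (Cr / m) with hQ
  have hQ0 : 0 < Q := by positivity
  have hN0 : 0 ≤ angNorm x p := norm_nonneg _
  have hE0 := b.energy_nonneg
  have hPE := b.abs_pr_le
  have hL : angMom x p = radius x * angNorm x p := rfl
  set E := energy m x p
  set N := angNorm x p
  have hsP : √|pr x p| ^ 2 = |pr x p| := Real.sq_sqrt (abs_nonneg _)
  have hsQ : √Q ^ 2 = Q := Real.sq_sqrt hQ0.le
  rcases le_total (radius x) (ρ * m) with hR | hR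
  -- Inside r ≤ R the null constraint |p̸|² = k(E − p), with k ≤ 2Q and E − p ≤ 2E, gives one power
  -- of E; |p| ≤ E supplies the other.
  · have h1 : N ^ 2 ≤ 4 * Q * E := by
      have h2 := b.null
      rw [hL, mul_pow] at h2
      have h3 : N ^ 2 = (p.1 + pr x p) * (E - pr x p) := by
        have : radius x ^ 2 * N ^ 2 = radius x ^ 2 * ((p.1 + pr x p) * (E - pr x p)) := by
          rw [← h2]; ring
        exact mul_left_cancel₀ (pow_ne_zero 2 hr.ne') this
      rw [h3]
      have h4 := abs_le.1 hPE
      calc (p.1 + pr x p) * (E - pr x p) ≤ (2 * Q) * (2 * E) :=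
            mul_le_mul b.k_le (by linarith) (by linarith) (by positivity)
        _ = _ := by ring
    have h5 : √|pr x p| * N ≤ 2 * √Q * E := by
      refine abs_le_of_sq_le_sq' ?_ (by positivity) |>.2
      calc (√|pr x p| * N) ^ 2 = |pr x p| * N ^ 2 := by rw [mul_pow, hsP]
        _ ≤ E * (4 * Q * E) := mul_le_mul hPE h1 (sq_nonneg _) hE0
        _ = (2 * √Q * E) ^ 2 := by rw [mul_pow, mul_pow, hsQ]; ring
    have h6 : 1 ≤ ρ * (m / radius x) := by
      rw [← mul_div_assoc, le_div_iff₀ hr, one_mul]; exact hR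
    calc √|pr x p| * N ≤ 1 * (2 * √Q * E) := by rw [one_mul]; exact h5
      _ ≤ ρ * (m / radius x) * (2 * √Q * E) := by gcongr
      _ = _ := by ring
  -- Outside, the orbit has come from r = R, so L is bounded by a multiple of mE. This also produces
  -- the factor m/r.
  · have h1 := ((b.late hτ).2 hR).1
    have hω : 1 / 4 ≤ 1 - 2 / ρ := by
      have : 2 / ρ ≤ 3 / 4 := by rw [div_le_iff₀ (by linarith)]; linarith
      linarith
    have h2 : radius x * N ≤ 2 * (ρ * m * E) := by
      refine abs_le_of_sq_le_sq' ?_ (by positivity) |>.2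
      rw [← hL]
      nlinarith [sq_nonneg (angMom x p)]
    have h3 : √|pr x p| ≤ √Q := by
      refine Real.sqrt_le_sqrt (hPE.trans (b.energy_le.trans ?_))
      have : 1 ≤ Cr / m := by rw [le_div_iff₀ hm]; linarith [b.two_m_le]
      rw [hQ]; exact le_mul_of_one_le_right hCp.le this
    have h4 : N ≤ 2 * ρ * (m / radius x) * E := by
      have : 2 * ρ * (m / radius x) * E = 2 * (ρ * m * E) / radius x := by ring
      rw [this, le_div_iff₀ hr]
      linarith
    calc √|pr x p| * N ≤ √Q * (2 * ρ * (m / radius x) * E) :=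
          mul_le_mul h3 h4 hN0 (Real.sqrt_nonneg _)
      _ = _ := by ring

theorem dataNorm_nonneg (m R : ℝ) (f₀ : Phase → ℝ) : 0 ≤ dataNorm m R f₀ :=
  Real.sSup_nonneg (by rintro _ ⟨z, -, rfl⟩; exact abs_nonneg _)

/-- Moments whose weight is at most `Wb` on the support of the solution. -/
theorem moment_le {m ρ Cr Cp Wb : ℝ} {f₀ f w : Phase → ℝ} (hm : 0 < m) (hρ : 3 < ρ)
    (hCr : 0 < Cr) (hCp : 0 < Cp) (h₀ : IsInitialDatum m (ρ * m) Cr Cp f₀)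
    (hf : IsVlasovSolution m (ρ * m) f₀ f) {x : Event} (hx : x ∈ exterior m)
    (hτ : flightConst ρ * (m + Cr ^ 2 / m) ≤ tau m (ρ * m) x) (hWb : 0 ≤ Wb)
    (hw : ∀ p, (x, p) ∈ massShellFuture m (ρ * m) → f (x, p) ≠ 0 → SupportBounds m ρ Cr Cp x p →
      w (x, p) ≤ Wb) :
    moment m w f x ≤ ENNReal.ofReal (Wb * dataNorm m (ρ * m) f₀ * (576 * ρ ^ 2
      * (Cp ^ 2 * Cr ^ 2 * (1 / radius x ^ 2)) * Real.exp (-(2 * (1 / (8 * ρ ^ 4)) / m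
        * (tau m (ρ * m) x - flightConst ρ * (m + Cr ^ 2 / m)))))) := by
  have hx2 : 2 * m ≤ radius x := hx
  have hr : 0 < radius x := by linarith
  have hR : 2 * m < ρ * m := by nlinarith
  have hρ0 : 0 < ρ := by linarith
  have hτ0 : 0 < tau m (ρ * m) x :=
    (mul_pos (flightConst_pos hρ) (by positivity)).trans_le hτ
  set Q := Cp * (Cr / m) with hQ
  have hQ0 : 0 < Q := by positivity
  set Γ := 2 * ρ * (m / radius x) * √Q with hΓ
  have hΓ0 : 0 < Γ := by positivity
  set F := dataNorm m (ρ * m) f₀ with hF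
  have hF0 : 0 ≤ F := dataNorm_nonneg _ _ _
  set X := tau m (ρ * m) x - flightConst ρ * (m + Cr ^ 2 / m) with hX
  set D := 9 * ρ * (2 * Q) * Real.exp (-(1 / (2 * ρ ^ 4) / m * X)) with hD
  have hD0 : 0 < D := by positivity
  have hdm : Measurable fun q : E3 => ENNReal.ofReal (energy m x (lift m x q))⁻¹ :=
    (measurable_energy_lift m x).inv.ennreal_ofReal
  set fib : Set E3 := {q | (x, lift m x q) ∈ massShell m} with hfib
  have hfm : MeasurableSet fib := measurableSet_fibre hm hx
  have h1 : moment m w f x ≤ ∫⁻ q, fib.indicator (fun q => ENNReal.ofReal (energy m x (lift m x q))⁻¹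
      * ENNReal.ofReal (w (x, lift m x q) * f (x, lift m x q))) q := by
    rw [lintegral_indicator hfm]
    -- Only an upper bound is needed; it requires measurability of the density alone.
    exact lintegral_withDensity_le_lintegral_mul _ hdm _
  -- As L = r|p̸|, the slab has slope r `trapSlope` in the variables (p^r, |p̸|), and L ≤ C_r C_p
  -- bounds |p̸| by A.
  have h2 := lintegral_fibre_le (x := x) hr.ne' (trapSlope m (radius x) * radius x)
    (A := Cr * Cp / radius x) (D := D) (by positivity) hD0
    (ENNReal.ofReal (Wb * F) * ENNReal.ofReal Γ)
    (G := fib.indicator (fun q => ENNReal.ofReal (energy m x (lift m x q))⁻¹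
      * ENNReal.ofReal (w (x, lift m x q) * f (x, lift m x q)))) (fun q hq => by
    have hqf : q ∈ fib := by
      by_contra hc
      exact hq (indicator_of_notMem hc _)
    rw [indicator_of_mem hqf] at hq ⊢
    have hmem : (x, lift m x q) ∈ massShellFuture m (ρ * m) := ⟨hqf, hτ0⟩
    have hne : f (x, lift m x q) ≠ 0 := by
      intro h; rw [h] at hq; simp at hq
    have b := supportBounds_of_ne_zero hm hρ hCp h₀ hf hmem hne
    obtain ⟨hf0, hfF⟩ := value_bounds hm hR h₀ hf hmem
    have hP : pr x (lift m x q) = pr x (0, q) := rfl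
    have hN : angNorm x (lift m x q) = angNorm x (0, q) := rfl
    have hL : angMom x (lift m x q) = radius x * angNorm x (0, q) := rfl
    refine ⟨?_, ?_, ?_⟩
    · rw [le_div_iff₀ hr, mul_comm, ← hL]; exact b.angMom_le
    · have h3 := (b.late hτ).1
      rw [hL, hP, ← mul_assoc] at h3
      exact h3
    · have h3 := b.sqrt_pr_mul_angNorm_le hm hρ hCp hx2 hτ
      rw [hP, hN] at h3
      have h4 := ofReal_inv_le_invSqrt_mul b.energy_nonneg hΓ0 h3
      have h5 : ENNReal.ofReal (w (x, lift m x q) * f (x, lift m x q)) ≤ ENNReal.ofReal (Wb * F) := by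
        refine ENNReal.ofReal_le_ofReal ?_
        calc w (x, lift m x q) * f (x, lift m x q) ≤ Wb * f (x, lift m x q) :=
              mul_le_mul_of_nonneg_right (hw _ hmem hne b) hf0
          _ ≤ Wb * F := mul_le_mul_of_nonneg_left hfF hWb
      rw [mul_assoc, mul_comm (ENNReal.ofReal (Wb * F))]
      exact mul_le_mul' h4 h5)
  refine h1.trans (h2.trans ?_)
  rw [← ENNReal.ofReal_mul (by positivity), ← ENNReal.ofReal_mul (by positivity)]
  refine ENNReal.ofReal_le_ofReal ?_
  -- The square root halves the rate 1/(2ρ⁴) to 1/(4ρ⁴) = 2c. One √Q here and one in Γ combine to Q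
  -- = C_p C_r/m, whose m cancels against Γ.
  have hsD : √D ≤ 3 * ρ * √Q * Real.exp (-(2 * (1 / (8 * ρ ^ 4)) / m * X)) := by
    refine Real.sqrt_le_iff.2 ⟨by positivity, ?_⟩
    have he : Real.exp (-(1 / (2 * ρ ^ 4) / m * X))
        = Real.exp (-(2 * (1 / (8 * ρ ^ 4)) / m * X)) ^ 2 := by
      rw [← Real.exp_nat_mul]
      congr 1
      push_cast
      ring
    rw [hD, he, mul_pow, mul_pow, Real.sq_sqrt hQ0.le]
    have : 18 * ρ ≤ (3 * ρ) ^ 2 := by nlinarith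
    have h5 : 0 ≤ Q * Real.exp (-(2 * (1 / (8 * ρ ^ 4)) / m * X)) ^ 2 := by positivity
    nlinarith [mul_le_mul_of_nonneg_right this h5]
  calc Wb * F * Γ * (96 * (Cr * Cp / radius x) * √D)
      ≤ Wb * F * Γ * (96 * (Cr * Cp / radius x)
        * (3 * ρ * √Q * Real.exp (-(2 * (1 / (8 * ρ ^ 4)) / m * X)))) := by gcongr
    _ = Wb * F * (576 * ρ ^ 2 * (m * (√Q) ^ 2 * Cr * Cp * (1 / radius x ^ 2))
        * Real.exp (-(2 * (1 / (8 * ρ ^ 4)) / m * X))) := by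
        rw [hΓ]; field_simp; ring
    _ = _ := by
        rw [Real.sq_sqrt hQ0.le, hQ]
        field_simp

theorem continuousAt_pr {z : Phase} (hz : radius z.1 ≠ 0) :
    ContinuousAt (fun z : Phase => pr z.1 z.2) z := by
  unfold pr radius at *
  exact ContinuousAt.div (by fun_prop) (by fun_prop) hz

theorem continuousAt_angNorm {z : Phase} (hz : radius z.1 ≠ 0) :
    ContinuousAt (fun z : Phase => angNorm z.1 z.2) z := by
  have h := continuousAt_pr hz
  unfold angNorm radius at *
  exact ((by fun_prop : ContinuousAt (fun z : Phase => z.2.2) z).sub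
    ((h.div (by fun_prop) hz).smul (by fun_prop))).norm

/-- A weight that is bounded in `x` is bounded on the support of the solution. -/
theorem bddAbove_weight {m ρ Cr Cp : ℝ} {f₀ f w : Phase → ℝ} (hm : 0 < m) (hρ : 3 < ρ)
    (hCr : 0 < Cr) (hCp : 0 < Cp) (h₀ : IsInitialDatum m (ρ * m) Cr Cp f₀)
    (hf : IsVlasovSolution m (ρ * m) f₀ f) (hw : BoundedInX m w) :
    BddAbove ((fun z => |w z|) '' suppOn (massShellFuture m (ρ * m)) f) := by
  set K := 2 * (Cp * (Cr / m)) + Cp with hK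
  have hK0 : 0 < K := by positivity
  refine (hw K hK0).mono (image_mono ?_)
  rintro z ⟨hzc, hzS⟩
  have hr : 0 < radius z.1 := by
    have : 2 * m ≤ radius z.1 := hzS.1.1
    linarith
  have key : ∀ y ∈ {z ∈ massShellFuture m (ρ * m) | f z ≠ 0},
      y.2.1 ≤ K ∧ |pr y.1 y.2| ≤ K ∧ angNorm y.1 y.2 ≤ K := by
    rintro ⟨x, p⟩ ⟨hy, hne⟩
    have b := supportBounds_of_ne_zero hm hρ hCp h₀ hf hy hne
    have hP := b.abs_pr_le.trans b.energy_le
    have hx : 2 * m ≤ radius x := hy.1.1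
    have h1 : 0 < Cp * (Cr / m) := by positivity
    refine ⟨?_, ?_, ?_⟩
    · linarith [b.k_le, (abs_le.1 hP).1]
    · change |pr x p| ≤ K
      linarith
    · change angNorm x p ≤ K
      have h2 : m * angNorm x p ≤ Cr * Cp := by
        refine le_trans ?_ b.angMom_le
        exact mul_le_mul_of_nonneg_right (by linarith) (norm_nonneg _)
      have h3 : angNorm x p ≤ Cp * (Cr / m) := by
        rw [← mul_div_assoc, le_div_iff₀ hm]; linarith
      linarith
  -- The support is a relative closure, so the bounds pass to limit points by continuity of the
  -- components, which holds as r > 0.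
  have hcl : ∀ g : Phase → ℝ, ContinuousAt g z →
      (∀ y ∈ {z ∈ massShellFuture m (ρ * m) | f z ≠ 0}, g y ≤ K) → g z ≤ K := fun g hg hb =>
    ContinuousWithinAt.closure_le hzc hg.continuousWithinAt continuousWithinAt_const hb
  exact ⟨hzS.1, hcl (fun z => z.2.1) (by fun_prop) fun y hy => (key y hy).1,
    hcl (fun z => |pr z.1 z.2|) (continuousAt_pr hr.ne').abs fun y hy => (key y hy).2.1,
    hcl (fun z => angNorm z.1 z.2) (continuousAt_angNorm hr.ne') fun y hy => (key y hy).2.2⟩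

theorem weightSup_nonneg (m R : ℝ) (w f : Phase → ℝ) : 0 ≤ weightSup m R w f :=
  Real.sSup_nonneg (by rintro _ ⟨z, -, rfl⟩; exact abs_nonneg _)

theorem le_weightSup {m R : ℝ} {w f : Phase → ℝ}
    (h : BddAbove ((fun z => |w z|) '' suppOn (massShellFuture m R) f)) {z : Phase}
    (hz : z ∈ massShellFuture m R) (hne : f z ≠ 0) : w z ≤ weightSup m R w f :=
  (le_abs_self _).trans (le_csSup h ⟨z, ⟨subset_closure ⟨hz, hne⟩, hz⟩, rfl⟩)

/-! ### Particular weights -/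

theorem abs_trapSlope_mul {m r : ℝ} (hm : 0 < m) (hr : 0 < r) :
    |trapSlope m r| * m = √(1 / 27 - m ^ 2 / r ^ 2 * Omega2 m r) := by
  have h : 1 / 27 - m ^ 2 / r ^ 2 * Omega2 m r = (|trapSlope m r| * m) ^ 2 := by
    rw [mul_pow, sq_abs, trapSlope_sq hm hr, Omega2]
    field_simp
  rw [h, Real.sqrt_sq (by positivity)]

/-- The distance of `|p^r|` from its value on the trapped orbits. -/
theorem abs_abs_pr_sub_le {m : ℝ} {x : Event} (p : Event) (hm : 0 < m) (hr : 0 < radius x) :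
    |(|pr x p| - √(1 / 27 - m ^ 2 / radius x ^ 2 * Omega2 m (radius x)) * (angMom x p / m))|
      ≤ |pr x p - trapSlope m (radius x) * angMom x p| := by
  have h0 : 0 ≤ angMom x p := mul_nonneg hr.le (norm_nonneg _)
  have h1 : √(1 / 27 - m ^ 2 / radius x ^ 2 * Omega2 m (radius x)) * (angMom x p / m)
      = |trapSlope m (radius x) * angMom x p| := by
    rw [← abs_trapSlope_mul hm hr, abs_mul, abs_of_nonneg h0]
    field_simp
  rw [h1]
  exact abs_abs_sub_abs_le _ _

theorem trapSlope_three_mul {m : ℝ} (hm : 0 < m) : trapSlope m (3 * m) = 0 := by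
  have h : trapSlope m (3 * m) ^ 2 = 0 := by
    rw [trapSlope_sq hm (by positivity)]
    field_simp
    ring
  exact pow_eq_zero_iff two_ne_zero |>.1 h

/-- For P ≥ 0 one has (E − P)E ≤ (E − P)(E + P) = ON², so the component is at most N²/E; replacing
one factor N by 2ρmE/r removes E and leaves two powers of C_r/r. On r = ρm, where P may be negative,
C_r/r ≥ 2/ρ makes the trivial bound 6C_p sufficient. -/
theorem outgoing_component_le {m ρ Cr Cp r E P N O : ℝ} (hm : 0 < m) (hρ : 3 < ρ) (hr : 0 < r)
    (hO0 : 0 < O) (hO : 1 / 3 ≤ O) (hC : 2 * m ≤ Cr) (hEC : E ≤ Cp) (hPE : -E ≤ P)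
    (hPE' : P ≤ E) (hN0 : 0 ≤ N) (hN : N ≤ Cp * (Cr / r)) (h2 : r * N ≤ 2 * (ρ * m * E))
    (hNN : (E - P) * (E + P) = O * N ^ 2) (h : r = ρ * m ∨ 0 ≤ P) :
    (E - P) / O ≤ 2 * ρ ^ 2 * Cp * (Cr / r) ^ 2 := by
  have hCr : 0 < Cr := by linarith
  have hE0 : 0 ≤ E := by linarith
  have hCp0 : 0 ≤ Cp := hE0.trans hEC
  rcases h with hreq | hP
  · have h1 : (E - P) / O ≤ 6 * Cp := by
      rw [div_le_iff₀ hO0]; nlinarith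
    have h3 : 2 ≤ ρ * (Cr / r) := by
      rw [← mul_div_assoc, le_div_iff₀ hr, hreq]
      nlinarith
    have h4 : 4 ≤ (ρ * (Cr / r)) ^ 2 := by nlinarith
    have h5 := mul_le_mul_of_nonneg_left h4 hCp0
    have h6 : 2 * ρ ^ 2 * Cp * (Cr / r) ^ 2 = 2 * (Cp * (ρ * (Cr / r)) ^ 2) := by ring
    rw [h6]; linarith
  · rcases hE0.eq_or_lt with h0 | h0
    · have : E - P = 0 := by linarith
      rw [this, zero_div]; positivity
    have h3 : (E - P) / O * E ≤ 2 * ρ * (m / r) * N * E := by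
      have h4 : (E - P) * E ≤ O * N ^ 2 := by
        rw [← hNN]; exact mul_le_mul_of_nonneg_left (by linarith) (by linarith)
      calc (E - P) / O * E = (E - P) * E / O := by ring
        _ ≤ N ^ 2 := by rw [div_le_iff₀ hO0]; linarith
        _ = (r * N) * N / r := by field_simp
        _ ≤ 2 * (ρ * m * E) * N / r := by gcongr
        _ = _ := by ring
    have h5 : (E - P) / O ≤ 2 * ρ * (m / r) * N := le_of_mul_le_mul_right h3 h0
    have hmC : m ≤ Cr := by linarith
    calc (E - P) / O ≤ 2 * ρ * (m / r) * N := h5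
      _ ≤ 2 * ρ * (Cr / r) * (Cp * (Cr / r)) := by gcongr
      _ = ρ * (2 * Cp * (Cr / r) ^ 2) := by ring
      _ ≤ ρ ^ 2 * (2 * Cp * (Cr / r) ^ 2) := by gcongr; nlinarith
      _ = _ := by ring

/-- Bounds for the null components of the momentum in the far region. -/
theorem SupportBounds.far {m ρ Cr Cp : ℝ} {x p : Event} (hm : 0 < m) (hρ : 3 < ρ)
    (hx : ρ * m ≤ radius x) (b : SupportBounds m ρ Cr Cp x p)
    (hτ : flightConst ρ * (m + Cr ^ 2 / m) ≤ tau m (ρ * m) x) :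
    |pv m x p| ≤ 6 * Cp ∧ |pu m x p| ≤ 2 * ρ ^ 2 * Cp * (Cr / radius x) ^ 2 ∧
      angNorm x p ≤ Cp * (Cr / radius x) := by
  have hρm : 3 * m < ρ * m := by nlinarith
  have hr : 0 < radius x := by linarith
  have hCr : 0 < Cr := by linarith [b.two_m_le]
  have hE0 := b.energy_nonneg
  have hEC := b.energy_le
  have hPE := abs_le.1 b.abs_pr_le
  have hN0 : 0 ≤ angNorm x p := norm_nonneg _
  obtain ⟨hlate1, hlate2⟩ := (b.late hτ).2 hx
  have hnull := b.null
  have hL := b.angMom_le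
  have hLdef : angMom x p = radius x * angNorm x p := rfl
  have hO : 1 / 3 ≤ Omega2 m (radius x) := by
    have : 2 * m / radius x ≤ 2 / 3 := by rw [div_le_iff₀ hr]; linarith
    unfold Omega2; linarith
  have hO1 : Omega2 m (radius x) ≤ 1 := by
    have : 0 < 2 * m / radius x := by positivity
    unfold Omega2; linarith
  have hO0 : 0 < Omega2 m (radius x) := by linarith
  have hpt : pt m x p = energy m x p / Omega2 m (radius x) := by
    unfold pt energy; field_simp
  have hpv : pv m x p = (energy m x p + pr x p) / Omega2 m (radius x) := by
    unfold pv prStar; rw [hpt]; ring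
  have hpu : pu m x p = (energy m x p - pr x p) / Omega2 m (radius x) := by
    unfold pu prStar; rw [hpt]; ring
  have hk : (p.1 + pr x p) * Omega2 m (radius x) = energy m x p + pr x p := by
    unfold energy; ring
  set E := energy m x p
  set P := pr x p
  set O := Omega2 m (radius x)
  set N := angNorm x p
  set r := radius x
  have hCp0 : 0 ≤ Cp := hE0.trans hEC
  have hN : N ≤ Cp * (Cr / r) := by
    rw [← mul_div_assoc, le_div_iff₀ hr]; linarith
  have hpvn : 0 ≤ (E + P) / O := div_nonneg (by linarith) hO0.le
  have hpun : 0 ≤ (E - P) / O := div_nonneg (by linarith) hO0.le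
  refine ⟨?_, ?_, hN⟩
  · rw [hpv, abs_of_nonneg hpvn, div_le_iff₀ hO0]
    nlinarith
  rw [hpu, abs_of_nonneg hpun]
  have hNN : (E - P) * (E + P) = O * N ^ 2 := by
    have h : r ^ 2 * ((p.1 + P) * (E - P)) = r ^ 2 * N ^ 2 := by
      rw [← mul_pow, ← hLdef, ← hnull]; ring
    rw [← mul_left_cancel₀ (pow_ne_zero 2 hr.ne') h, ← hk]; ring
  have hω : 1 / 4 ≤ 1 - 2 / ρ := by
    have : 2 / ρ ≤ 3 / 4 := by rw [div_le_iff₀ (by linarith)]; linarith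
    linarith
  have h2 : r * N ≤ 2 * (ρ * m * E) := by
    refine abs_le_of_sq_le_sq' ?_ (by positivity) |>.2
    rw [← hLdef]
    have := mul_le_mul_of_nonneg_right hω (sq_nonneg (angMom x p))
    linarith
  exact outgoing_component_le hm hρ hr hO0 hO b.two_m_le hEC hPE.1 hPE.2 hN0 hN h2 hNN hlate2

/-- Absorbs the constants of the weight and of the basic estimate into a single power. -/
theorem mul_rpow_two_add_le {A B s t : ℝ} (hB : 1 ≤ B) (hBA : B ≤ A) (hs : 0 ≤ s) (hst : s ≤ t) :
    A * B ^ s ≤ A ^ (2 + t) := by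
  have hA : 1 ≤ A := hB.trans hBA
  calc A * B ^ s ≤ A ^ (2 : ℝ) * A ^ t := by
        refine mul_le_mul ?_ ?_ (by positivity) (by positivity)
        · exact Real.self_le_rpow_of_one_le hA (by norm_num)
        · exact (Real.rpow_le_rpow (by linarith) hBA hs).trans (Real.rpow_le_rpow_of_exponent_le hA hst)
    _ = A ^ (2 + t) := (Real.rpow_add (by linarith) _ _).symm

/-- On the support the weight is at most D^a C_p^b, with D the width of the slab. D decays at the
rate 4c/m, so the total rate is (2 + 4a)c/m, which exceeds the one claimed. -/
theorem moment_weightAB_le {m ρ Cr Cp a b : ℝ} {f₀ f : Phase → ℝ} (hm : 0 < m) (hρ : 3 < ρ)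
    (hCr : 0 < Cr) (hCp : 0 < Cp) (h₀ : IsInitialDatum m (ρ * m) Cr Cp f₀)
    (hf : IsVlasovSolution m (ρ * m) f₀ f) (ha : 0 < a) (hb : 0 < b) {x : Event}
    (hx : x ∈ exterior m) (hτ : flightConst ρ * (m + Cr ^ 2 / m) ≤ tau m (ρ * m) x) :
    moment m (weightAB m a b) f x ≤ ENNReal.ofReal ((576 * ρ ^ 2) ^ (2 + a + b)
      * dataNorm m (ρ * m) f₀ * (Cr ^ (2 + a) * Cp ^ (2 + a + b) / m ^ a) * (1 / radius x ^ 2)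
      * Real.exp (-(1 / (8 * ρ ^ 4) * min (1 + a) (3 + 2 * b) / m)
        * (tau m (ρ * m) x - flightConst ρ * (m + Cr ^ 2 / m)))) := by
  have hρ0 : 0 < ρ := by linarith
  have hx2 : 2 * m ≤ radius x := hx
  have hr : 0 < radius x := by linarith
  have hF0 := dataNorm_nonneg m (ρ * m) f₀
  set X := tau m (ρ * m) x - flightConst ρ * (m + Cr ^ 2 / m) with hX
  have hX0 : 0 ≤ X := sub_nonneg.2 hτ
  set η := Real.exp (-(1 / (2 * ρ ^ 4) / m * X)) with hη
  have hη0 : 0 < η := Real.exp_pos _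
  refine (moment_le (Wb := (9 * ρ * (2 * (Cp * (Cr / m))) * η) ^ a * Cp ^ b) hm hρ hCr hCp h₀ hf hx hτ
    (by positivity) (fun p _ _ B => ?_)).trans (ENNReal.ofReal_le_ofReal ?_)
  · unfold weightAB
    refine mul_le_mul ?_ ?_ (by positivity) (by positivity)
    · exact Real.rpow_le_rpow (abs_nonneg _)
        ((abs_abs_pr_sub_le p hm hr).trans (B.late hτ).1) ha.le
    · exact Real.rpow_le_rpow (abs_nonneg _) (B.abs_pr_le.trans B.energy_le) hb.le
  · have h1 : (9 * ρ * (2 * (Cp * (Cr / m))) * η) ^ a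
        = (18 * ρ) ^ a * (Cp ^ a * (Cr ^ a / m ^ a)) * η ^ a := by
      rw [← Real.div_rpow hCr.le hm.le, ← Real.mul_rpow hCp.le (by positivity),
        ← Real.mul_rpow (by positivity) (by positivity), ← Real.mul_rpow (by positivity) hη0.le]
      congr 1
      ring
    have h2 : η ^ a * Real.exp (-(2 * (1 / (8 * ρ ^ 4)) / m * X))
        ≤ Real.exp (-(1 / (8 * ρ ^ 4) * min (1 + a) (3 + 2 * b) / m) * X) := by
      rw [hη, ← Real.exp_mul, ← Real.exp_add]
      refine Real.exp_le_exp.2 ?_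
      have h3 : min (1 + a) (3 + 2 * b) ≤ 2 + 4 * a := (min_le_left _ _).trans (by linarith)
      have h4 : 0 ≤ 1 / (8 * ρ ^ 4) / m * X := by positivity
      have h5 := mul_le_mul_of_nonneg_left h3 h4
      have e1 : -(1 / (8 * ρ ^ 4) * min (1 + a) (3 + 2 * b) / m) * X
          = -(1 / (8 * ρ ^ 4) / m * X * min (1 + a) (3 + 2 * b)) := by ring
      have e2 : -(1 / (2 * ρ ^ 4) / m * X) * a + -(2 * (1 / (8 * ρ ^ 4)) / m * X)
          = -(1 / (8 * ρ ^ 4) / m * X * (2 + 4 * a)) := by ring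
      rw [e1, e2]; linarith
    have h3 : 576 * ρ ^ 2 * (18 * ρ) ^ a ≤ (576 * ρ ^ 2) ^ (2 + a + b) := by
      rw [add_assoc]
      exact mul_rpow_two_add_le (by linarith) (by nlinarith) ha.le (by linarith)
    have e1 : Cr ^ (2 + a) = Cr ^ 2 * Cr ^ a := by
      rw [Real.rpow_add hCr, Real.rpow_two]
    have e2 : Cp ^ (2 + a + b) = Cp ^ 2 * Cp ^ a * Cp ^ b := by
      rw [Real.rpow_add hCp, Real.rpow_add hCp, Real.rpow_two]
    calc (9 * ρ * (2 * (Cp * (Cr / m))) * η) ^ a * Cp ^ b * dataNorm m (ρ * m) f₀ * (576 * ρ ^ 2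
          * (Cp ^ 2 * Cr ^ 2 * (1 / radius x ^ 2)) * Real.exp (-(2 * (1 / (8 * ρ ^ 4)) / m * X)))
        = (576 * ρ ^ 2 * (18 * ρ) ^ a) * dataNorm m (ρ * m) f₀
          * (Cr ^ (2 + a) * Cp ^ (2 + a + b) / m ^ a) * (1 / radius x ^ 2)
          * (η ^ a * Real.exp (-(2 * (1 / (8 * ρ ^ 4)) / m * X))) := by rw [h1, e1, e2]; ring
      _ ≤ _ := by gcongr

/-- On the photon sphere `trapSlope` vanishes, so the stable coordinate is p^r itself and the weight
is at most D^κ. The prefactor 1/r² becomes 1/(9m²). -/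
theorem moment_pr_le {m ρ Cr Cp κ : ℝ} {f₀ f : Phase → ℝ} (hm : 0 < m) (hρ : 3 < ρ)
    (hCr : 0 < Cr) (hCp : 0 < Cp) (h₀ : IsInitialDatum m (ρ * m) Cr Cp f₀)
    (hf : IsVlasovSolution m (ρ * m) f₀ f) (hκ : 0 < κ) {x : Event}
    (hx : radius x = 3 * m) (hτ : flightConst ρ * (m + Cr ^ 2 / m) ≤ tau m (ρ * m) x) :
    moment m (fun z => |pr z.1 z.2| ^ κ) f x ≤ ENNReal.ofReal ((576 * ρ ^ 2) ^ (2 + κ)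
      * dataNorm m (ρ * m) f₀ * (Cr ^ (2 + κ) * Cp ^ (2 + κ) / m ^ (2 + κ))
      * Real.exp (-(1 / (8 * ρ ^ 4) / m) * (1 + κ)
        * (tau m (ρ * m) x - flightConst ρ * (m + Cr ^ 2 / m)))) := by
  have hρ0 : 0 < ρ := by linarith
  have hxe : x ∈ exterior m := by
    change 2 * m ≤ radius x
    linarith
  have hF0 := dataNorm_nonneg m (ρ * m) f₀
  set X := tau m (ρ * m) x - flightConst ρ * (m + Cr ^ 2 / m) with hX
  have hX0 : 0 ≤ X := sub_nonneg.2 hτ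
  set η := Real.exp (-(1 / (2 * ρ ^ 4) / m * X)) with hη
  have hη0 : 0 < η := Real.exp_pos _
  refine (moment_le (Wb := (9 * ρ * (2 * (Cp * (Cr / m))) * η) ^ κ) hm hρ hCr hCp h₀ hf hxe hτ
    (by positivity) (fun p _ _ B => ?_)).trans (ENNReal.ofReal_le_ofReal ?_)
  · refine Real.rpow_le_rpow (abs_nonneg _) ?_ hκ.le
    have h := (B.late hτ).1
    rwa [hx, trapSlope_three_mul hm, zero_mul, sub_zero] at h
  · have h1 : (9 * ρ * (2 * (Cp * (Cr / m))) * η) ^ κ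
        = (18 * ρ) ^ κ * (Cp ^ κ * (Cr ^ κ / m ^ κ)) * η ^ κ := by
      rw [← Real.div_rpow hCr.le hm.le, ← Real.mul_rpow hCp.le (by positivity),
        ← Real.mul_rpow (by positivity) (by positivity), ← Real.mul_rpow (by positivity) hη0.le]
      congr 1
      ring
    have h2 : η ^ κ * Real.exp (-(2 * (1 / (8 * ρ ^ 4)) / m * X))
        ≤ Real.exp (-(1 / (8 * ρ ^ 4) / m) * (1 + κ) * X) := by
      rw [hη, ← Real.exp_mul, ← Real.exp_add]
      refine Real.exp_le_exp.2 ?_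
      have h4 : 0 ≤ 1 / (8 * ρ ^ 4) / m * X := by positivity
      have h5 := mul_le_mul_of_nonneg_left (by linarith : 1 + κ ≤ 2 + 4 * κ) h4
      have e1 : -(1 / (8 * ρ ^ 4) / m) * (1 + κ) * X = -(1 / (8 * ρ ^ 4) / m * X * (1 + κ)) := by ring
      have e2 : -(1 / (2 * ρ ^ 4) / m * X) * κ + -(2 * (1 / (8 * ρ ^ 4)) / m * X)
          = -(1 / (8 * ρ ^ 4) / m * X * (2 + 4 * κ)) := by ring
      rw [e1, e2]; linarith
    have h3 : 576 * ρ ^ 2 * (18 * ρ) ^ κ ≤ (576 * ρ ^ 2) ^ (2 + κ) :=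
      mul_rpow_two_add_le (by linarith) (by nlinarith) hκ.le le_rfl
    have e : ∀ {y : ℝ}, 0 < y → y ^ (2 + κ) = y ^ 2 * y ^ κ := fun hy => by
      rw [Real.rpow_add hy, Real.rpow_two]
    calc (9 * ρ * (2 * (Cp * (Cr / m))) * η) ^ κ * dataNorm m (ρ * m) f₀ * (576 * ρ ^ 2
          * (Cp ^ 2 * Cr ^ 2 * (1 / radius x ^ 2)) * Real.exp (-(2 * (1 / (8 * ρ ^ 4)) / m * X)))
        = 1 / 9 * ((576 * ρ ^ 2 * (18 * ρ) ^ κ) * dataNorm m (ρ * m) f₀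
          * (Cr ^ (2 + κ) * Cp ^ (2 + κ) / m ^ (2 + κ))
          * (η ^ κ * Real.exp (-(2 * (1 / (8 * ρ ^ 4)) / m * X)))) := by
          rw [h1, e hCr, e hCp, e hm, hx]
          field_simp
          ring
      _ ≤ 1 * ((576 * ρ ^ 2 * (18 * ρ) ^ κ) * dataNorm m (ρ * m) f₀
          * (Cr ^ (2 + κ) * Cp ^ (2 + κ) / m ^ (2 + κ))
          * (η ^ κ * Real.exp (-(2 * (1 / (8 * ρ ^ 4)) / m * X)))) := by
          gcongr
          norm_num
      _ ≤ _ := by rw [one_mul]; gcongr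

theorem exp_two_mul_rate_le {m ρ X : ℝ} (hm : 0 < m) (hρ : 3 < ρ) (hX : 0 ≤ X) :
    Real.exp (-(2 * (1 / (8 * ρ ^ 4)) / m * X)) ≤ Real.exp (-(1 / (8 * ρ ^ 4) / m) * X) := by
  have hρ0 : 0 < ρ := by linarith
  refine Real.exp_le_exp.2 ?_
  have h4 : 0 ≤ 1 / (8 * ρ ^ 4) / m * X := by positivity
  have e1 : -(2 * (1 / (8 * ρ ^ 4)) / m * X) = -(2 * (1 / (8 * ρ ^ 4) / m * X)) := by ring
  rw [e1, neg_mul]; linarith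

/-- The powers of C_r/r add up as 2 from the basic estimate, 2b from p^u and d from p̸, while p^v is
merely bounded. -/
theorem moment_far_le {m ρ Cr Cp a b d : ℝ} {f₀ f : Phase → ℝ} (hm : 0 < m) (hρ : 3 < ρ)
    (hCr : 0 < Cr) (hCp : 0 < Cp) (h₀ : IsInitialDatum m (ρ * m) Cr Cp f₀)
    (hf : IsVlasovSolution m (ρ * m) f₀ f) (ha : 0 ≤ a) (hb : 0 ≤ b) (hd : 0 ≤ d) {x : Event}
    (hx : ρ * m ≤ radius x) (hτ : flightConst ρ * (m + Cr ^ 2 / m) ≤ tau m (ρ * m) x) :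
    moment m (fun z => |pv m z.1 z.2| ^ a * |pu m z.1 z.2| ^ b * angNorm z.1 z.2 ^ d) f x ≤
      ENNReal.ofReal ((576 * ρ ^ 2) ^ (2 + a + b + d) * dataNorm m (ρ * m) f₀ * Cp ^ (2 + a + b + d)
        * (Cr ^ (2 * (1 + b) + d) / radius x ^ (2 * (1 + b) + d))
        * Real.exp (-(1 / (8 * ρ ^ 4) / m)
          * (tau m (ρ * m) x - flightConst ρ * (m + Cr ^ 2 / m)))) := by
  have hρ0 : 0 < ρ := by linarith
  have hρm : 2 * m < ρ * m := by nlinarith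
  have hr : 0 < radius x := by linarith
  have hxe : x ∈ exterior m := hρm.le.trans hx
  have hF0 := dataNorm_nonneg m (ρ * m) f₀
  set X := tau m (ρ * m) x - flightConst ρ * (m + Cr ^ 2 / m) with hX
  have hX0 : 0 ≤ X := sub_nonneg.2 hτ
  set q := Cr / radius x with hq
  have hq0 : 0 < q := by positivity
  refine (moment_le (Wb := (6 * Cp) ^ a * (2 * ρ ^ 2 * Cp * q ^ 2) ^ b * (Cp * q) ^ d) hm hρ hCr hCp
    h₀ hf hxe hτ (by positivity) (fun p _ _ B => ?_)).trans (ENNReal.ofReal_le_ofReal ?_)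
  · obtain ⟨h1, h2, h3⟩ := B.far hm hρ hx hτ
    refine mul_le_mul (mul_le_mul ?_ ?_ (by positivity) (by positivity)) ?_
      (Real.rpow_nonneg (norm_nonneg _) _) (by positivity)
    · exact Real.rpow_le_rpow (abs_nonneg _) h1 ha
    · exact Real.rpow_le_rpow (abs_nonneg _) h2 hb
    · exact Real.rpow_le_rpow (norm_nonneg _) h3 hd
  · set A := 576 * ρ ^ 2 with hA
    have hA1 : 576 ≤ A := by nlinarith
    have e1 : Cp ^ (2 + a + b + d) = Cp ^ 2 * Cp ^ a * Cp ^ b * Cp ^ d := by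
      rw [Real.rpow_add hCp, Real.rpow_add hCp, Real.rpow_add hCp, Real.rpow_two]
    have e2 : Cr ^ (2 * (1 + b) + d) / radius x ^ (2 * (1 + b) + d) = q ^ 2 * (q ^ 2) ^ b * q ^ d := by
      rw [← Real.div_rpow hCr.le hr.le, ← hq, Real.rpow_add hq0, Real.rpow_mul hq0.le, Real.rpow_two,
        Real.rpow_add (by positivity), Real.rpow_one]
    have h1 : 6 ^ a * (2 * ρ ^ 2) ^ b ≤ A ^ (a + b) := by
      rw [Real.rpow_add (by positivity)]
      exact mul_le_mul (Real.rpow_le_rpow (by norm_num) (by linarith) ha)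
        (Real.rpow_le_rpow (by positivity) (by nlinarith) hb) (by positivity) (by positivity)
    have h2 : A * (6 ^ a * (2 * ρ ^ 2) ^ b) ≤ A ^ (2 + a + b + d) := by
      have : A * A ^ (a + b) ≤ A ^ (2 + (a + b + d)) :=
        mul_rpow_two_add_le (by linarith) le_rfl (by linarith) (by linarith)
      rw [show 2 + a + b + d = 2 + (a + b + d) by ring]
      exact (mul_le_mul_of_nonneg_left h1 (by positivity)).trans this
    have hE := exp_two_mul_rate_le hm hρ hX0
    calc (6 * Cp) ^ a * (2 * ρ ^ 2 * Cp * q ^ 2) ^ b * (Cp * q) ^ d * dataNorm m (ρ * m) f₀ * (A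
          * (Cp ^ 2 * Cr ^ 2 * (1 / radius x ^ 2)) * Real.exp (-(2 * (1 / (8 * ρ ^ 4)) / m * X)))
        = (A * (6 ^ a * (2 * ρ ^ 2) ^ b)) * dataNorm m (ρ * m) f₀ * Cp ^ (2 + a + b + d)
          * (Cr ^ (2 * (1 + b) + d) / radius x ^ (2 * (1 + b) + d))
          * Real.exp (-(2 * (1 / (8 * ρ ^ 4)) / m * X)) := by
          rw [e1, e2, Real.mul_rpow (by norm_num) hCp.le, Real.mul_rpow (by positivity) (by positivity),
            Real.mul_rpow (by positivity) hCp.le, Real.mul_rpow hCp.le hq0.le,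
            show Cp ^ 2 * Cr ^ 2 * (1 / radius x ^ 2) = Cp ^ 2 * q ^ 2 by rw [hq]; ring]
          ring
      _ ≤ _ := by gcongr

end SchwarzschildVlasov

end

/-! ### The theorem -/

open SchwarzschildVlasov in
theorem theorem3p2 :
    ∀ ρ : ℝ, 3 < ρ → ∃ C C₀ c : ℝ, 0 < C ∧ 0 < C₀ ∧ 0 < c ∧
      ∀ m Cr Cp : ℝ, 0 < m → 0 < Cr → 0 < Cp → ∀ R τ₀ : ℝ, R = ρ * m → τ₀ = C₀ * (m + Cr ^ 2 / m) →
      ∀ f₀ f : Phase → ℝ, IsInitialDatum m R Cr Cp f₀ → IsVlasovSolution m R f₀ f →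
        (∀ w : Phase → ℝ, (∀ z ∈ massShell m, 0 ≤ w z) → (Measurable fun z : massShell m => w z) →
          BoundedInX m w →
          BddAbove ((fun z => |w z|) '' suppOn (massShellFuture m R) f) ∧
          (∀ x ∈ exterior m, τ₀ ≤ tau m R x →
            moment m w f x ≤ ENNReal.ofReal (C * weightSup m R w f * dataNorm m R f₀ * Cp ^ 2 * Cr ^ 2
              * (1 / radius x ^ 2) * Real.exp (-(c / m) * (tau m R x - τ₀)))) ∧
          (∀ δ : ℝ, 0 < δ → δ < 1 → ∀ x ∈ exterior m, τ₀ ≤ tau m R x →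
            radius x ∉ Set.Icc ((3 - δ) * m) ((3 + δ) * m) →
            moment m w f x ≤ ENNReal.ofReal (C * weightSup m R w f * dataNorm m R f₀ * Cp ^ 2 * Cr ^ 2
              * (1 / radius x ^ 2) * Real.exp (-(2 * c / m) * (tau m R x - τ₀))))) ∧
        (∀ a b : ℝ, 0 < a → 0 < b → ∀ x ∈ exterior m, τ₀ ≤ tau m R x →
          moment m (weightAB m a b) f x ≤ ENNReal.ofReal (C ^ (2 + a + b) * dataNorm m R f₀
            * (Cr ^ (2 + a) * Cp ^ (2 + a + b) / m ^ a) * (1 / radius x ^ 2)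
            * Real.exp (-(c * min (1 + a) (3 + 2 * b) / m) * (tau m R x - τ₀)))) ∧
        (∀ κ : ℝ, 0 < κ → ∀ x : Event, radius x = 3 * m → τ₀ ≤ tau m R x →
          moment m (fun z => |pr z.1 z.2| ^ κ) f x ≤ ENNReal.ofReal (C ^ (2 + κ) * dataNorm m R f₀
            * (Cr ^ (2 + κ) * Cp ^ (2 + κ) / m ^ (2 + κ))
            * Real.exp (-(c / m) * (1 + κ) * (tau m R x - τ₀)))) ∧
        (∀ a b d : ℝ, 0 ≤ a → 0 ≤ b → 0 ≤ d → ∀ x : Event, R ≤ radius x → τ₀ ≤ tau m R x →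
          moment m (fun z => |pv m z.1 z.2| ^ a * |pu m z.1 z.2| ^ b * angNorm z.1 z.2 ^ d) f x ≤
            ENNReal.ofReal (C ^ (2 + a + b + d) * dataNorm m R f₀ * Cp ^ (2 + a + b + d)
              * (Cr ^ (2 * (1 + b) + d) / radius x ^ (2 * (1 + b) + d))
              * Real.exp (-(c / m) * (tau m R x - τ₀)))) := by
  intro ρ hρ
  have hρ0 : 0 < ρ := by linarith
  refine ⟨576 * ρ ^ 2, flightConst ρ, 1 / (8 * ρ ^ 4), by positivity, flightConst_pos hρ,
    by positivity, ?_⟩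
  rintro m Cr Cp hm hCr hCp _ _ rfl rfl f₀ f h₀ hf
  refine ⟨fun w _ _ hwb => ?_, fun a b ha hb x hx hτ => moment_weightAB_le hm hρ hCr hCp h₀ hf ha hb hx hτ,
    fun κ hκ x hx hτ => moment_pr_le hm hρ hCr hCp h₀ hf hκ hx hτ,
    fun a b d ha hb hd x hx hτ => moment_far_le hm hρ hCr hCp h₀ hf ha hb hd hx hτ⟩
  have hbdd := bddAbove_weight hm hρ hCr hCp h₀ hf hwb
  have hW0 := weightSup_nonneg m (ρ * m) w f
  have hF0 := dataNorm_nonneg m (ρ * m) f₀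
  have key := fun (x : Event) (hx : x ∈ exterior m)
    (hτ : flightConst ρ * (m + Cr ^ 2 / m) ≤ tau m (ρ * m) x) =>
    moment_le hm hρ hCr hCp h₀ hf hx hτ hW0 (fun p hp hne _ => le_weightSup hbdd hp hne)
  -- The basic estimate has the rate 2c at every radius: it is weakened to c for the first bound and
  -- used as it stands for the second.
  refine ⟨hbdd, fun x hx hτ => (key x hx hτ).trans (ENNReal.ofReal_le_ofReal ?_),
    fun δ _ _ x hx hτ _ => (key x hx hτ).trans (ENNReal.ofReal_le_ofReal (le_of_eq ?_))⟩
  · have hE := exp_two_mul_rate_le hm hρ (sub_nonneg.2 hτ)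
    refine le_trans (le_of_eq ?_) (mul_le_mul_of_nonneg_left hE (by positivity))
    ring
  · rw [← neg_mul]
    ring
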